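/- Let $\Omega$ be $\mathbb{R}^3$ or the torus $\mathbb{R}^3/(2\pi\mathbb{Z})^3$. Fix a function $\psi\in C^\infty(\mathbb{R}^3)$ with $\psi(\xi)=1$ for $|\xi|\le \frac12$ and $\psi(\xi)=0$ for $|\xi|>1$, and put $\lambda_q=2^q$, $\varphi(\xi)=\psi(\xi/\lambda_1)-\psi(\xi)$, $\varphi_q(\xi)=\varphi(\xi/\lambda_q)$ for $q\in\mathbb{Z}$. Let $u_q$ be the Littlewood–Paley piece of $u$ with Fourier multiplier $\varphi_q$: $u_q=u*\mathcal{F}^{-1}(\varphi_q)$ on $\mathbb{R}^3$, with $\mathcal{F}^{-1}(\varphi_q)(y)=(2\pi)^{-3}\int\varphi_q(\xi)e^{i\xi\cdot y}\,d\xi$, and $u_q(x)=\sum_{k\in\mathbb{Z}^3}\hat u(k)\varphi_q(k)e^{ik\cdot x}$ on the torus. There is a constant $C>0$, depending only on $\psi$, such that the following holds for both domains, all $\nu>0$ and all $T>0$. Let $u$ be a smooth solution on $(0,T)\times\Omega$, with smooth pressure $p$, of the incompressible Navier–Stokes equations $$\partial_t u+(u\cdot\nabla)u=-\nabla p+\nu\Delta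 u,\qquad \nabla\cdot u=0,$$ with finite-energy initial data, that is, $u(t)\to u_0$ in $L^2(\Omega)$ as $t\to0^+$ for some $u_0\in L^2(\Omega)$. (Smooth means that $u$ is $C^\infty$ on $(0,T)\times\Omega$ and that $u\in L^\infty_{\mathrm{loc}}((0,T);H^m(\Omega))$ for every $m\ge0$; on the torus, where $u$ and $p$ are periodic, the second condition follows from the first.) Then for every $t\in(0,T)$ the pieces $u_q(t)$ are in $L^2(\Omega)$, the series $\sum_{q\in\mathbb{Z}}\lambda_q^3\|u_q(t)\|_2^2$ converges, its sum is differentiable in time at $t$, and $$\frac{d}{dt}\sum_{q\in\mathbb{Z}}\lambda_q^3\|u_q\|_2^2\;\le\;\frac{C}{\nu}\sum_{q\in\mathbb{Z}}\bigl(\lambda_q^3\|u_q\|_2^2\bigr)^2 .$$ In particular, also $$\frac{d}{dt}\sum_{q\in\mathbb{Z}}\lambda_q^3\|u_q\|_2^2\;\le\;\frac{C}{\nu}\Bigl(\sum_{q\in\mathbb{Z}}\lambda_q^3\|u_q\|_2^2\Bigr)^2 .$$ -/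

import Mathlib

open MeasureTheory Set Filter Topology
open scoped ContDiff FourierTransform

noncomputable section

namespace NSE

/-- Physical (and frequency) space `ℝ³`. -/
abbrev E3 : Type := EuclideanSpace ℝ (Fin 3)

/-- The space of values of the Littlewood-Paley pieces. The cutoff need not be even, so the pieces
of a real vector field may be complex. -/
abbrev C3 : Type := EuclideanSpace ℂ (Fin 3)

/-- The spatial domain: the whole space `ℝ³`, or the torus `ℝ³ / (2πℤ)³`. Functions on the
torus are functions on `ℝ³` that are `2π`-periodic in each coordinate. -/
inductive SpatialDomain : Type
  | space
  | torus

namespace SpatialDomain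

/-- A fundamental cell: all of `ℝ³`, or the cube `[0, 2π)³`. -/
def cell : SpatialDomain → Set E3
  | space => univ
  | torus => {x | ∀ i, x i ∈ Ico (0 : ℝ) (2 * Real.pi)}

/-- Lebesgue measure on the domain. -/
def vol (Ω : SpatialDomain) : Measure E3 := volume.restrict Ω.cell

/-- `f` is a function on the domain: no condition on `ℝ³`, periodicity on the torus. -/
def IsFunctionOn {F : Type} (Ω : SpatialDomain) (f : E3 → F) : Prop :=
  match Ω with
  | space => True
  | torus => ∀ (i : Fin 3) (x : E3), f (x + EuclideanSpace.single i (2 * Real.pi)) = f x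

end SpatialDomain

/-! ### Littlewood-Paley decomposition -/

/-- The cutoff `ψ`: smooth, equal to `1` for `|ξ| ≤ 1/2` and to `0` for `|ξ| > 1`. -/
structure IsCutoff (ψ : E3 → ℝ) : Prop where
  smooth : ContDiff ℝ ∞ ψ
  eq_one : ∀ ξ, ‖ξ‖ ≤ 1 / 2 → ψ ξ = 1
  eq_zero : ∀ ξ, 1 < ‖ξ‖ → ψ ξ = 0

/-- The wave number `λ_q = 2^q`. -/
def lam (q : ℤ) : ℝ := (2 : ℝ) ^ q

/-- `φ(ξ) = ψ(ξ / λ₁) - ψ(ξ)`. -/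
def phi (ψ : E3 → ℝ) (ξ : E3) : ℝ := ψ ((lam 1)⁻¹ • ξ) - ψ ξ

/-- `φ_q(ξ) = φ(ξ / λ_q)`. -/
def phiq (ψ : E3 → ℝ) (q : ℤ) (ξ : E3) : ℝ := phi ψ ((lam q)⁻¹ • ξ)

/-- The convolution kernel `y ↦ (2π)⁻³ ∫ φ_q(ξ) e^{i ξ·y} dξ`, the inverse Fourier transform of
`φ_q` in the convention whose frequencies match the modes `e^{i k·x}` of the torus. Mathlib's `𝓕⁻`
has the phase `e^{2π i η·y}`, hence the substitution `ξ = 2π η`. -/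
def lpKernel (ψ : E3 → ℝ) (q : ℤ) : E3 → ℂ :=
  𝓕⁻ (fun η : E3 => (phiq ψ q ((2 * Real.pi) • η) : ℂ))

/-- The lattice point `k ∈ ℤ³` as a frequency in `ℝ³`. -/
def latticePt (k : Fin 3 → ℤ) : E3 := WithLp.toLp 2 (fun i => (k i : ℝ))

/-- The mode `e^{i k·x}`. -/
def mode (k : Fin 3 → ℤ) (x : E3) : ℂ :=
  Complex.exp (Complex.I * ((inner ℝ (latticePt k) x : ℝ) : ℂ))

/-- The Fourier coefficient `(2π)⁻³ ∫_{[0,2π)³} f(x) e^{-i k·x} dx`. -/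
def fourierCoeffTorus (f : E3 → ℝ) (k : Fin 3 → ℤ) : ℂ :=
  ((2 * Real.pi : ℝ) : ℂ)⁻¹ ^ 3 *
    ∫ x in SpatialDomain.torus.cell, (f x : ℂ) * mode (-k) x

/-- The `q`-th Littlewood-Paley piece of a scalar function. -/
def lpScalar (Ω : SpatialDomain) (ψ : E3 → ℝ) (q : ℤ) (f : E3 → ℝ) (x : E3) : ℂ :=
  match Ω with
  | .space => ∫ y, (f (x - y) : ℂ) * lpKernel ψ q y
  | .torus => ∑' k : Fin 3 → ℤ, fourierCoeffTorus f k * (phiq ψ q (latticePt k) : ℂ) * mode k x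

/-- The `q`-th Littlewood-Paley piece `u_q` of a vector field, componentwise. -/
def lpPiece (Ω : SpatialDomain) (ψ : E3 → ℝ) (q : ℤ) (u : E3 → E3) (x : E3) : C3 :=
  WithLp.toLp 2 (fun i => lpScalar Ω ψ q (fun z => u z i) x)

/-- `λ_q³ ‖u_q‖₂²`, the contribution of the frequencies `|ξ| ~ λ_q` to the square of the
homogeneous Sobolev norm of order `3/2`. -/
def shell (Ω : SpatialDomain) (ψ : E3 → ℝ) (u : E3 → E3) (q : ℤ) : ℝ :=
  lam q ^ 3 * ∫ x, ‖lpPiece Ω ψ q u x‖ ^ 2 ∂Ω.vol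

/-! ### The Navier-Stokes equations -/

/-- The divergence of a vector field. -/
def divergence (v : E3 → E3) (x : E3) : ℝ :=
  ∑ i, (fderiv ℝ v x (EuclideanSpace.single i 1)) i

/-- `(u, p)` is a smooth solution on `(0, T)` of the incompressible Navier-Stokes equations with
viscosity `ν` on `Ω`, with the finite energy initial datum `u₀`. Smoothness is meant
pointwise and in the scale of Sobolev spaces: `u ∈ L^∞_loc((0, T); H^m)` for all `m`. On the torus
the latter follows from the former; on `ℝ³` it holds for every Leray-Hopf solution that is regular
on `(0, T)`. The pressure is not normalized. -/
structure IsSmoothSolution (Ω : SpatialDomain) (ν T : ℝ) (u₀ : E3 → E3)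
    (u : ℝ → E3 → E3) (p : ℝ → E3 → ℝ) : Prop where
  smooth_velocity : ContDiffOn ℝ ∞ (fun z : ℝ × E3 => u z.1 z.2) (Ioo 0 T ×ˢ univ)
  smooth_pressure : ContDiffOn ℝ ∞ (fun z : ℝ × E3 => p z.1 z.2) (Ioo 0 T ×ˢ univ)
  velocity_on : ∀ t ∈ Ioo 0 T, Ω.IsFunctionOn (u t)
  pressure_on : ∀ t ∈ Ioo 0 T, Ω.IsFunctionOn (p t)
  sobolev : ∀ (m : ℕ) (a b : ℝ), 0 < a → b < T → ∃ M : ℝ, ∀ t ∈ Icc a b,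
    eLpNorm (iteratedFDeriv ℝ m (u t)) 2 Ω.vol ≤ ENNReal.ofReal M
  momentum : ∀ t ∈ Ioo 0 T, ∀ x,
    deriv (fun s => u s x) t + fderiv ℝ (u t) x (u t x)
      = -gradient (p t) x + ν • Laplacian.laplacian (u t) x
  incompressible : ∀ t ∈ Ioo 0 T, ∀ x, divergence (u t) x = 0
  initial_on : Ω.IsFunctionOn u₀
  initial_energy : MemLp u₀ 2 Ω.vol
  initial : Tendsto (fun t => eLpNorm (u t - u₀) 2 Ω.vol) (𝓝[>] 0) (𝓝 0)

end NSE

end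

open MeasureTheory Set Filter Topology
open scoped ContDiff FourierTransform

set_option linter.unusedSectionVars false

noncomputable section

namespace NSE

/-! ### The weight `W = ∑ λ_q³ φ_q²` -/

/-! On the frequency side the sum of the shells is, up to the Plancherel constant, E = ∫ W(ξ)|û(ξ)|²
dξ with W = ∑ λ_q³ φ_q². Two properties of W matter: it is comparable to |ξ|³ (`exists_weight_le`,
`le_weight`), and |W(x) - W(y)| ≤ C |x - y| max(|x|, |y|)² (`exists_abs_weight_sub_le`). Since dE/dt
= -2ν ∫ W|ξ|²|û|² minus twice a trilinear term, everything rests on bounding that term by ν ∫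
W|ξ|²|û|² plus (C/ν) ∑ (shell)² (`exists_abs_trilinear_le`).

The trilinear term is a double integral over x and y, with third frequency x - y. Incompressibility
and reality make its integrand antisymmetric apart from the weight, so symmetrizing replaces W(x) by
W(x) - W(y) (`flux_add_swap`), and the derivative may be charged to the smaller of |x|, |y|. The
resulting kernel |x - y| max² min has degree four. In a triad the two largest frequencies are
comparable, so only products |z||û(z)| · |y|³|û(y)|² with |z| ≤ |y| remain (`triad_le`,
`lintegral_trilinear_le`).

The low factor ∫_{|z| ≤ |y|} |z||û(z)| is estimated by Cauchy-Schwarz, using that a ball of radius r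
contains O(r³) nonzero frequencies. Young's inequality with a parameter proportional to ν then
produces a multiple of |y|⁵|û(y)|², absorbed by the dissipation, and a remainder ν⁻¹ ∫ |y|²|û(y)|²
∫_{|z| ≤ |y|} |z|⁴|û(z)|². In dyadic annuli with β_q = λ_q³ · (mass of û on annulus q), the
remainder is at most a multiple of ∑_q ∑_k 2^{-k} β_q β_{q-k}. The geometric factor is what gives ∑
β_q² and not merely (∑ β_q)². Finally β_q is controlled by three neighbouring shells
(`annulus_mass_le`).

The second issue is differentiability in time: the solution is smooth pointwise and locally bounded
in every H^m, but no time regularity in L² and no bound on the pressure are given. The vorticity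
equation contains no pressure, and for divergence-free û the energy is half the sum over i, j of ∫
(W/|ξ|²)|ω̂_ij|². Testing against compactly supported functions shows that ω_ij is weakly
differentiable in L² with bounded derivative, hence Lipschitz. The symmetric pairing of ω_ij with
its weighted version is then differentiable once the weighted version is continuous, which follows
by interpolation (`hasDerivAt_inner_of_symm`, `hasDerivAt_pairing`).

Both domains are handled at once by `IsFourierModel`, verified with counting measure on the lattice
for the torus and with Mathlib's L² Fourier transform for the whole space. -/

theorem lam_pos (q : ℤ) : 0 < lam q := by unfold lam; positivity

theorem lam_add_one (q : ℤ) : lam (q + 1) = 2 * lam q := by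
  unfold lam; rw [zpow_add_one₀ two_ne_zero]; ring

theorem lam_sub_one (q : ℤ) : lam (q - 1) = lam q / 2 := by
  unfold lam; rw [zpow_sub_one₀ two_ne_zero]; ring

theorem lam_le_lam {p q : ℤ} (h : p ≤ q) : lam p ≤ lam q :=
  zpow_le_zpow_right₀ one_le_two h

theorem exists_lam_le_lt {r : ℝ} (hr : 0 < r) : ∃ j : ℤ, lam j ≤ r ∧ r < lam (j + 1) :=
  exists_mem_Ico_zpow hr one_lt_two

theorem phiq_eq (ψ : E3 → ℝ) (q : ℤ) (x : E3) :
    phiq ψ q x = ψ ((lam (q + 1))⁻¹ • x) - ψ ((lam q)⁻¹ • x) := by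
  unfold phiq phi
  rw [smul_smul, lam_add_one]
  congr 3
  unfold lam
  simp [mul_comm]

theorem IsCutoff.phiq_eq_zero_of_lt {ψ : E3 → ℝ} (hψ : IsCutoff ψ) {q : ℤ} {x : E3}
    (h : 2 * ‖x‖ ≤ lam q) : phiq ψ q x = 0 := by
  have h0 := lam_pos q
  rw [phiq_eq, hψ.eq_one, hψ.eq_one, sub_self]
  · rw [norm_smul, norm_inv, Real.norm_of_nonneg h0.le, inv_mul_le_iff₀ h0]; linarith
  · have h1 := lam_pos (q + 1)
    rw [norm_smul, norm_inv, Real.norm_of_nonneg h1.le, inv_mul_le_iff₀ h1, lam_add_one]; linarith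

theorem IsCutoff.phiq_eq_zero_of_gt {ψ : E3 → ℝ} (hψ : IsCutoff ψ) {q : ℤ} {x : E3}
    (h : 2 * lam q < ‖x‖) : phiq ψ q x = 0 := by
  have h0 := lam_pos q
  have h1 := lam_pos (q + 1)
  rw [phiq_eq, hψ.eq_zero, hψ.eq_zero, sub_self]
  · rw [norm_smul, norm_inv, Real.norm_of_nonneg h0.le, lt_inv_mul_iff₀ h0]; linarith
  · rw [norm_smul, norm_inv, Real.norm_of_nonneg h1.le, lt_inv_mul_iff₀ h1, lam_add_one]; linarith

theorem phiq_zero (ψ : E3 → ℝ) (q : ℤ) : phiq ψ q 0 = 0 := by simp [phiq_eq]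

theorem IsCutoff.hasCompactSupport {ψ : E3 → ℝ} (hψ : IsCutoff ψ) : HasCompactSupport ψ := by
  refine HasCompactSupport.intro (isCompact_closedBall (0 : E3) 1) fun x hx => hψ.eq_zero x ?_
  simpa using hx

theorem contDiff_phiq {ψ : E3 → ℝ} (hψ : IsCutoff ψ) (q : ℤ) : ContDiff ℝ ∞ (phiq ψ q) := by
  have : phiq ψ q = fun x => ψ ((lam (q + 1))⁻¹ • x) - ψ ((lam q)⁻¹ • x) :=
    funext fun x => phiq_eq ψ q x
  rw [this]
  have := hψ.smooth
  fun_prop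

theorem hasCompactSupport_phiq {ψ : E3 → ℝ} (hψ : IsCutoff ψ) (q : ℤ) :
    HasCompactSupport (phiq ψ q) := by
  refine HasCompactSupport.intro (isCompact_closedBall (0 : E3) (2 * lam q)) fun x hx =>
    hψ.phiq_eq_zero_of_gt ?_
  simpa using hx

/-- The cutoffs `φ_q` are uniformly bounded, and Lipschitz with constant `O(λ_q⁻¹)`. -/
theorem IsCutoff.exists_bound {ψ : E3 → ℝ} (hψ : IsCutoff ψ) :
    ∃ L : ℝ, 0 < L ∧ (∀ q x, |phiq ψ q x| ≤ L) ∧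
      ∀ q x y, |phiq ψ q x - phiq ψ q y| ≤ L * (lam q)⁻¹ * ‖x - y‖ := by
  obtain ⟨K, hK⟩ := hψ.smooth.lipschitzWith_of_hasCompactSupport hψ.hasCompactSupport (by simp)
  obtain ⟨B, hB⟩ := hψ.hasCompactSupport.exists_bound_of_continuous hψ.smooth.continuous
  have hB0 : 0 ≤ B := (norm_nonneg _).trans (hB 0)
  -- One constant for both claims: 2B for the supremum, 2K for the Lipschitz bound, and 1 for
  -- positivity.
  refine ⟨2 * B + 2 * K + 1, by positivity, fun q x => ?_, fun q x y => ?_⟩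
  · rw [phiq_eq]
    have h1 := hB ((lam (q + 1))⁻¹ • x)
    have h2 := hB ((lam q)⁻¹ • x)
    rw [Real.norm_eq_abs] at h1 h2
    have := abs_sub (ψ ((lam (q + 1))⁻¹ • x)) (ψ ((lam q)⁻¹ • x))
    have : (0 : ℝ) ≤ K := K.2
    linarith
  · have key : ∀ p : ℤ, |ψ ((lam p)⁻¹ • x) - ψ ((lam p)⁻¹ • y)| ≤ K * ((lam p)⁻¹ * ‖x - y‖) := by
      intro p
      have := hK.dist_le_mul ((lam p)⁻¹ • x) ((lam p)⁻¹ • y)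
      rwa [Real.dist_eq, dist_eq_norm, ← smul_sub, norm_smul, norm_inv,
        Real.norm_of_nonneg (lam_pos p).le] at this
    have h1 := key (q + 1)
    have h2 := key q
    have h3 : (lam (q + 1))⁻¹ ≤ (lam q)⁻¹ :=
      inv_anti₀ (lam_pos q) (lam_le_lam (by omega))
    have hn := norm_nonneg (x - y)
    have hl : 0 ≤ (lam q)⁻¹ := (inv_pos.2 (lam_pos q)).le
    rw [phiq_eq, phiq_eq]
    calc _ = |(ψ ((lam (q + 1))⁻¹ • x) - ψ ((lam (q + 1))⁻¹ • y))
            - (ψ ((lam q)⁻¹ • x) - ψ ((lam q)⁻¹ • y))| := by congr 1; ring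
      _ ≤ _ := abs_sub _ _
      _ ≤ K * ((lam q)⁻¹ * ‖x - y‖) + K * ((lam q)⁻¹ * ‖x - y‖) := by
          refine add_le_add (h1.trans ?_) h2
          gcongr
      _ ≤ _ := by nlinarith [mul_nonneg hl hn]

/-- The Fourier multiplier of the quadratic form `∑ λ_q³ ‖u_q‖₂²`. -/
def weight (ψ : E3 → ℝ) (x : E3) : ℝ := ∑' q : ℤ, lam q ^ 3 * phiq ψ q x ^ 2

/-- Terms with λ_q ≥ 2|x| vanish, so this is a geometric series governed by its top index. It serves
with n = 3 for the weight and with n = 2 for differences of the weight. -/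
theorem summable_weight_of_lam_le {x : E3} {f : ℤ → ℝ} {C : ℝ} (n : ℕ) (hn : n ≠ 0)
    (h0 : ∀ q, 0 ≤ f q) (h : ∀ q, f q ≤ C * lam q ^ n) (hz : ∀ q, 2 * ‖x‖ ≤ lam q → f q = 0) :
    Summable f ∧ ∑' q, f q ≤ C * (4 * ‖x‖) ^ n * 2 := by
  have hC : 0 ≤ C := by
    have h1 := (h0 0).trans (h 0)
    simpa [lam] using h1
  rcases eq_or_ne x 0 with rfl | hx
  · have : f = 0 := funext fun q => hz q (by simpa using (lam_pos q).le)
    subst this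
    exact ⟨summable_zero, by simp [hn]⟩
  obtain ⟨j, hj1, hj2⟩ := exists_lam_le_lt (r := 2 * ‖x‖) (by positivity)
  have hf0 : ∀ q, j < q → f q = 0 := fun q hq => hz q (hj2.le.trans (lam_le_lam hq))
  let e : ℕ → ℤ := fun k => j - k
  have hinj : Function.Injective e := fun a b hab => by simpa [e] using hab
  have hsupp : Function.support f ⊆ range e := by
    intro q hq
    have : q ≤ j := by
      by_contra hcon
      exact hq (hf0 q (by omega))
    exact ⟨(j - q).toNat, by simp only [e]; omega⟩
  have hb : ∀ k : ℕ, f (e k) ≤ C * lam j ^ n * (1 / 2) ^ k := by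
    intro k
    refine (h _).trans ?_
    rw [mul_assoc]
    refine mul_le_mul_of_nonneg_left ?_ hC
    have : lam (e k) = lam j * (1 / 2) ^ k := by
      simp only [e, lam]
      rw [zpow_sub₀ two_ne_zero]; simp [div_eq_mul_inv]
    rw [this, mul_pow]
    refine mul_le_mul_of_nonneg_left ?_ (pow_nonneg (lam_pos j).le _)
    -- The true ratio is 2⁻ⁿ; as n ≠ 0, the ratio 1/2 serves for every n.
    exact pow_le_of_le_one (by positivity) (pow_le_one₀ (by norm_num) (by norm_num)) hn
  have hg : Summable fun k : ℕ => C * lam j ^ n * (1 / 2 : ℝ) ^ k :=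
    summable_geometric_two.mul_left _
  have hs : Summable (f ∘ e) := Summable.of_nonneg_of_le (fun k => h0 _) hb hg
  refine ⟨(hinj.summable_iff (fun q hq => Function.notMem_support.1 fun h' => hq (hsupp h'))).1 hs,
    ?_⟩
  rw [← hinj.tsum_eq hsupp]
  refine (hs.tsum_le_tsum hb hg).trans ?_
  rw [tsum_mul_left, tsum_geometric_two]
  have := lam_pos j
  gcongr
  linarith [norm_nonneg x]

theorem weight_summable {ψ : E3 → ℝ} (hψ : IsCutoff ψ) (x : E3) :
    Summable fun q : ℤ => lam q ^ 3 * phiq ψ q x ^ 2 := by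
  obtain ⟨L, hL, hL1, -⟩ := hψ.exists_bound
  refine (summable_weight_of_lam_le (x := x) (C := L ^ 2) 3 (by norm_num)
    (fun q => ?_) (fun q => ?_) fun q hq => ?_).1
  · have := lam_pos q; positivity
  · rw [mul_comm]
    have := lam_pos q
    refine mul_le_mul_of_nonneg_right ?_ (by positivity)
    exact sq_le_sq' (by linarith [neg_abs_le (phiq ψ q x), hL1 q x]) ((le_abs_self _).trans (hL1 q x))
  · rw [hψ.phiq_eq_zero_of_lt hq]; simp

theorem weight_nonneg (ψ : E3 → ℝ) (x : E3) : 0 ≤ weight ψ x :=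
  tsum_nonneg fun q => by have := lam_pos q; positivity

theorem weight_zero (ψ : E3 → ℝ) : weight ψ 0 = 0 := by simp [weight, phiq_zero]

/-- Factoring φ_q(x)² - φ_q(y)² and using the Lipschitz bound gains one λ_q⁻¹, which leaves λ_q²|x -
y| in each shell. All terms vanish beyond the larger of the two frequencies, so summation gives its
square. This is the gain that compensates the derivative in the nonlinearity. -/
theorem exists_abs_weight_sub_le {ψ : E3 → ℝ} (hψ : IsCutoff ψ) :
    ∃ C : ℝ, 0 < C ∧ ∀ x y : E3,
      |weight ψ x - weight ψ y| ≤ C * (‖x - y‖ * max ‖x‖ ‖y‖ ^ 2) := by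
  obtain ⟨L, hL, hL1, hL2⟩ := hψ.exists_bound
  refine ⟨2 * L ^ 2 * 16 * 2, by positivity, fun x y => ?_⟩
  wlog hxy : ‖y‖ ≤ ‖x‖ generalizing x y with H
  · rw [abs_sub_comm, norm_sub_rev, max_comm]
    exact H y x (by linarith)
  have hterm : ∀ q, |lam q ^ 3 * phiq ψ q x ^ 2 - lam q ^ 3 * phiq ψ q y ^ 2|
      ≤ 2 * L ^ 2 * ‖x - y‖ * lam q ^ 2 := by
    intro q
    have hl := lam_pos q
    have e : lam q ^ 3 * phiq ψ q x ^ 2 - lam q ^ 3 * phiq ψ q y ^ 2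
        = lam q ^ 3 * ((phiq ψ q x + phiq ψ q y) * (phiq ψ q x - phiq ψ q y)) := by ring
    rw [e, abs_mul, abs_mul, abs_of_pos (pow_pos hl 3)]
    calc _ ≤ lam q ^ 3 * ((L + L) * (L * (lam q)⁻¹ * ‖x - y‖)) := by
          have := (abs_add_le (phiq ψ q x) (phiq ψ q y)).trans (add_le_add (hL1 q x) (hL1 q y))
          have := hL2 q x y
          gcongr
      _ = _ := by field_simp; ring
  have hA := summable_weight_of_lam_le (x := x)
    (f := fun q => |lam q ^ 3 * phiq ψ q x ^ 2 - lam q ^ 3 * phiq ψ q y ^ 2|)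
    (C := 2 * L ^ 2 * ‖x - y‖) 2 (by norm_num) (fun q => abs_nonneg _) hterm (fun q hq => by
      rw [hψ.phiq_eq_zero_of_lt hq, hψ.phiq_eq_zero_of_lt (x := y) (by linarith)]; simp)
  unfold weight
  rw [← (weight_summable hψ x).tsum_sub (weight_summable hψ y), max_eq_left hxy, ← Real.norm_eq_abs]
  refine (norm_tsum_le_tsum_norm (by simpa using hA.1)).trans ?_
  refine hA.2.trans (le_of_eq ?_)
  ring

theorem exists_weight_le {ψ : E3 → ℝ} (hψ : IsCutoff ψ) :
    ∃ C : ℝ, 0 < C ∧ ∀ x : E3, weight ψ x ≤ C * ‖x‖ ^ 3 := by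
  obtain ⟨C, hC, h⟩ := exists_abs_weight_sub_le hψ
  refine ⟨C, hC, fun x => ?_⟩
  have := h x 0
  rw [weight_zero, sub_zero, sub_zero, norm_zero, max_eq_left (norm_nonneg x)] at this
  calc _ ≤ _ := (le_abs_self _).trans this
    _ = _ := by ring

theorem continuous_weight {ψ : E3 → ℝ} (hψ : IsCutoff ψ) : Continuous (weight ψ) := by
  obtain ⟨C, hC, h⟩ := exists_abs_weight_sub_le hψ
  refine continuous_iff_continuousAt.2 fun x => ?_
  rw [ContinuousAt, tendsto_iff_norm_sub_tendsto_zero]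
  refine squeeze_zero (fun y => norm_nonneg _) (fun y => h y x) ?_
  have : Continuous fun y : E3 => C * (‖y - x‖ * max ‖y‖ ‖x‖ ^ 2) := by fun_prop
  simpa using this.tendsto x

/-- On a dyadic annulus three neighbouring cutoffs form a partition of unity. -/
theorem IsCutoff.one_le_sum_phiq_sq {ψ : E3 → ℝ} (hψ : IsCutoff ψ) {j : ℤ} {x : E3}
    (h1 : lam j ≤ ‖x‖) (h2 : ‖x‖ < lam (j + 1)) :
    1 ≤ 3 * (phiq ψ (j - 1) x ^ 2 + phiq ψ j x ^ 2 + phiq ψ (j + 1) x ^ 2) := by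
  -- The sum telescopes to ψ(x/λ_{j+2}) - ψ(x/λ_{j-1}) = 1 - 0. The claim is then (a + b + c)² ≤
  -- 3(a² + b² + c²).
  have hs : phiq ψ (j - 1) x + phiq ψ j x + phiq ψ (j + 1) x = 1 := by
    rw [phiq_eq, phiq_eq, phiq_eq, sub_add_cancel, hψ.eq_zero ((lam (j - 1))⁻¹ • x),
      hψ.eq_one ((lam (j + 1 + 1))⁻¹ • x)]
    · ring
    · have h0 := lam_pos (j + 1 + 1)
      rw [norm_smul, norm_inv, Real.norm_of_nonneg h0.le, inv_mul_le_iff₀ h0, lam_add_one]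
      linarith
    · have h0 := lam_pos (j - 1)
      rw [norm_smul, norm_inv, Real.norm_of_nonneg h0.le, lt_inv_mul_iff₀ h0, lam_sub_one]
      linarith [lam_pos j]
  nlinarith [sq_nonneg (phiq ψ (j - 1) x - phiq ψ j x), sq_nonneg (phiq ψ j x - phiq ψ (j + 1) x),
    sq_nonneg (phiq ψ (j - 1) x - phiq ψ (j + 1) x), congrArg (· ^ 2) hs]

/-- Lets the dissipation ∫ W|ξ|²|û|² control ∫ |ξ|⁵|û|². The constant is 8 · 3 · 8: |x|³ ≤ 8λ_j³,
the partition of unity costs 3, and λ_j³ = 8λ_{j-1}³ for the lowest of the three shells. -/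
theorem le_weight {ψ : E3 → ℝ} (hψ : IsCutoff ψ) (x : E3) : ‖x‖ ^ 3 ≤ 192 * weight ψ x := by
  rcases eq_or_ne x 0 with rfl | hx
  · simp [weight_zero]
  obtain ⟨j, hj1, hj2⟩ := exists_lam_le_lt (norm_pos_iff.2 hx)
  have h := hψ.one_le_sum_phiq_sq hj1 hj2
  have h3 := (weight_summable hψ x).sum_le_tsum {j - 1, j, j + 1}
    (fun q _ => by have := lam_pos q; positivity)
  rw [Finset.sum_insert (by simp; omega), Finset.sum_insert (by simp),
    Finset.sum_singleton] at h3
  have hl := lam_pos j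
  rw [lam_sub_one, lam_add_one] at h3
  rw [lam_add_one] at hj2
  have h4 : ‖x‖ ^ 3 ≤ (2 * lam j) ^ 3 := by gcongr
  have e : (2 * lam j) ^ 3 = 8 * lam j ^ 3 := by ring
  have hp : 0 < lam j ^ 3 := by positivity
  have e2 : (lam j / 2) ^ 3 = lam j ^ 3 / 8 := by ring
  rw [e, e2] at *
  change _ ≤ weight ψ x at h3
  set A := phiq ψ (j - 1) x ^ 2
  set B := phiq ψ j x ^ 2
  set D := phiq ψ (j + 1) x ^ 2
  have hB : 0 ≤ B := sq_nonneg _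
  have hD : 0 ≤ D := sq_nonneg _
  nlinarith [mul_nonneg hp.le hB, mul_nonneg hp.le hD, mul_le_mul_of_nonneg_left h hp.le]

section

/-! ### The trilinear estimate -/

open scoped ENNReal NNReal

theorem sq_lintegral_mul_le {α : Type*} [MeasurableSpace α] {μ : Measure α} {f g : α → ℝ≥0∞}
    (hf : AEMeasurable f μ) (hg : AEMeasurable g μ) :
    (∫⁻ x, f x * g x ∂μ) ^ 2 ≤ (∫⁻ x, f x ^ 2 ∂μ) * ∫⁻ x, g x ^ 2 ∂μ := by
  have h := ENNReal.lintegral_mul_le_Lp_mul_Lq μ Real.HolderConjugate.two_two hf hg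
  calc _ ≤ ((∫⁻ x, f x ^ (2 : ℝ) ∂μ) ^ (1 / (2 : ℝ)) * (∫⁻ x, g x ^ (2 : ℝ) ∂μ) ^ (1 / (2 : ℝ))) ^ 2 :=
        pow_le_pow_left' h 2
    _ = _ := by
      rw [mul_pow, ← ENNReal.rpow_natCast, ← ENNReal.rpow_natCast, ← ENNReal.rpow_mul,
        ← ENNReal.rpow_mul]
      norm_num

theorem ENNReal_mul_le_sq_add_sq (a b : ℝ≥0∞) : a * b ≤ a ^ 2 + b ^ 2 := by
  rcases le_total a b with h | h
  · calc a * b ≤ b * b := by gcongr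
      _ = b ^ 2 := (sq b).symm
      _ ≤ _ := le_add_self
  · calc a * b ≤ a * a := by gcongr
      _ = a ^ 2 := (sq a).symm
      _ ≤ _ := le_self_add

theorem ENNReal_young {δ : ℝ≥0∞} (h0 : δ ≠ 0) (h1 : δ ≠ ⊤) (a b : ℝ≥0∞) :
    a * b ≤ δ * a ^ 2 + δ⁻¹ * b ^ 2 := by
  rcases le_total b (δ * a) with h | h
  · calc a * b ≤ a * (δ * a) := by gcongr
      _ = δ * a ^ 2 := by ring
      _ ≤ _ := le_self_add
  · have h' : a ≤ δ⁻¹ * b := by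
      calc a = δ⁻¹ * (δ * a) := by
            rw [← mul_assoc, ENNReal.inv_mul_cancel h0 h1, one_mul]
        _ ≤ _ := by gcongr
    calc a * b ≤ δ⁻¹ * b * b := by gcongr
      _ = δ⁻¹ * b ^ 2 := by ring
      _ ≤ _ := le_add_self

theorem ENNReal_add_three_sq_le (a b c : ℝ≥0∞) :
    (a + b + c) ^ 2 ≤ 9 * (a ^ 2 + b ^ 2 + c ^ 2) := by
  have h : a + b + c ≤ 3 * max a (max b c) := by
    calc a + b + c ≤ max a (max b c) + max a (max b c) + max a (max b c) := by
          gcongr <;> simp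
      _ = _ := by ring
  have h2 : max a (max b c) ^ 2 ≤ a ^ 2 + b ^ 2 + c ^ 2 := by
    rcases max_choice a (max b c) with e | e
    · rw [e, add_assoc]; exact le_self_add
    · rw [e]
      rcases max_choice b c with e | e <;> rw [e]
      · rw [add_right_comm]; exact le_add_self
      · exact le_add_self
  calc _ ≤ (3 * max a (max b c)) ^ 2 := pow_le_pow_left' h 2
    _ = 9 * max a (max b c) ^ 2 := by ring
    _ ≤ _ := by gcongr

/-- The contribution of a low frequency of size `u` and amplitude `A` acting on a high frequency of
size `v` and amplitude `B`. -/
def lowHigh (u A v B : ℝ≥0) : ℝ≥0 := if u ≤ v then u * A * (v ^ 3 * B ^ 2) else 0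

/-- The arithmetic-geometric mean of tP and wQ leaves max(t, w)((tP)² + (wQ)²)/2, and comparability
lets the maximum be replaced, in each square, by twice its own frequency. -/
theorem mul_max_le_cube_add_cube {t w : ℝ≥0} (P Q : ℝ≥0) (h1 : t ≤ 2 * w) (h2 : w ≤ 2 * t) :
    t * w * max t w * (P * Q) ≤ t ^ 3 * P ^ 2 + w ^ 3 * Q ^ 2 := by
  have h1' : (t : ℝ) ≤ 2 * w := by exact_mod_cast h1
  have h2' : (w : ℝ) ≤ 2 * t := by exact_mod_cast h2
  have ht := t.coe_nonneg
  have hw := w.coe_nonneg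
  have h : ((t : ℝ) * P) * (w * Q) ≤ ((t * P) ^ 2 + (w * Q) ^ 2) / 2 := by
    nlinarith [sq_nonneg ((t : ℝ) * P - w * Q)]
  rw [← NNReal.coe_le_coe]
  push_cast
  rcases le_total (t : ℝ) w with h3 | h3
  · rw [max_eq_right h3]
    nlinarith [mul_le_mul_of_nonneg_left h hw, mul_nonneg (sub_nonneg.2 h2') (sq_nonneg (t * P : ℝ)),
      mul_nonneg hw (sq_nonneg (w * Q : ℝ))]
  · rw [max_eq_left h3]
    nlinarith [mul_le_mul_of_nonneg_left h ht, mul_nonneg (sub_nonneg.2 h1') (sq_nonneg (w * Q : ℝ)),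
      mul_nonneg ht (sq_nonneg (t * P : ℝ))]

/-- In a frequency triad the two largest frequencies are comparable, hence the trilinear kernel
splits into low-high interactions. -/
theorem triad_le {x y z : ℝ≥0} (A B D : ℝ≥0) (hx : x ≤ y + z) (hy : y ≤ x + z) (hz : z ≤ x + y) :
    x * max y z ^ 2 * min y z * (A * B * D) ≤
      lowHigh x A y B + lowHigh y B x A + lowHigh x A z D + lowHigh z D x A
        + lowHigh y B z D + lowHigh z D y B := by
  -- The least of the three frequencies plays the low role; the triangle inequalities then put the
  -- other two within a factor 2 of each other.
  have hcase : (x ≤ y ∧ x ≤ z) ∨ (y ≤ x ∧ y ≤ z) ∨ (z ≤ x ∧ z ≤ y) := by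
    grind
  rcases hcase with ⟨h1, h2⟩ | ⟨h1, h2⟩ | ⟨h1, h2⟩
  · have h3 : y ≤ 2 * z := hy.trans (by rw [two_mul]; gcongr)
    have h4 : z ≤ 2 * y := hz.trans (by rw [two_mul]; gcongr)
    calc _ = x * A * (max y z * min y z * max y z * (B * D)) := by ring
      _ = x * A * (y * z * max y z * (B * D)) := by rw [max_mul_min]
      _ ≤ x * A * (y ^ 3 * B ^ 2 + z ^ 3 * D ^ 2) :=
          mul_le_mul_right (mul_max_le_cube_add_cube B D h3 h4) _
      _ = lowHigh x A y B + lowHigh x A z D := by simp only [lowHigh, h1, h2, if_true]; ring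
      _ ≤ lowHigh x A y B + lowHigh x A z D + (lowHigh y B x A + lowHigh z D x A
        + lowHigh y B z D + lowHigh z D y B) := le_self_add
      _ = _ := by ring
  · have h3 : x ≤ 2 * z := hx.trans (by rw [two_mul]; gcongr)
    have h4 : z ≤ 2 * x := hz.trans (by rw [two_mul]; gcongr)
    calc _ = y * B * (x * z * z * (A * D)) := by rw [max_eq_right h2, min_eq_left h2]; ring
      _ ≤ y * B * (x * z * max x z * (A * D)) := by gcongr; exact le_max_right _ _
      _ ≤ y * B * (x ^ 3 * A ^ 2 + z ^ 3 * D ^ 2) :=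
          mul_le_mul_right (mul_max_le_cube_add_cube A D h3 h4) _
      _ = lowHigh y B x A + lowHigh y B z D := by simp only [lowHigh, h1, h2, if_true]; ring
      _ ≤ lowHigh y B x A + lowHigh y B z D + (lowHigh x A y B + lowHigh x A z D
        + lowHigh z D x A + lowHigh z D y B) := le_self_add
      _ = _ := by ring
  · have h3 : x ≤ 2 * y := hx.trans (by rw [two_mul]; gcongr)
    have h4 : y ≤ 2 * x := hy.trans (by rw [two_mul]; gcongr)
    calc _ = z * D * (x * y * y * (A * B)) := by rw [max_eq_left h2, min_eq_right h2]; ring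
      _ ≤ z * D * (x * y * max x y * (A * B)) := by gcongr; exact le_max_right _ _
      _ ≤ z * D * (x ^ 3 * A ^ 2 + y ^ 3 * B ^ 2) :=
          mul_le_mul_right (mul_max_le_cube_add_cube A B h3 h4) _
      _ = lowHigh z D x A + lowHigh z D y B := by simp only [lowHigh, h1, h2, if_true]; ring
      _ ≤ lowHigh z D x A + lowHigh z D y B + (lowHigh x A y B + lowHigh y B x A
        + lowHigh x A z D + lowHigh y B z D) := le_self_add
      _ = _ := by ring

theorem measurable_lowHigh {α : Type*} [MeasurableSpace α] {u A v B : α → ℝ≥0} (hu : Measurable u)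
    (hA : Measurable A) (hv : Measurable v) (hB : Measurable B) :
    Measurable fun x => lowHigh (u x) (A x) (v x) (B x) :=
  Measurable.ite (measurableSet_le hu hv) (by fun_prop) measurable_const

section Group

variable {G : Type*} [AddCommGroup G] [MeasurableSpace G] [MeasurableAdd₂ G] [MeasurableNeg G]
  {m : Measure G} [SFinite m] [m.IsAddLeftInvariant] [m.IsNegInvariant] {n F : G → ℝ≥0}

/-- `triad_le` yields one low-high term for each ordered pair from the triad (x - y, y, x).
Translation, reflection and exchange of variables carry any such pair to two independent variables,
so the six integrals coincide. -/
theorem lintegral_trilinear_le (hn : Measurable n) (hF : Measurable F)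
    (hadd : ∀ g h, n (g + h) ≤ n g + n h) (hneg : ∀ g, n (-g) = n g) :
    ∫⁻ x, ∫⁻ y, (n (x - y) * max (n y) (n x) ^ 2 * min (n y) (n x) * (F (x - y) * F y * F x) : ℝ≥0)
        ∂m ∂m ≤
      6 * ∫⁻ y, ∫⁻ z, (lowHigh (n z) (F z) (n y) (F y) : ℝ≥0) ∂m ∂m := by
  set J := ∫⁻ y, ∫⁻ z, (lowHigh (n z) (F z) (n y) (F y) : ℝ≥0∞) ∂m ∂m with hJ
  have hm : ∀ {f₁ f₂ : G × G → G}, Measurable f₁ → Measurable f₂ → Measurable fun p : G × G =>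
      (lowHigh (n (f₁ p)) (F (f₁ p)) (n (f₂ p)) (F (f₂ p)) : ℝ≥0∞) := fun h1 h2 =>
    (measurable_lowHigh (hn.comp h1) (hF.comp h1) (hn.comp h2) (hF.comp h2)).coe_nnreal_ennreal
  have hJ' : ∫⁻ y, ∫⁻ z, (lowHigh (n y) (F y) (n z) (F z) : ℝ≥0∞) ∂m ∂m = J := by
    rw [hJ, lintegral_lintegral_swap (hm measurable_fst measurable_snd).aemeasurable]
  have hsub : Measurable fun p : G × G => p.1 - p.2 := measurable_fst.sub measurable_snd
  have e1 : ∫⁻ x, ∫⁻ y, (lowHigh (n (x - y)) (F (x - y)) (n y) (F y) : ℝ≥0∞) ∂m ∂m = J := by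
    rw [lintegral_lintegral_swap (hm hsub measurable_snd).aemeasurable]
    refine lintegral_congr fun y => ?_
    exact lintegral_sub_right_eq_self (fun z => (lowHigh (n z) (F z) (n y) (F y) : ℝ≥0∞)) y
  have e2 : ∫⁻ x, ∫⁻ y, (lowHigh (n y) (F y) (n (x - y)) (F (x - y)) : ℝ≥0∞) ∂m ∂m = J := by
    rw [lintegral_lintegral_swap (hm measurable_snd hsub).aemeasurable, ← hJ']
    refine lintegral_congr fun y => ?_
    exact lintegral_sub_right_eq_self (fun z => (lowHigh (n y) (F y) (n z) (F z) : ℝ≥0∞)) y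
  have e3 : ∫⁻ x, ∫⁻ y, (lowHigh (n (x - y)) (F (x - y)) (n x) (F x) : ℝ≥0∞) ∂m ∂m = J := by
    refine lintegral_congr fun x => ?_
    exact lintegral_sub_left_eq_self (fun z => (lowHigh (n z) (F z) (n x) (F x) : ℝ≥0∞)) x
  have e4 : ∫⁻ x, ∫⁻ y, (lowHigh (n x) (F x) (n (x - y)) (F (x - y)) : ℝ≥0∞) ∂m ∂m = J := by
    rw [← hJ']
    refine lintegral_congr fun x => ?_
    exact lintegral_sub_left_eq_self (fun z => (lowHigh (n x) (F x) (n z) (F z) : ℝ≥0∞)) x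
  have M1 := hm hsub measurable_snd
  have M2 := hm measurable_snd hsub
  have M3 := hm hsub measurable_fst
  have M4 := hm measurable_fst hsub
  have M5 := hm measurable_snd measurable_fst
  have M6 := hm measurable_fst measurable_snd
  calc _ ≤ ∫⁻ p : G × G, ((lowHigh (n (p.1 - p.2)) (F (p.1 - p.2)) (n p.2) (F p.2) : ℝ≥0∞)
          + lowHigh (n p.2) (F p.2) (n (p.1 - p.2)) (F (p.1 - p.2))
          + lowHigh (n (p.1 - p.2)) (F (p.1 - p.2)) (n p.1) (F p.1)
          + lowHigh (n p.1) (F p.1) (n (p.1 - p.2)) (F (p.1 - p.2))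
          + lowHigh (n p.2) (F p.2) (n p.1) (F p.1)
          + lowHigh (n p.1) (F p.1) (n p.2) (F p.2)) ∂(m.prod m) := by
        rw [lintegral_prod _ (by fun_prop)]
        refine lintegral_mono fun x => lintegral_mono fun y => ?_
        have h1 : n (x - y) ≤ n y + n x := by
          rw [sub_eq_add_neg, add_comm (n y), ← hneg y]; exact hadd _ _
        have h2 : n y ≤ n (x - y) + n x := by
          have := hadd (-(x - y)) x
          rwa [hneg, neg_sub, sub_add_cancel] at this
        have h3 : n x ≤ n (x - y) + n y := by
          have := hadd (x - y) y
          rwa [sub_add_cancel] at this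
        dsimp only
        exact_mod_cast triad_le (F (x - y)) (F y) (F x) h1 h2 h3
    _ = 6 * J := by
        rw [lintegral_add_left (by fun_prop), lintegral_add_left (by fun_prop),
          lintegral_add_left (by fun_prop), lintegral_add_left (by fun_prop),
          lintegral_add_left (by fun_prop), lintegral_prod _ M1.aemeasurable,
          lintegral_prod _ M2.aemeasurable, lintegral_prod _ M3.aemeasurable,
          lintegral_prod _ M4.aemeasurable, lintegral_prod _ M5.aemeasurable,
          lintegral_prod _ M6.aemeasurable]
        dsimp only
        rw [e1, e2, e3, e4, hJ', ← hJ]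
        ring

end Group

end

/-! ### Dyadic summation of the low-high interactions -/

section

open scoped ENNReal NNReal

/-- The wave number `λ_q` as a nonnegative real. -/
def lamN (q : ℤ) : ℝ≥0 := 2 ^ q

theorem coe_lamN (q : ℤ) : (lamN q : ℝ) = lam q := by simp [lamN, lam]

theorem lamN_add_one (q : ℤ) : lamN (q + 1) = 2 * lamN q := by
  unfold lamN; rw [zpow_add_one₀ two_ne_zero]; ring

theorem lamN_sub_nat (q : ℤ) (k : ℕ) : lamN (q - k) = lamN q * (1 / 2) ^ k := by
  unfold lamN; rw [zpow_sub₀ two_ne_zero]; simp [div_eq_mul_inv]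

theorem exists_lamN_le_lt {r : ℝ≥0} (hr : 0 < r) : ∃ j : ℤ, lamN j ≤ r ∧ r < lamN (j + 1) :=
  exists_mem_Ico_zpow hr one_lt_two

theorem lamN_lt_lamN {p q : ℤ} : lamN p < lamN q ↔ p < q :=
  zpow_lt_zpow_iff_right₀ one_lt_two

theorem tsum_half_pow : ∑' k : ℕ, (((1 / 2 : ℝ≥0) ^ k : ℝ≥0) : ℝ≥0∞) = 2 := by
  have := ENNReal.tsum_geometric (1 / 2)
  rw [one_div, ENNReal.one_sub_inv_two, inv_inv] at this
  rw [← this]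
  refine tsum_congr fun k => ?_
  push_cast
  simp

section Dyadic

variable {α : Type*} [MeasurableSpace α] {μ : Measure α} {n F : α → ℝ≥0}

/-- The part of frequency space with `λ_q ≤ n < λ_{q+1}`. -/
def annulus (n : α → ℝ≥0) (q : ℤ) : Set α := {g | lamN q ≤ n g ∧ n g < lamN (q + 1)}

theorem measurableSet_annulus (hn : Measurable n) (q : ℤ) : MeasurableSet (annulus n q) := by
  have h1 : MeasurableSet {g | lamN q ≤ n g} := measurableSet_le measurable_const hn
  have h2 : MeasurableSet {g | n g < lamN (q + 1)} := measurableSet_lt hn measurable_const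
  exact h1.inter h2

theorem measurableSet_low (hn : Measurable n) (r : ℝ≥0) :
    MeasurableSet {x | n x ≠ 0 ∧ n x ≤ r} := by
  have h1 : MeasurableSet {x | n x = 0} := measurableSet_eq_fun hn measurable_const
  have h2 : MeasurableSet {x | n x ≤ r} := measurableSet_le hn measurable_const
  exact h1.compl.inter h2

theorem lintegral_le_tsum_annulus {h : α → ℝ≥0∞} (hz : ∀ x, n x = 0 → h x = 0) :
    ∫⁻ x, h x ∂μ ≤ ∑' q : ℤ, ∫⁻ x in annulus n q, h x ∂μ := by
  refine le_trans (le_of_eq ?_) (lintegral_iUnion_le _ _)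
  refine (setLIntegral_eq_of_support_subset fun x hx => ?_).symm
  have hx0 : n x ≠ 0 := fun h0 => hx (hz x h0)
  exact mem_iUnion.2 (exists_lamN_le_lt (pos_iff_ne_zero.2 hx0))

theorem setLIntegral_lt_le_tsum_annulus (h : α → ℝ≥0∞) (q : ℤ) :
    ∫⁻ x in {x | n x ≠ 0 ∧ n x < lamN (q + 1)}, h x ∂μ
      ≤ ∑' k : ℕ, ∫⁻ x in annulus n (q - k), h x ∂μ := by
  refine le_trans (lintegral_mono_set fun x hx => ?_) (lintegral_iUnion_le _ _)
  obtain ⟨j, hj1, hj2⟩ := exists_lamN_le_lt (pos_iff_ne_zero.2 hx.1)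
  have : j < q + 1 := lamN_lt_lamN.1 (hj1.trans_lt hx.2)
  refine mem_iUnion.2 ⟨(q - j).toNat, ?_⟩
  have e : q - ((q - j).toNat : ℤ) = j := by omega
  rw [e]
  exact ⟨hj1, hj2⟩

/-- Cubic volume growth beats the inverse-square singularity at zero frequency: the shell n ~
r2^{-k} contributes at most 4 · 4^k r⁻² · K r³ 8^{-k} = 4Kr 2^{-k}. -/
theorem setLIntegral_inv_sq_le (hn : Measurable n) {K : ℝ≥0}
    (hK : ∀ r : ℝ≥0, μ {x | n x ≠ 0 ∧ n x ≤ r} ≤ K * r ^ 3) (r : ℝ≥0) :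
    ∫⁻ x in {x | n x ≠ 0 ∧ n x ≤ r}, ((n x)⁻¹ ^ 2 : ℝ≥0) ∂μ ≤ 8 * K * r := by
  rcases eq_or_ne r 0 with rfl | hr
  · simp
  let s : ℕ → Set α := fun k => {x | n x ≠ 0 ∧ r * (1 / 2) ^ (k + 1) < n x ∧ n x ≤ r * (1 / 2) ^ k}
  have hsm : ∀ k, MeasurableSet (s k) := fun k => by
    have h1 : MeasurableSet {x | n x = 0} := measurableSet_eq_fun hn measurable_const
    have h2 : MeasurableSet {x | r * (1 / 2) ^ (k + 1) < n x} := measurableSet_lt measurable_const hn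
    have h3 : MeasurableSet {x | n x ≤ r * (1 / 2) ^ k} := measurableSet_le hn measurable_const
    exact h1.compl.inter (h2.inter h3)
  have hsub : {x | n x ≠ 0 ∧ n x ≤ r} ⊆ ⋃ k, s k := by
    rintro x ⟨h0, h1⟩
    have hx : 0 < n x / r := div_pos (pos_iff_ne_zero.2 h0) (pos_iff_ne_zero.2 hr)
    obtain ⟨k, hk1, hk2⟩ := exists_nat_pow_near_of_lt_one hx
      (div_le_one_of_le₀ h1 zero_le) (one_half_pos : (0 : ℝ≥0) < 1 / 2) one_half_lt_one
    refine mem_iUnion.2 ⟨k, h0, ?_, ?_⟩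
    · rwa [lt_div_iff₀ (pos_iff_ne_zero.2 hr), mul_comm] at hk1
    · rwa [div_le_iff₀ (pos_iff_ne_zero.2 hr), mul_comm] at hk2
  have hpiece : ∀ k, ∫⁻ x in s k, ((n x)⁻¹ ^ 2 : ℝ≥0) ∂μ
      ≤ (4 * K * r : ℝ≥0) * ((1 / 2 : ℝ≥0) ^ k : ℝ≥0) := by
    intro k
    have hc : 0 < r * (1 / 2) ^ (k + 1) := by positivity
    calc _ ≤ ∫⁻ x in s k, (((r * (1 / 2) ^ (k + 1))⁻¹ ^ 2 : ℝ≥0) : ℝ≥0∞) ∂μ := by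
          refine setLIntegral_mono' (hsm k) fun x hx => ?_
          have := inv_anti₀ hc hx.2.1.le
          exact_mod_cast pow_le_pow_left' this 2
      _ ≤ ((r * (1 / 2) ^ (k + 1))⁻¹ ^ 2 : ℝ≥0) * (K * (r * (1 / 2) ^ k : ℝ≥0) ^ 3) := by
          rw [setLIntegral_const]
          gcongr
          exact (measure_mono (t := {x | n x ≠ 0 ∧ n x ≤ r * (1 / 2) ^ k})
            fun x hx => ⟨hx.1, hx.2.2⟩).trans (by simpa using hK (r * (1 / 2) ^ k))
      _ = _ := by
          norm_cast
          have h2 : (1 / 2 : ℝ≥0) ^ k ≠ 0 := by positivity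
          rw [show (1 / 2 : ℝ≥0) ^ (k + 1) = (1 / 2) ^ k / 2 by rw [pow_succ]; ring]
          field_simp
          norm_num
          ring
  calc _ ≤ ∑' k, ∫⁻ x in s k, ((n x)⁻¹ ^ 2 : ℝ≥0) ∂μ :=
        (lintegral_mono_set hsub).trans (lintegral_iUnion_le _ _)
    _ ≤ ∑' k : ℕ, (4 * K * r : ℝ≥0) * (((1 / 2 : ℝ≥0) ^ k : ℝ≥0) : ℝ≥0∞) := ENNReal.tsum_le_tsum hpiece
    _ = _ := by rw [ENNReal.tsum_mul_left, tsum_half_pow]; push_cast; ring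

/-- The low frequencies enter through `∫ |ζ| F`, bounded by Cauchy-Schwarz. -/
theorem sq_setLIntegral_le (hn : Measurable n) (hF : Measurable F) {K : ℝ≥0}
    (hK : ∀ r : ℝ≥0, μ {x | n x ≠ 0 ∧ n x ≤ r} ≤ K * r ^ 3) (r : ℝ≥0) :
    (∫⁻ x in {x | n x ≠ 0 ∧ n x ≤ r}, (n x * F x : ℝ≥0) ∂μ) ^ 2 ≤
      8 * K * r * ∫⁻ x in {x | n x ≠ 0 ∧ n x ≤ r}, (n x ^ 4 * F x ^ 2 : ℝ≥0) ∂μ := by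
  have hs : MeasurableSet {x | n x ≠ 0 ∧ n x ≤ r} := measurableSet_low hn r
  -- The splitting n F = n⁻¹ · n²F isolates a factor whose square has integral O(r) over the low
  -- frequencies.
  have e : ∫⁻ x in {x | n x ≠ 0 ∧ n x ≤ r}, (n x * F x : ℝ≥0) ∂μ =
      ∫⁻ x in {x | n x ≠ 0 ∧ n x ≤ r}, (((n x)⁻¹ : ℝ≥0) : ℝ≥0∞) * (n x ^ 2 * F x : ℝ≥0) ∂μ := by
    refine setLIntegral_congr_fun hs fun x hx => ?_
    have := hx.1
    rw [← ENNReal.coe_mul]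
    congr 1
    field_simp
  rw [e]
  refine (sq_lintegral_mul_le (by fun_prop) (by fun_prop)).trans ?_
  refine mul_le_mul' ?_ (le_of_eq ?_)
  · refine le_trans (le_of_eq ?_) (setLIntegral_inv_sq_le hn hK r)
    push_cast; rfl
  · refine lintegral_congr fun x => ?_
    push_cast; ring

/-- The low factor n⁴F² has one power of frequency more than the n³F² of a shell. This surplus is
spent on the high side: λ_q² λ_{q-k} = λ_q³ 2^{-k}, so interactions at distance k decay
geometrically. The constant is 4 · 16 from the annuli, times 2 for the geometric sum and 2 for the
two squares. -/
theorem lintegral_lintegral_low_high_le (hn : Measurable n) (hF : Measurable F) :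
    ∫⁻ y, (n y ^ 2 * F y ^ 2 : ℝ≥0) * ∫⁻ z in {z | n z ≠ 0 ∧ n z ≤ n y}, (n z ^ 4 * F z ^ 2 : ℝ≥0) ∂μ ∂μ
      ≤ 256 * ∑' q : ℤ, ((lamN q ^ 3 : ℝ≥0) * ∫⁻ x in annulus n q, (F x ^ 2 : ℝ≥0) ∂μ) ^ 2 := by
  set β : ℤ → ℝ≥0∞ := fun q => (lamN q ^ 3 : ℝ≥0) * ∫⁻ x in annulus n q, (F x ^ 2 : ℝ≥0) ∂μ with hβ
  have hR : ∀ q : ℤ, ∫⁻ z in {z | n z ≠ 0 ∧ n z < lamN (q + 1)}, (n z ^ 4 * F z ^ 2 : ℝ≥0) ∂μ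
      ≤ ∑' k : ℕ, (16 * lamN (q - k) : ℝ≥0) * β (q - k) := by
    intro q
    refine (setLIntegral_lt_le_tsum_annulus _ q).trans (ENNReal.tsum_le_tsum fun k => ?_)
    calc _ ≤ ∫⁻ x in annulus n (q - k), ((16 * lamN (q - k) ^ 4 : ℝ≥0) : ℝ≥0∞) * (F x ^ 2 : ℝ≥0) ∂μ := by
          refine setLIntegral_mono' (measurableSet_annulus hn _) fun x hx => ?_
          norm_cast
          have := hx.2.le
          rw [lamN_add_one] at this
          calc _ ≤ (2 * lamN (q - k)) ^ 4 * F x ^ 2 := by gcongr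
            _ = _ := by ring
      _ = _ := by
          rw [lintegral_const_mul _ (by fun_prop), hβ]
          push_cast
          ring
  have hq : ∀ q : ℤ, ∫⁻ y in annulus n q, (n y ^ 2 * F y ^ 2 : ℝ≥0) *
      ∫⁻ z in {z | n z ≠ 0 ∧ n z ≤ n y}, (n z ^ 4 * F z ^ 2 : ℝ≥0) ∂μ ∂μ ≤
      ∑' k : ℕ, 64 * (((1 / 2 : ℝ≥0) ^ k : ℝ≥0) : ℝ≥0∞) * (β q * β (q - k)) := by
    intro q
    calc _ ≤ ∫⁻ y in annulus n q, ((4 * lamN q ^ 2 : ℝ≥0) : ℝ≥0∞) *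
          (∑' k : ℕ, (16 * lamN (q - k) : ℝ≥0) * β (q - k)) * (F y ^ 2 : ℝ≥0) ∂μ := by
          refine setLIntegral_mono' (measurableSet_annulus hn _) fun y hy => ?_
          have h1 : ((n y ^ 2 * F y ^ 2 : ℝ≥0) : ℝ≥0∞) ≤ (4 * lamN q ^ 2 : ℝ≥0) * (F y ^ 2 : ℝ≥0) := by
            norm_cast
            have := hy.2.le
            rw [lamN_add_one] at this
            calc _ ≤ (2 * lamN q) ^ 2 * F y ^ 2 := by gcongr
              _ = _ := by ring
          have h2 := (lintegral_mono_set (μ := μ) (f := fun z => ((n z ^ 4 * F z ^ 2 : ℝ≥0) : ℝ≥0∞))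
            fun z (hz : n z ≠ 0 ∧ n z ≤ n y) => (⟨hz.1, hz.2.trans_lt hy.2⟩ :
              n z ≠ 0 ∧ n z < lamN (q + 1))).trans (hR q)
          calc _ ≤ _ := mul_le_mul' h1 h2
            _ = _ := by ring
      _ = _ := by
          rw [lintegral_const_mul _ (by fun_prop), ← ENNReal.tsum_mul_left, ← ENNReal.tsum_mul_right]
          refine tsum_congr fun k => ?_
          rw [hβ, lamN_sub_nat]
          push_cast
          ring
  calc _ ≤ ∑' q : ℤ, ∑' k : ℕ, 64 * (((1 / 2 : ℝ≥0) ^ k : ℝ≥0) : ℝ≥0∞) * (β q * β (q - k)) :=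
        (lintegral_le_tsum_annulus fun x hx => by simp [hx]).trans (ENNReal.tsum_le_tsum hq)
    -- Separating the product before exchanging the sums makes each inner sum over q
    -- shift-invariant, so every k contributes the same ∑ β_q².
    _ ≤ ∑' q : ℤ, ∑' k : ℕ, 64 * (((1 / 2 : ℝ≥0) ^ k : ℝ≥0) : ℝ≥0∞) * (β q ^ 2 + β (q - k) ^ 2) := by
        gcongr
        exact ENNReal_mul_le_sq_add_sq _ _
    _ = ∑' k : ℕ, 64 * (((1 / 2 : ℝ≥0) ^ k : ℝ≥0) : ℝ≥0∞) * (2 * ∑' q : ℤ, β q ^ 2) := by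
        rw [ENNReal.tsum_comm]
        refine tsum_congr fun k => ?_
        have : ∑' q : ℤ, β (q - k) ^ 2 = ∑' q : ℤ, β q ^ 2 :=
          (Equiv.subRight (k : ℤ)).tsum_eq (fun q => β q ^ 2)
        rw [ENNReal.tsum_mul_left, ENNReal.tsum_add, this, two_mul]
    _ = _ := by
        rw [ENNReal.tsum_mul_right, ENNReal.tsum_mul_left, tsum_half_pow]
        ring

/-- For fixed y the inner integral is n³F² L, where L is the low-frequency integral of nF. Young's
inequality on the product n² · L yields δ n⁵F² and δ⁻¹ n F² L², and Cauchy-Schwarz bounds L² by 8K n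
times the fourth moment below n. Hence 2048 = 8 · 256. -/
theorem lintegral_lintegral_lowHigh_le (hn : Measurable n) (hF : Measurable F) {K : ℝ≥0}
    (hK : ∀ r : ℝ≥0, μ {x | n x ≠ 0 ∧ n x ≤ r} ≤ K * r ^ 3) {δ : ℝ≥0} (hδ : δ ≠ 0) :
    ∫⁻ y, ∫⁻ z, (lowHigh (n z) (F z) (n y) (F y) : ℝ≥0) ∂μ ∂μ ≤
      δ * ∫⁻ y, (n y ^ 5 * F y ^ 2 : ℝ≥0) ∂μ
      + (2048 * K * δ⁻¹ : ℝ≥0) *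
        ∑' q : ℤ, ((lamN q ^ 3 : ℝ≥0) * ∫⁻ x in annulus n q, (F x ^ 2 : ℝ≥0) ∂μ) ^ 2 := by
  have hS : ∀ y, MeasurableSet {z | n z ≠ 0 ∧ n z ≤ n y} := fun y =>
    measurableSet_low hn (n y)
  have hpt : ∀ y, ∫⁻ z, (lowHigh (n z) (F z) (n y) (F y) : ℝ≥0) ∂μ ≤
      (δ : ℝ≥0∞) * (n y ^ 5 * F y ^ 2 : ℝ≥0) + (8 * K * δ⁻¹ : ℝ≥0) * ((n y ^ 2 * F y ^ 2 : ℝ≥0) *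
        ∫⁻ z in {z | n z ≠ 0 ∧ n z ≤ n y}, (n z ^ 4 * F z ^ 2 : ℝ≥0) ∂μ) := by
    intro y
    set L := ∫⁻ z in {z | n z ≠ 0 ∧ n z ≤ n y}, (n z * F z : ℝ≥0) ∂μ with hL
    have e : ∫⁻ z, (lowHigh (n z) (F z) (n y) (F y) : ℝ≥0) ∂μ = (n y ^ 3 * F y ^ 2 : ℝ≥0) * L := by
      rw [hL, ← lintegral_const_mul _ (by fun_prop), ← lintegral_indicator (hS y)]
      refine lintegral_congr fun z => ?_
      unfold lowHigh
      by_cases h1 : n z = 0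
      · simp [h1]
      by_cases h2 : n z ≤ n y
      · rw [if_pos h2, indicator_of_mem (show z ∈ {z | n z ≠ 0 ∧ n z ≤ n y} from ⟨h1, h2⟩)]
        push_cast; ring
      · rw [if_neg h2, indicator_of_notMem (fun h => h2 h.2)]; simp
    have hY := ENNReal_young (δ := (δ : ℝ≥0∞)) (by simpa using hδ) ENNReal.coe_ne_top
      ((n y ^ 2 : ℝ≥0) : ℝ≥0∞) L
    have hL2 := sq_setLIntegral_le (μ := μ) hn hF hK (n y)
    rw [← hL] at hL2
    rw [e]
    calc _ = ((n y * F y ^ 2 : ℝ≥0) : ℝ≥0∞) * ((n y ^ 2 : ℝ≥0) * L) := by push_cast; ring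
      _ ≤ ((n y * F y ^ 2 : ℝ≥0) : ℝ≥0∞) * (δ * (n y ^ 2 : ℝ≥0) ^ 2 + (δ : ℝ≥0∞)⁻¹ * (8 * K * n y *
        ∫⁻ z in {z | n z ≠ 0 ∧ n z ≤ n y}, (n z ^ 4 * F z ^ 2 : ℝ≥0) ∂μ)) := by
          gcongr
          exact hY.trans (by gcongr)
      _ = _ := by
          push_cast [ENNReal.coe_inv hδ]
          ring
  refine (lintegral_mono hpt).trans ?_
  rw [lintegral_add_left (by fun_prop), lintegral_const_mul _ (by fun_prop),
    lintegral_const_mul' _ _ ENNReal.coe_ne_top]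
  refine add_le_add le_rfl ?_
  refine (mul_le_mul_right (lintegral_lintegral_low_high_le hn hF) _).trans (le_of_eq ?_)
  rw [← mul_assoc]
  congr 1
  push_cast
  ring

end Dyadic

end

section

open scoped ENNReal NNReal

/-! ### Rapidly decaying functions on frequency space -/

section Frequency

variable {G τ : Type*} [AddCommGroup G] [MeasurableSpace G]

/-- The Fourier dual `G` of a three-dimensional domain, with frequencies `ι g ∈ ℝ³`. -/
structure IsFreq (m : Measure G) (ι : G →+ E3) : Prop where
  meas : Measurable ι
  vol : ∃ K : ℝ≥0, ∀ r : ℝ≥0, m {g | ‖ι g‖₊ ≠ 0 ∧ ‖ι g‖₊ ≤ r} ≤ K * r ^ 3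
  inv_sq : ∫⁻ g, ((1 + ‖ι g‖ₑ ^ 2)⁻¹) ^ 2 ∂m < ⊤

/-- The function `x ↦ ∫ a(g) e^{i ι(g)·x} dm(g)`. -/
def synth (m : Measure G) (ι : G →+ E3) (a : G → ℂ) (x : E3) : ℂ :=
  ∫ g, a g * Complex.exp (Complex.I * ((inner ℝ (ι g) x : ℝ) : ℂ)) ∂m

/-- A family of functions on frequency space that is bounded in every weighted `L²` norm. -/
structure Decay (m : Measure G) (ι : G →+ E3) (b : τ → G → ℂ) : Prop where
  meas : ∀ t, Measurable (b t)
  bound : ∀ n : ℕ, ∃ M : ℝ≥0, ∀ t, ∫⁻ g, ‖ι g‖ₑ ^ n * ‖b t g‖ₑ ^ 2 ∂m ≤ M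

/-- Convolution on frequency space. -/
def conv (m : Measure G) (a b : G → ℂ) (x : G) : ℂ := ∫ y, a (x - y) * b y ∂m

/-- The Fourier multiplier of `∂_j`. -/
def der (ι : G →+ E3) (j : Fin 3) (a : G → ℂ) (g : G) : ℂ := Complex.I * ((ι g j : ℝ) : ℂ) * a g

theorem ENNReal_le_one_add_sq (x : ℝ≥0∞) : x ≤ 1 + x ^ 2 := by
  rcases le_total x 1 with h | h
  · exact h.trans le_self_add
  · exact (le_self_pow₀ h two_ne_zero).trans le_add_self

theorem ENNReal_add_pow_le (x y : ℝ≥0∞) (n : ℕ) : (x + y) ^ n ≤ 2 ^ n * (x ^ n + y ^ n) := by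
  rcases le_total x y with h | h
  · calc (x + y) ^ n ≤ (2 * y) ^ n := by rw [two_mul]; gcongr
      _ = 2 ^ n * y ^ n := mul_pow _ _ _
      _ ≤ _ := by gcongr; exact le_add_self
  · calc (x + y) ^ n ≤ (2 * x) ^ n := by rw [two_mul]; gcongr
      _ = 2 ^ n * x ^ n := mul_pow _ _ _
      _ ≤ _ := by gcongr; exact le_self_add

namespace Decay

variable {m : Measure G} {ι : G →+ E3} {a b : τ → G → ℂ}

theorem comp {σ : Type*} (ha : Decay m ι a) (f : σ → τ) : Decay m ι fun s => a (f s) :=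
  ⟨fun _ => ha.meas _, fun n => (ha.bound n).imp fun _ h _ => h _⟩

theorem single (ha : Decay m ι a) (t : τ) : Decay m ι fun _ : Unit => a t := ha.comp fun _ => t

/-- A symbol of polynomial growth only shifts the moments that are used. Constants, derivatives,
`weight`, `pot` and `phiq` all act through this lemma. -/
theorem of_norm_le (hι : Measurable ι) (ha : Decay m ι a) (hb : ∀ t, Measurable (b t))
    {C : ℝ≥0} {k : ℕ} (h : ∀ t g, ‖b t g‖ₑ ≤ C * (1 + ‖ι g‖ₑ ^ k) * ‖a t g‖ₑ) : Decay m ι b := by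
  refine ⟨hb, fun n => ?_⟩
  obtain ⟨M, hM⟩ := ha.bound n
  obtain ⟨M', hM'⟩ := ha.bound (n + k * 2)
  refine ⟨C ^ 2 * 4 * (M + M'), fun t => ?_⟩
  have hm := ha.meas t
  calc _ ≤ ∫⁻ g, (C ^ 2 * 4 : ℝ≥0) * (‖ι g‖ₑ ^ n * ‖a t g‖ₑ ^ 2 + ‖ι g‖ₑ ^ (n + k * 2) * ‖a t g‖ₑ ^ 2) ∂m := by
        refine lintegral_mono fun g => ?_
        calc _ ≤ ‖ι g‖ₑ ^ n * (C * (1 + ‖ι g‖ₑ ^ k) * ‖a t g‖ₑ) ^ 2 := by gcongr; exact h t g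
          _ = C ^ 2 * ‖ι g‖ₑ ^ n * ‖a t g‖ₑ ^ 2 * (1 + ‖ι g‖ₑ ^ k) ^ 2 := by ring
          _ ≤ C ^ 2 * ‖ι g‖ₑ ^ n * ‖a t g‖ₑ ^ 2 * (2 ^ 2 * (1 ^ 2 + (‖ι g‖ₑ ^ k) ^ 2)) := by
              gcongr; exact ENNReal_add_pow_le _ _ _
          _ = _ := by push_cast; ring
    _ ≤ _ := by
        rw [lintegral_const_mul _ (by fun_prop), lintegral_add_left (by fun_prop)]
        push_cast
        gcongr
        · exact hM t
        · exact hM' t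

theorem add (hι : Measurable ι) (ha : Decay m ι a) (hb : Decay m ι b) : Decay m ι fun t g => a t g + b t g := by
  refine ⟨fun t => (ha.meas t).add (hb.meas t), fun n => ?_⟩
  obtain ⟨M, hM⟩ := ha.bound n
  obtain ⟨M', hM'⟩ := hb.bound n
  refine ⟨4 * (M + M'), fun t => ?_⟩
  have hm := ha.meas t
  have hm' := hb.meas t
  calc _ ≤ ∫⁻ g, 4 * (‖ι g‖ₑ ^ n * ‖a t g‖ₑ ^ 2 + ‖ι g‖ₑ ^ n * ‖b t g‖ₑ ^ 2) ∂m := by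
        refine lintegral_mono fun g => ?_
        calc _ ≤ ‖ι g‖ₑ ^ n * (‖a t g‖ₑ + ‖b t g‖ₑ) ^ 2 := by gcongr; exact enorm_add_le _ _
          _ ≤ ‖ι g‖ₑ ^ n * (2 ^ 2 * (‖a t g‖ₑ ^ 2 + ‖b t g‖ₑ ^ 2)) := by
              gcongr; exact ENNReal_add_pow_le _ _ _
          _ = _ := by ring
    _ ≤ _ := by
        rw [lintegral_const_mul' _ _ (by simp)]
        push_cast
        gcongr
        rw [lintegral_add_left (by fun_prop)]
        gcongr
        · exact hM t
        · exact hM' t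

theorem mul_const (hι : Measurable ι) (ha : Decay m ι a) (c : ℂ) : Decay m ι fun t g => c * a t g :=
  of_norm_le hι (C := ‖c‖₊) (k := 0) ha (fun t => (ha.meas t).const_mul c) fun t g => by
    rw [enorm_mul, enorm_eq_nnnorm c]
    gcongr
    calc (‖c‖₊ : ℝ≥0∞) = ‖c‖₊ * 1 := (mul_one _).symm
      _ ≤ _ := by gcongr; simp

theorem neg (hι : Measurable ι) (ha : Decay m ι a) : Decay m ι fun t g => - a t g := by
  simpa using ha.mul_const hι (-1)

theorem sub (hι : Measurable ι) (ha : Decay m ι a) (hb : Decay m ι b) :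
    Decay m ι fun t g => a t g - b t g := by
  simpa [sub_eq_add_neg] using ha.add hι (hb.neg hι)

theorem sum (hι : Measurable ι) {κ : Type*} (s : Finset κ) {f : κ → τ → G → ℂ}
    (hf : ∀ k ∈ s, Decay m ι (f k)) : Decay m ι fun t g => ∑ k ∈ s, f k t g := by
  classical
  induction s using Finset.induction_on with
  | empty => exact ⟨fun t => by simp, fun n => ⟨0, by simp⟩⟩
  | insert k s hk ih =>
    simp only [Finset.sum_insert hk]
    exact (hf k (by simp)).add hι (ih fun j hj => hf j (by simp [hj]))

theorem der (hι : Measurable ι) (ha : Decay m ι a) (j : Fin 3) :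
    Decay m ι fun t => NSE.der ι j (a t) := by
  refine of_norm_le hι (C := 1) (k := 1) ha (fun t => ?_) fun t g => ?_
  · have h1 := ha.meas t
    have h2 : Measurable fun g => ι g j := (EuclideanSpace.proj (𝕜 := ℝ) j).measurable.comp hι
    unfold NSE.der
    fun_prop
  · unfold NSE.der
    rw [enorm_mul, enorm_mul]
    have : ‖((ι g j : ℝ) : ℂ)‖ₑ ≤ ‖ι g‖ₑ := by
      rw [enorm_le_iff_norm_le, Complex.norm_real]
      exact PiLp.norm_apply_le _ _
    have hI : ‖Complex.I‖ₑ = 1 := by simp [enorm_eq_nnnorm]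
    rw [hI, one_mul, ENNReal.coe_one, one_mul, pow_one]
    gcongr
    exact this.trans le_add_self

/-- Cauchy-Schwarz against (1 + |ι|²)⁻¹, which is square integrable by `inv_sq`, turns weighted L²
bounds into weighted L¹ bounds. -/
theorem l1 (hG : IsFreq m ι) (ha : Decay m ι a) (n : ℕ) :
    ∃ M : ℝ≥0, ∀ t, ∫⁻ g, ‖ι g‖ₑ ^ n * ‖a t g‖ₑ ∂m ≤ M := by
  have hι := hG.meas
  obtain ⟨M1, h1⟩ := ha.bound (2 * n)
  obtain ⟨M2, h2⟩ := ha.bound (2 * n + 4)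
  refine ⟨1 + (∫⁻ g, ((1 + ‖ι g‖ₑ ^ 2)⁻¹) ^ 2 ∂m).toNNReal * (4 * (M1 + M2)), fun t => ?_⟩
  have hm := ha.meas t
  -- Bounding x by 1 + x² avoids the square root that Cauchy-Schwarz would otherwise require.
  refine (ENNReal_le_one_add_sq _).trans ?_
  push_cast
  rw [ENNReal.coe_toNNReal hG.inv_sq.ne]
  gcongr
  have e : ∀ g, ‖ι g‖ₑ ^ n * ‖a t g‖ₑ =
      (1 + ‖ι g‖ₑ ^ 2)⁻¹ * ((1 + ‖ι g‖ₑ ^ 2) * ‖ι g‖ₑ ^ n * ‖a t g‖ₑ) := by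
    intro g
    rw [mul_assoc, ← mul_assoc (1 + ‖ι g‖ₑ ^ 2)⁻¹, ENNReal.inv_mul_cancel (by simp) (by finiteness),
      one_mul]
  simp_rw [e]
  refine (sq_lintegral_mul_le (by fun_prop) (by fun_prop)).trans ?_
  gcongr
  calc _ ≤ ∫⁻ g, 4 * (‖ι g‖ₑ ^ (2 * n) * ‖a t g‖ₑ ^ 2 + ‖ι g‖ₑ ^ (2 * n + 4) * ‖a t g‖ₑ ^ 2) ∂m := by
        refine lintegral_mono fun g => ?_
        calc _ = ‖ι g‖ₑ ^ (2 * n) * ‖a t g‖ₑ ^ 2 * (1 + ‖ι g‖ₑ ^ 2) ^ 2 := by ring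
          _ ≤ ‖ι g‖ₑ ^ (2 * n) * ‖a t g‖ₑ ^ 2 * (2 ^ 2 * (1 ^ 2 + (‖ι g‖ₑ ^ 2) ^ 2)) := by
              gcongr; exact ENNReal_add_pow_le _ _ _
          _ = _ := by ring
    _ ≤ _ := by
        rw [lintegral_const_mul' _ _ (by simp), lintegral_add_left (by fun_prop)]
        gcongr
        · exact h1 t
        · exact h2 t

theorem integrable_weight (hG : IsFreq m ι) (ha : Decay m ι a) (n : ℕ) (t : τ) :
    Integrable (fun g => ((‖ι g‖ ^ n : ℝ) : ℂ) * a t g) m := by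
  have hι := hG.meas
  have hm := ha.meas t
  obtain ⟨M, hM⟩ := ha.l1 hG n
  refine ⟨by fun_prop, lt_of_le_of_lt (le_of_eq ?_) ((hM t).trans_lt ENNReal.coe_lt_top)⟩
  refine lintegral_congr fun g => ?_
  rw [enorm_mul]
  congr 1
  rw [← ofReal_norm, Complex.norm_real, norm_pow, norm_norm,
    ENNReal.ofReal_pow (norm_nonneg _), ofReal_norm]

theorem integrable (hG : IsFreq m ι) (ha : Decay m ι a) (t : τ) : Integrable (a t) m := by
  simpa using ha.integrable_weight hG 0 t

theorem memLp_two (ha : Decay m ι a) (t : τ) : MemLp (a t) 2 m := by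
  have hm := ha.meas t
  rw [memLp_two_iff_integrable_sq_norm hm.aestronglyMeasurable]
  obtain ⟨M, hM⟩ := ha.bound 0
  refine ⟨by fun_prop, lt_of_le_of_lt (le_of_eq ?_) ((hM t).trans_lt ENNReal.coe_lt_top)⟩
  refine lintegral_congr fun g => ?_
  simp

end Decay

/-! ### Convolution on frequency space -/

section Convolution

variable {m : Measure G} {ι : G →+ E3} {a b : G → ℂ} [MeasurableAdd₂ G] [MeasurableNeg G] [SFinite m]
  [m.IsAddLeftInvariant]

theorem lintegral_lintegral_sub_mul {P Q : G → ℝ≥0∞} (hP : Measurable P) (hQ : Measurable Q) :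
    ∫⁻ x, ∫⁻ y, P (x - y) * Q y ∂m ∂m = (∫⁻ x, P x ∂m) * ∫⁻ y, Q y ∂m := by
  rw [lintegral_lintegral_swap (by fun_prop)]
  calc _ = ∫⁻ y, (∫⁻ x, P x ∂m) * Q y ∂m := by
        refine lintegral_congr fun y => ?_
        rw [lintegral_mul_const _ (by fun_prop), lintegral_sub_right_eq_self P y]
    _ = _ := lintegral_const_mul _ hQ

theorem measurable_conv (ha : Measurable a) (hb : Measurable b) : Measurable (conv m a b) := by
  refine (StronglyMeasurable.integral_prod_right (f := fun x y => a (x - y) * b y) ?_).measurable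
  exact Measurable.stronglyMeasurable (by unfold Function.uncurry; fun_prop)

theorem integrable_conv_prod (ha : Measurable a) (hb : Measurable b) (ha' : Integrable a m)
    (hb' : Integrable b m) : Integrable (fun p : G × G => a (p.1 - p.2) * b p.2) (m.prod m) := by
  refine ⟨by fun_prop, ?_⟩
  rw [HasFiniteIntegral, lintegral_prod _ (by fun_prop)]
  simp only [enorm_mul]
  rw [lintegral_lintegral_sub_mul (P := fun x => ‖a x‖ₑ) (Q := fun x => ‖b x‖ₑ) (by fun_prop)
    (by fun_prop)]
  exact ENNReal.mul_lt_top ha'.2 hb'.2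

/-- Characters are multiplicative and `m` is translation invariant, so Fubini factors the integral.
This identifies `advect` with the transform of the convective term. -/
theorem synth_conv (hι : Measurable ι) (ha : Measurable a) (hb : Measurable b)
    (ha' : Integrable a m) (hb' : Integrable b m) (x : E3) :
    synth m ι (conv m a b) x = synth m ι a x * synth m ι b x := by
  set e : G → ℂ := fun g => Complex.exp (Complex.I * ((inner ℝ (ι g) x : ℝ) : ℂ)) with he
  have hadd : ∀ g h, e (g + h) = e g * e h := fun g h => by
    simp only [he, map_add, inner_add_left, Complex.ofReal_add, mul_add, Complex.exp_add]
  have hnorm : ∀ g, ‖e g‖ = 1 := fun g => by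
    rw [he]; simp only; rw [mul_comm]; exact Complex.norm_exp_ofReal_mul_I _
  have hem : Measurable e := by fun_prop
  have hprod : Integrable (fun p : G × G => a (p.1 - p.2) * b p.2 * e p.1) (m.prod m) := by
    refine (integrable_conv_prod ha hb ha' hb').mono (by fun_prop) (ae_of_all _ fun p => ?_)
    rw [norm_mul (a (p.1 - p.2) * b p.2), hnorm, mul_one]
  calc synth m ι (conv m a b) x = ∫ p, ∫ q, a (p - q) * b q * e p ∂m ∂m := by
        refine integral_congr_ae (ae_of_all _ fun p => ?_)
        simp only [conv]
        rw [← integral_mul_const]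
    _ = ∫ q, ∫ p, a (p - q) * b q * e p ∂m ∂m := integral_integral_swap hprod
    _ = ∫ q, synth m ι a x * (b q * e q) ∂m := by
        refine integral_congr_ae (ae_of_all _ fun q => ?_)
        have : ∀ p, a (p - q) * b q * e p = (fun z => a z * e z) (p - q) * (b q * e q) := by
          intro p
          have h := hadd (p - q) q
          rw [sub_add_cancel] at h
          simp only [h]; ring
        simp only [this]
        rw [integral_mul_const, integral_sub_right_eq_self (fun z => a z * e z) q]
        rfl
    _ = _ := by rw [integral_const_mul]; rfl

/-- Cauchy-Schwarz with respect to the density P(x - y). Integrated in x, it is Young's inequality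
L¹ * L² ⊂ L². -/
theorem sq_lintegral_sub_mul_le {P Q : G → ℝ≥0∞} (hP : Measurable P) (hQ : Measurable Q)
    [m.IsNegInvariant] (x : G) :
    (∫⁻ y, P (x - y) * Q y ∂m) ^ 2 ≤ (∫⁻ y, P y ∂m) * ∫⁻ y, P (x - y) * Q y ^ 2 ∂m := by
  have e : ∀ y, P (x - y) * Q y = P (x - y) ^ (1 / 2 : ℝ) * (P (x - y) ^ (1 / 2 : ℝ) * Q y) := by
    intro y
    rw [← mul_assoc, ← ENNReal.rpow_add_of_nonneg _ _ (by norm_num) (by norm_num)]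
    norm_num
  have e2 : ∀ y, (P (x - y) ^ (1 / 2 : ℝ)) ^ 2 = P (x - y) := by
    intro y
    rw [← ENNReal.rpow_natCast, ← ENNReal.rpow_mul]
    norm_num
  calc _ = (∫⁻ y, P (x - y) ^ (1 / 2 : ℝ) * (P (x - y) ^ (1 / 2 : ℝ) * Q y) ∂m) ^ 2 := by
        simp_rw [← e]
    _ ≤ _ := sq_lintegral_mul_le (by fun_prop) (by fun_prop)
    _ = _ := by
        simp_rw [mul_pow, e2]
        rw [lintegral_sub_left_eq_self P x]

/-- The weight |ι x|ⁿ is distributed over x - y and y at the cost 2ⁿ; then `a` enters through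
weighted L¹ norms and `b` through weighted L² norms. -/
theorem Decay.conv [m.IsNegInvariant] (hG : IsFreq m ι) {a b : τ → G → ℂ} (ha : Decay m ι a)
    (hb : Decay m ι b) : Decay m ι fun t => NSE.conv m (a t) (b t) := by
  have hι := hG.meas
  refine ⟨fun t => measurable_conv (ha.meas t) (hb.meas t), fun n => ?_⟩
  obtain ⟨A0, hA0⟩ := ha.l1 hG 0
  obtain ⟨An, hAn⟩ := ha.l1 hG n
  obtain ⟨B0, hB0⟩ := hb.bound 0
  obtain ⟨Bn, hBn⟩ := hb.bound n
  refine ⟨A0 * (2 ^ n * (An * B0 + A0 * Bn)), fun t => ?_⟩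
  have hm := ha.meas t
  have hm' := hb.meas t
  simp only [pow_zero, one_mul] at hA0 hB0
  have hpt : ∀ x y, ‖ι x‖ₑ ^ n ≤ 2 ^ n * (‖ι (x - y)‖ₑ ^ n + ‖ι y‖ₑ ^ n) := by
    intro x y
    refine le_trans ?_ (ENNReal_add_pow_le _ _ _)
    gcongr
    calc _ = ‖ι (x - y) + ι y‖ₑ := by rw [← map_add, sub_add_cancel]
      _ ≤ _ := enorm_add_le _ _
  calc _ ≤ ∫⁻ x, ‖ι x‖ₑ ^ n * (∫⁻ y, ‖a t (x - y)‖ₑ * ‖b t y‖ₑ ∂m) ^ 2 ∂m := by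
        refine lintegral_mono fun x => ?_
        dsimp only
        gcongr
        refine (enorm_integral_le_lintegral_enorm _).trans (le_of_eq ?_)
        simp_rw [enorm_mul]
    _ ≤ ∫⁻ x, (A0 : ℝ≥0∞) * ∫⁻ y, 2 ^ n * ((‖ι (x - y)‖ₑ ^ n * ‖a t (x - y)‖ₑ) * ‖b t y‖ₑ ^ 2
          + ‖a t (x - y)‖ₑ * (‖ι y‖ₑ ^ n * ‖b t y‖ₑ ^ 2)) ∂m ∂m := by
        refine lintegral_mono fun x => ?_
        calc _ ≤ ‖ι x‖ₑ ^ n * (A0 * ∫⁻ y, ‖a t (x - y)‖ₑ * ‖b t y‖ₑ ^ 2 ∂m) := by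
              gcongr
              refine (sq_lintegral_sub_mul_le (P := fun z => ‖a t z‖ₑ) (by fun_prop)
                (by fun_prop) x).trans ?_
              gcongr
              exact hA0 t
          _ = A0 * ∫⁻ y, ‖ι x‖ₑ ^ n * (‖a t (x - y)‖ₑ * ‖b t y‖ₑ ^ 2) ∂m := by
              rw [lintegral_const_mul _ (by fun_prop)]; ring
          _ ≤ _ := by
              refine mul_le_mul_right (lintegral_mono fun y => ?_) _
              calc _ ≤ 2 ^ n * (‖ι (x - y)‖ₑ ^ n + ‖ι y‖ₑ ^ n) * (‖a t (x - y)‖ₑ * ‖b t y‖ₑ ^ 2) := by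
                    gcongr; exact hpt x y
                _ = _ := by ring
    _ ≤ _ := by
        rw [lintegral_const_mul' _ _ ENNReal.coe_ne_top]
        have : ∀ x, ∫⁻ y, 2 ^ n * ((‖ι (x - y)‖ₑ ^ n * ‖a t (x - y)‖ₑ) * ‖b t y‖ₑ ^ 2
          + ‖a t (x - y)‖ₑ * (‖ι y‖ₑ ^ n * ‖b t y‖ₑ ^ 2)) ∂m =
          2 ^ n * (∫⁻ y, (‖ι (x - y)‖ₑ ^ n * ‖a t (x - y)‖ₑ) * ‖b t y‖ₑ ^ 2 ∂m
          + ∫⁻ y, ‖a t (x - y)‖ₑ * (‖ι y‖ₑ ^ n * ‖b t y‖ₑ ^ 2) ∂m) := by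
          intro x
          rw [lintegral_const_mul _ (by fun_prop), lintegral_add_left (by fun_prop)]
        simp_rw [this]
        have hmeas : Measurable fun x => ∫⁻ y, (‖ι (x - y)‖ₑ ^ n * ‖a t (x - y)‖ₑ) * ‖b t y‖ₑ ^ 2 ∂m :=
          Measurable.lintegral_prod_right' (f := fun p : G × G =>
            (‖ι (p.1 - p.2)‖ₑ ^ n * ‖a t (p.1 - p.2)‖ₑ) * ‖b t p.2‖ₑ ^ 2) (by fun_prop)
        rw [lintegral_const_mul' _ _ (by finiteness), lintegral_add_left hmeas,
          lintegral_lintegral_sub_mul (P := fun z => ‖ι z‖ₑ ^ n * ‖a t z‖ₑ)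
            (Q := fun y => ‖b t y‖ₑ ^ 2) (by fun_prop) (by fun_prop),
          lintegral_lintegral_sub_mul (P := fun z => ‖a t z‖ₑ)
            (Q := fun y => ‖ι y‖ₑ ^ n * ‖b t y‖ₑ ^ 2) (by fun_prop) (by fun_prop)]
        push_cast
        gcongr
        · exact hAn t
        · exact hB0 t
        · exact hA0 t
        · exact hBn t

end Convolution

/-! ### Linearity and differentiation of the synthesis -/

section Synthesis

variable {m : Measure G} {ι : G →+ E3} {a b : G → ℂ}

theorem norm_exp_I_inner (g : G) (x : E3) :
    ‖Complex.exp (Complex.I * ((inner ℝ (ι g) x : ℝ) : ℂ))‖ = 1 := by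
  rw [mul_comm]; exact Complex.norm_exp_ofReal_mul_I _

theorem integrable_synth (hι : Measurable ι) (ha : Integrable a m) (x : E3) :
    Integrable (fun g => a g * Complex.exp (Complex.I * ((inner ℝ (ι g) x : ℝ) : ℂ))) m :=
  ha.mul_bdd (c := 1) (by fun_prop) (ae_of_all _ fun g => (norm_exp_I_inner g x).le)

theorem synth_add (hι : Measurable ι) (ha : Integrable a m) (hb : Integrable b m) (x : E3) :
    synth m ι (fun g => a g + b g) x = synth m ι a x + synth m ι b x := by
  simp only [synth, add_mul]
  exact integral_add (integrable_synth hι ha x) (integrable_synth hι hb x)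

theorem synth_sub (hι : Measurable ι) (ha : Integrable a m) (hb : Integrable b m) (x : E3) :
    synth m ι (fun g => a g - b g) x = synth m ι a x - synth m ι b x := by
  simp only [synth, sub_mul]
  exact integral_sub (integrable_synth hι ha x) (integrable_synth hι hb x)

theorem synth_const_mul (c : ℂ) (x : E3) :
    synth m ι (fun g => c * a g) x = c * synth m ι a x := by
  simp only [synth, mul_assoc]
  exact integral_const_mul _ _

theorem synth_sum (hι : Measurable ι) {κ : Type*} (s : Finset κ) {f : κ → G → ℂ}
    (hf : ∀ k ∈ s, Integrable (f k) m) (x : E3) :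
    synth m ι (fun g => ∑ k ∈ s, f k g) x = ∑ k ∈ s, synth m ι (f k) x := by
  simp only [synth, Finset.sum_mul]
  exact integral_finsetSum _ fun k hk => integrable_synth hι (hf k hk) x

theorem integrable_der (hι : Measurable ι) (ha : Measurable a)
    (ha1 : Integrable (fun g => ((‖ι g‖ ^ 1 : ℝ) : ℂ) * a g) m) (j : Fin 3) :
    Integrable (der ι j a) m := by
  have hj : Measurable fun g => ι g j := (EuclideanSpace.proj (𝕜 := ℝ) j).measurable.comp hι
  refine ha1.mono (by unfold der; fun_prop) (ae_of_all _ fun g => ?_)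
  simp only [der, norm_mul, Complex.norm_I, one_mul, Complex.norm_real, pow_one, norm_norm]
  gcongr
  exact PiLp.norm_apply_le _ _

theorem hasDerivAt_synth (hι : Measurable ι) (ha : Measurable a) (ha0 : Integrable a m)
    (ha1 : Integrable (fun g => ((‖ι g‖ ^ 1 : ℝ) : ℂ) * a g) m) (j : Fin 3) (x : E3) (s : ℝ) :
    HasDerivAt (fun s : ℝ => synth m ι a (x + s • EuclideanSpace.single j 1))
      (synth m ι (der ι j a) (x + s • EuclideanSpace.single j 1)) s := by
  have hd := integrable_der hι ha ha1 j
  have hj : Measurable fun g => ι g j := (EuclideanSpace.proj (𝕜 := ℝ) j).measurable.comp hι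
  have hpt : ∀ g, ∀ s : ℝ, HasDerivAt (fun s : ℝ => a g * Complex.exp (Complex.I *
      ((inner ℝ (ι g) (x + s • EuclideanSpace.single j 1) : ℝ) : ℂ)))
      (der ι j a g * Complex.exp (Complex.I *
      ((inner ℝ (ι g) (x + s • EuclideanSpace.single j 1) : ℝ) : ℂ))) s := by
    intro g s
    have h1 : HasDerivAt (fun s : ℝ => (inner ℝ (ι g) (x + s • EuclideanSpace.single j 1) : ℝ))
        (ι g j) s := by
      have e : (fun s : ℝ => (inner ℝ (ι g) (x + s • EuclideanSpace.single j 1) : ℝ)) =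
          fun s => inner ℝ (ι g) x + s * ι g j := by
        funext s
        rw [inner_add_right, inner_smul_right, EuclideanSpace.inner_single_right]
        simp
      rw [e]
      simpa using ((hasDerivAt_id s).mul_const (ι g j)).const_add (inner ℝ (ι g) x)
    have h2 := ((h1.ofReal_comp.const_mul Complex.I).cexp).const_mul (a g)
    refine h2.congr_deriv ?_
    simp only [der]
    ring
  have hb : ∀ g, ∀ s ∈ (univ : Set ℝ), ‖der ι j a g * Complex.exp (Complex.I *
      ((inner ℝ (ι g) (x + s • EuclideanSpace.single j 1) : ℝ) : ℂ))‖ ≤ ‖der ι j a g‖ := by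
    intro g s _
    rw [norm_mul, norm_exp_I_inner, mul_one]
  exact (hasDerivAt_integral_of_dominated_loc_of_deriv_le (𝕜 := ℝ) univ_mem
    (Eventually.of_forall fun s => (integrable_synth hι ha0 _).aestronglyMeasurable)
    (integrable_synth hι ha0 _) (integrable_synth hι hd _).aestronglyMeasurable
    (ae_of_all _ hb) hd.norm (ae_of_all _ fun g s _ => hpt g s)).2

end Synthesis

end Frequency

end

section

open scoped ENNReal NNReal ComplexConjugate

/-! ### The nonlinear term on the frequency side -/

section Nonlinear

variable {G : Type*} [AddCommGroup G] [MeasurableSpace G] {m : Measure G} {ι : G →+ E3}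

/-- The Fourier transform of a smooth real divergence-free vector field. -/
structure IsVelocity (m : Measure G) (ι : G →+ E3) (a : Fin 3 → G → ℂ) : Prop where
  decay : ∀ i, Decay m ι fun _ : Unit => a i
  real : ∀ i g, a i (-g) = conj (a i g)
  div : ∀ g, ∑ i, ((ι g i : ℝ) : ℂ) * a i g = 0

/-- The vector `(a₁, a₂, a₃)` at a frequency. -/
def vec (a : Fin 3 → G → ℂ) (g : G) : C3 := WithLp.toLp 2 fun i => a i g

/-- The amplitude of a vector field at a frequency. -/
def amp (a : Fin 3 → G → ℂ) (g : G) : ℝ≥0 := ‖vec a g‖₊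

theorem coe_amp (a : Fin 3 → G → ℂ) (g : G) : (amp a g : ℝ) = ‖vec a g‖ := rfl

theorem amp_sq (a : Fin 3 → G → ℂ) (g : G) : (amp a g : ℝ) ^ 2 = ∑ i, ‖a i g‖ ^ 2 := by
  rw [coe_amp, EuclideanSpace.norm_sq_eq]; rfl

theorem measurable_amp {a : Fin 3 → G → ℂ} (ha : ∀ i, Measurable (a i)) : Measurable (amp a) := by
  refine Measurable.nnnorm ?_
  exact (WithLp.measurable_toLp 2 _).comp (measurable_pi_lambda _ ha)

/-- The Fourier transform of `((u · ∇) v)_i`, where `a`, `b` are the transforms of `u`, `v_i`. -/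
def advect (m : Measure G) (ι : G →+ E3) (a : Fin 3 → G → ℂ) (b : G → ℂ) (g : G) : ℂ :=
  ∑ l, conv m (a l) (der ι l b) g

/-- The integrand of the energy flux through the weight `w`. -/
def flux (w : G → ℝ) (ι : G →+ E3) (a : Fin 3 → G → ℂ) (p : G × G) : ℝ :=
  w p.1 * (Complex.I * (∑ l, ((ι p.2 l : ℝ) : ℂ) * a l (p.1 - p.2)) *
    ∑ i, a i p.2 * conj (a i p.1)).re

/-- Incompressibility at x - y allows ι y to be replaced by ι x in the transport factor, and reality
gives a(y - x) = conj a(x - y). Exchanging x and y therefore maps the complex integrand to minus its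
conjugate, so its real part changes sign. With a constant weight the flux would cancel, which is
energy conservation. -/
theorem flux_add_swap {a : Fin 3 → G → ℂ} (ha : IsVelocity m ι a) (w : G → ℝ) (x y : G) :
    flux w ι a (x, y) + flux w ι a (y, x) = (w x - w y) *
      (Complex.I * (∑ l, ((ι y l : ℝ) : ℂ) * a l (x - y)) * ∑ i, a i y * conj (a i x)).re := by
  have h1 : ∑ l, ((ι x l : ℝ) : ℂ) * a l (x - y) = ∑ l, ((ι y l : ℝ) : ℂ) * a l (x - y) := by
    have h := ha.div (x - y)
    rw [← sub_eq_zero, ← Finset.sum_sub_distrib, ← h]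
    refine Finset.sum_congr rfl fun i _ => ?_
    rw [map_sub, PiLp.sub_apply, Complex.ofReal_sub]
    ring
  have h2 : ∀ l, a l (y - x) = conj (a l (x - y)) := fun l => by rw [← ha.real, neg_sub]
  have h3 : (Complex.I * (∑ l, ((ι x l : ℝ) : ℂ) * a l (y - x)) * ∑ i, a i x * conj (a i y)) =
      - conj (Complex.I * (∑ l, ((ι y l : ℝ) : ℂ) * a l (x - y)) * ∑ i, a i y * conj (a i x)) := by
    rw [← h1]
    simp only [h2, map_mul, map_sum, Complex.conj_I, Complex.conj_ofReal, Complex.conj_conj]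
    simp only [mul_comm (conj (a _ y))]
    ring
  simp only [flux, h3, Complex.neg_re, Complex.conj_re]
  ring

theorem norm_sum_mul_le (a : Fin 3 → G → ℂ) (v : E3) (g : G) :
    ‖∑ l, ((v l : ℝ) : ℂ) * a l g‖ ≤ ‖v‖ * amp a g := by
  have h := norm_inner_le_norm (𝕜 := ℂ) (WithLp.toLp 2 fun i => ((v i : ℝ) : ℂ) : C3) (vec a g)
  rw [PiLp.inner_apply] at h
  have e : ‖(WithLp.toLp 2 fun i => ((v i : ℝ) : ℂ) : C3)‖ = ‖v‖ := by
    simp [EuclideanSpace.norm_eq]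
  rw [e] at h
  refine le_trans (le_of_eq ?_) h
  congr 1
  refine Finset.sum_congr rfl fun i _ => ?_
  simp [vec, mul_comm]

theorem norm_sum_mul_conj_le (a : Fin 3 → G → ℂ) (g h : G) :
    ‖∑ i, a i g * conj (a i h)‖ ≤ amp a g * amp a h := by
  have h := norm_inner_le_norm (𝕜 := ℂ) (vec a h) (vec a g)
  rw [PiLp.inner_apply, mul_comm] at h
  exact h

/-- The transport factor is the same for ι x and ι y, so it can be estimated with the smaller of
them, whence the minimum. The difference of weights supplies the remaining three powers. -/
theorem abs_flux_add_swap_le {ψ : E3 → ℝ} {C : ℝ}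
    (hC : ∀ x y : E3, |weight ψ x - weight ψ y| ≤ C * (‖x - y‖ * max ‖x‖ ‖y‖ ^ 2))
    {a : Fin 3 → G → ℂ} (ha : IsVelocity m ι a) (x y : G) :
    |flux (fun g => weight ψ (ι g)) ι a (x, y) + flux (fun g => weight ψ (ι g)) ι a (y, x)| ≤
      C * (‖ι (x - y)‖ * max ‖ι y‖ ‖ι x‖ ^ 2 * min ‖ι y‖ ‖ι x‖ *
        (amp a (x - y) * amp a y * amp a x)) := by
  rw [flux_add_swap ha, abs_mul]
  have h1 : ∑ l, ((ι x l : ℝ) : ℂ) * a l (x - y) = ∑ l, ((ι y l : ℝ) : ℂ) * a l (x - y) := by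
    have h := ha.div (x - y)
    rw [← sub_eq_zero, ← Finset.sum_sub_distrib, ← h]
    refine Finset.sum_congr rfl fun i _ => ?_
    rw [map_sub, PiLp.sub_apply, Complex.ofReal_sub]
    ring
  have h2 : ‖∑ l, ((ι y l : ℝ) : ℂ) * a l (x - y)‖ ≤ min ‖ι y‖ ‖ι x‖ * amp a (x - y) := by
    rcases min_choice ‖ι y‖ ‖ι x‖ with e | e <;> rw [e]
    · exact norm_sum_mul_le a _ _
    · rw [← h1]; exact norm_sum_mul_le a _ _
  have h3 := norm_sum_mul_conj_le a y x
  have h4 := hC (ι x) (ι y)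
  rw [← map_sub, max_comm] at h4
  calc _ ≤ C * (‖ι (x - y)‖ * max ‖ι y‖ ‖ι x‖ ^ 2) *
        ((min ‖ι y‖ ‖ι x‖ * amp a (x - y)) * (amp a y * amp a x)) := by
        refine mul_le_mul h4 ?_ (abs_nonneg _) ((abs_nonneg _).trans h4)
        refine (Complex.abs_re_le_norm _).trans ?_
        rw [norm_mul, norm_mul, Complex.norm_I, one_mul]
        exact mul_le_mul h2 h3 (norm_nonneg _) (by positivity)
    _ = _ := by ring

/-! ### Integrability of the flux and the symmetrized bound -/

section Integrals

variable [MeasurableAdd₂ G] [MeasurableNeg G] [SFinite m] [m.IsAddLeftInvariant] [m.IsNegInvariant]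

/-- Both `h` and the convolution of |a| with |b| are square integrable, so their product is
integrable. This licenses Fubini for the flux. -/
theorem integrable_triple (hG : IsFreq m ι) {h a b : G → ℂ} (hh : Decay m ι fun _ : Unit => h)
    (ha : Decay m ι fun _ : Unit => a) (hb : Decay m ι fun _ : Unit => b) :
    Integrable (fun p : G × G => h p.1 * (a (p.1 - p.2) * b p.2)) (m.prod m) := by
  have h1 : Measurable h := hh.meas ()
  have h2 : Measurable a := ha.meas ()
  have h3 : Measurable b := hb.meas ()
  refine ⟨by fun_prop, ?_⟩
  rw [HasFiniteIntegral, lintegral_prod _ (by fun_prop)]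
  obtain ⟨A, hA⟩ := ha.l1 hG 0
  obtain ⟨B, hB⟩ := hb.bound 0
  obtain ⟨H, hH⟩ := hh.bound 0
  simp only [pow_zero, one_mul] at hA hB hH
  replace hA := hA ()
  replace hB := hB ()
  replace hH := hH ()
  have e : ∀ x, ∫⁻ y, ‖h x * (a (x - y) * b y)‖ₑ ∂m = ‖h x‖ₑ * ∫⁻ y, ‖a (x - y)‖ₑ * ‖b y‖ₑ ∂m := by
    intro x
    simp only [enorm_mul]
    rw [lintegral_const_mul _ (by fun_prop)]
  simp only [e]
  calc _ ≤ ∫⁻ x, (‖h x‖ₑ ^ 2 + A * ∫⁻ y, ‖a (x - y)‖ₑ * ‖b y‖ₑ ^ 2 ∂m) ∂m := by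
        refine lintegral_mono fun x => (ENNReal_mul_le_sq_add_sq _ _).trans ?_
        gcongr
        refine (sq_lintegral_sub_mul_le (P := fun z => ‖a z‖ₑ) (by fun_prop) (by fun_prop) x).trans ?_
        gcongr
    _ ≤ H + A * (A * B) := by
        rw [lintegral_add_left (by fun_prop), lintegral_const_mul' _ _ ENNReal.coe_ne_top,
          lintegral_lintegral_sub_mul (P := fun z => ‖a z‖ₑ) (Q := fun y => ‖b y‖ₑ ^ 2) (by fun_prop)
            (by fun_prop)]
        gcongr
    _ < ⊤ := by finiteness

theorem Decay.weight_mul {τ : Type*} {ψ : E3 → ℝ} (hψ : IsCutoff ψ) (hι : Measurable ι)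
    {a : τ → G → ℂ} (ha : Decay m ι a) : Decay m ι fun t g => (weight ψ (ι g) : ℂ) * a t g := by
  obtain ⟨C, hC, h⟩ := exists_weight_le hψ
  have hw : Measurable fun g => weight ψ (ι g) := (continuous_weight hψ).measurable.comp hι
  refine Decay.of_norm_le hι (C := C.toNNReal) (k := 3) ha (fun t => ?_) fun t g => ?_
  · have := ha.meas t
    fun_prop
  · rw [enorm_mul]
    gcongr
    have h1 : ‖(weight ψ (ι g) : ℂ)‖ ≤ C * ‖ι g‖ ^ 3 := by
      rw [Complex.norm_real, Real.norm_of_nonneg (weight_nonneg _ _)]; exact h _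
    calc _ = ENNReal.ofReal ‖(weight ψ (ι g) : ℂ)‖ := (ofReal_norm _).symm
      _ ≤ ENNReal.ofReal (C * ‖ι g‖ ^ 3) := ENNReal.ofReal_le_ofReal h1
      _ = C.toNNReal * ‖ι g‖ₑ ^ 3 := by
          rw [ENNReal.ofReal_mul hC.le, ENNReal.ofReal_pow (norm_nonneg _), ofReal_norm]; rfl
      _ ≤ _ := by gcongr; exact le_add_self

theorem Decay.conj {τ : Type*} {a : τ → G → ℂ} (ha : Decay m ι a) :
    Decay m ι fun t g => conj (a t g) := by
  refine ⟨fun t => ?_, fun n => ?_⟩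
  · exact Complex.continuous_conj.measurable.comp (ha.meas t)
  · simpa only [enorm_eq_nnnorm, RCLike.nnnorm_conj] using ha.bound n

theorem Decay.advect {τ : Type*} (hG : IsFreq m ι) {a : Fin 3 → τ → G → ℂ} {b : τ → G → ℂ}
    (ha : ∀ i, Decay m ι (a i)) (hb : Decay m ι b) :
    Decay m ι fun t => advect m ι (fun i => a i t) (b t) := by
  unfold NSE.advect
  exact Decay.sum hG.meas _ fun l _ => (ha l).conv hG (hb.der hG.meas l)

/-- The trilinear form as a double integral of the flux. -/
theorem integral_weight_advect {ψ : E3 → ℝ} (hψ : IsCutoff ψ) (hG : IsFreq m ι)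
    {a : Fin 3 → G → ℂ} (ha : IsVelocity m ι a) :
    Integrable (flux (fun g => weight ψ (ι g)) ι a) (m.prod m) ∧
    ∫ g, weight ψ (ι g) * (∑ i, advect m ι a (a i) g * conj (a i g)).re ∂m =
      ∫ p, flux (fun g => weight ψ (ι g)) ι a p ∂(m.prod m) := by
  have hI : ∀ i l : Fin 3, Integrable (fun p : G × G => ((weight ψ (ι p.1) : ℂ) * conj (a i p.1)) *
      (a l (p.1 - p.2) * der ι l (a i) p.2)) (m.prod m) := fun i l =>
    integrable_triple hG (((ha.decay i).conj).weight_mul hψ hG.meas) (ha.decay l)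
      ((ha.decay i).der hG.meas l)
  have hflux : flux (fun g => weight ψ (ι g)) ι a = fun p : G × G =>
      (∑ i, ∑ l, ((weight ψ (ι p.1) : ℂ) * conj (a i p.1)) *
      (a l (p.1 - p.2) * der ι l (a i) p.2)).re := by
    funext p
    unfold flux
    rw [← Complex.re_ofReal_mul]
    congr 1
    rw [mul_assoc Complex.I, Finset.mul_sum, Finset.mul_sum, Finset.mul_sum]
    refine Finset.sum_congr rfl fun i _ => ?_
    rw [Finset.sum_mul, Finset.mul_sum, Finset.mul_sum]
    refine Finset.sum_congr rfl fun l _ => ?_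
    unfold der
    ring
  have hS := integrable_finsetSum Finset.univ fun i _ =>
    integrable_finsetSum Finset.univ fun l _ => hI i l
  refine ⟨by rw [hflux]; exact hS.re, ?_⟩
  rw [hflux]
  have e1 := integral_re hS
  simp only [RCLike.re_to_complex] at e1
  rw [e1, integral_prod _ hS, ← RCLike.re_to_complex, ← integral_re hS.integral_prod_left]
  refine integral_congr_ae ?_
  have hae : ∀ᵐ x ∂m, ∀ i l : Fin 3, Integrable (fun y => ((weight ψ (ι x) : ℂ) * conj (a i x)) *
      (a l (x - y) * der ι l (a i) y)) m := by
    rw [ae_all_iff]; intro i; rw [ae_all_iff]; intro l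
    exact (hI i l).prod_right_ae
  filter_upwards [hae] with x hx
  rw [integral_finsetSum _ fun i _ => integrable_finsetSum _ fun l _ => hx i l]
  rw [RCLike.re_to_complex, ← Complex.re_ofReal_mul]
  congr 1
  rw [Finset.mul_sum]
  refine Finset.sum_congr rfl fun i _ => ?_
  rw [integral_finsetSum _ fun l _ => hx i l]
  unfold advect
  rw [Finset.sum_mul, Finset.mul_sum]
  refine Finset.sum_congr rfl fun l _ => ?_
  rw [integral_const_mul]
  unfold conv
  ring

/-- The flux alone does not satisfy the good pointwise bound, only its sum with its swap does. Since
exchanging variables preserves the product measure, the integral of that sum is twice the trilinear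
term. -/
theorem ofReal_abs_trilinear_le {ψ : E3 → ℝ} (hψ : IsCutoff ψ) (hG : IsFreq m ι) {C : ℝ≥0}
    (hC : ∀ x y : E3, |weight ψ x - weight ψ y| ≤ C * (‖x - y‖ * max ‖x‖ ‖y‖ ^ 2))
    {a : Fin 3 → G → ℂ} (ha : IsVelocity m ι a) :
    ENNReal.ofReal |∫ g, weight ψ (ι g) * (∑ i, advect m ι a (a i) g * conj (a i g)).re ∂m| ≤
      C * (6 * ∫⁻ y, ∫⁻ z, (lowHigh ‖ι z‖₊ (amp a z) ‖ι y‖₊ (amp a y) : ℝ≥0) ∂m ∂m) := by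
  obtain ⟨hI, e⟩ := integral_weight_advect hψ hG ha
  have hι := hG.meas
  have hF : Measurable (amp a) := measurable_amp fun i => (ha.decay i).meas ()
  set Φ := flux (fun g => weight ψ (ι g)) ι a
  have hsw : ∫ p : G × G, Φ p.swap ∂(m.prod m) = ∫ p, Φ p ∂(m.prod m) := integral_prod_swap Φ
  have h2 : 2 * ∫ p, Φ p ∂(m.prod m) = ∫ p : G × G, (Φ p + Φ p.swap) ∂(m.prod m) := by
    have h := integral_add hI hI.swap
    simp only [Function.comp_apply] at h
    rw [h, hsw, two_mul]
  -- The factor 1/2 from the symmetrization is discarded.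
  have h3 : |∫ p, Φ p ∂(m.prod m)| ≤ |∫ p : G × G, (Φ p + Φ p.swap) ∂(m.prod m)| := by
    rw [← h2, abs_mul, abs_two]; linarith [abs_nonneg (∫ p, Φ p ∂(m.prod m))]
  rw [e]
  calc _ ≤ ENNReal.ofReal |∫ p : G × G, (Φ p + Φ p.swap) ∂(m.prod m)| := ENNReal.ofReal_le_ofReal h3
    _ = ‖∫ p : G × G, (Φ p + Φ p.swap) ∂(m.prod m)‖ₑ := by rw [← Real.norm_eq_abs, ofReal_norm]
    _ ≤ ∫⁻ p : G × G, ‖Φ p + Φ p.swap‖ₑ ∂(m.prod m) := enorm_integral_le_lintegral_enorm _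
    _ ≤ ∫⁻ p : G × G, C * ((‖ι (p.1 - p.2)‖₊ * max ‖ι p.2‖₊ ‖ι p.1‖₊ ^ 2 * min ‖ι p.2‖₊ ‖ι p.1‖₊ *
        (amp a (p.1 - p.2) * amp a p.2 * amp a p.1) : ℝ≥0) : ℝ≥0∞) ∂(m.prod m) := by
        refine lintegral_mono fun p => ?_
        have h := abs_flux_add_swap_le hC ha p.1 p.2
        rw [← Real.norm_eq_abs] at h
        rw [← ENNReal.coe_mul, enorm_eq_nnnorm, ENNReal.coe_le_coe, ← NNReal.coe_le_coe]
        push_cast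
        exact h
    _ = C * ∫⁻ x, ∫⁻ y, ((‖ι (x - y)‖₊ * max ‖ι y‖₊ ‖ι x‖₊ ^ 2 * min ‖ι y‖₊ ‖ι x‖₊ *
        (amp a (x - y) * amp a y * amp a x) : ℝ≥0) : ℝ≥0∞) ∂m ∂m := by
        rw [lintegral_const_mul' _ _ ENNReal.coe_ne_top, lintegral_prod _ (by fun_prop)]
    _ ≤ _ := by
        gcongr
        exact lintegral_trilinear_le (n := fun g => ‖ι g‖₊) (by fun_prop) hF
          (fun g h => by rw [map_add]; exact nnnorm_add_le _ _) fun g => by rw [map_neg, nnnorm_neg]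

end Integrals

end Nonlinear

end

/-! ### Shells on the frequency side and absorption by the dissipation -/

section

open scoped ENNReal NNReal ComplexConjugate

section ShellHat

variable {G : Type*} [AddCommGroup G] [MeasurableSpace G] {m : Measure G} {ι : G →+ E3}
  {a : Fin 3 → G → ℂ} {ψ : E3 → ℝ}

/-- The contribution of the `q`-th shell, on the frequency side. -/
def shellHat (m : Measure G) (ι : G →+ E3) (ψ : E3 → ℝ) (a : Fin 3 → G → ℂ) (q : ℤ) : ℝ :=
  lam q ^ 3 * ∫ g, phiq ψ q (ι g) ^ 2 * (amp a g : ℝ) ^ 2 ∂m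

theorem measurable_phiq (hψ : IsCutoff ψ) (hι : Measurable ι) (q : ℤ) :
    Measurable fun g => phiq ψ q (ι g) :=
  (contDiff_phiq hψ q).continuous.measurable.comp hι

theorem measurable_weight (hψ : IsCutoff ψ) (hι : Measurable ι) :
    Measurable fun g => weight ψ (ι g) :=
  (continuous_weight hψ).measurable.comp hι

theorem IsVelocity.measurable_amp (ha : IsVelocity m ι a) : Measurable (amp a) :=
  NSE.measurable_amp fun i => (ha.decay i).meas ()

theorem IsVelocity.integrable_pow_mul_amp_sq (hι : Measurable ι) (ha : IsVelocity m ι a) (n : ℕ) :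
    Integrable (fun g => ‖ι g‖ ^ n * (amp a g : ℝ) ^ 2) m := by
  have e : (fun g => ‖ι g‖ ^ n * (amp a g : ℝ) ^ 2) = fun g => ∑ i, ‖ι g‖ ^ n * ‖a i g‖ ^ 2 := by
    funext g; rw [amp_sq, Finset.mul_sum]
  rw [e]
  refine integrable_finsetSum _ fun i _ => ?_
  have hm : Measurable (a i) := (ha.decay i).meas ()
  obtain ⟨M, hM⟩ := (ha.decay i).bound n
  refine ⟨by fun_prop, lt_of_le_of_lt (le_of_eq ?_) ((hM ()).trans_lt ENNReal.coe_lt_top)⟩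
  refine lintegral_congr fun g => ?_
  rw [enorm_mul, enorm_pow, enorm_pow, enorm_norm, enorm_norm]

theorem IsVelocity.integrable_phiq (hψ : IsCutoff ψ) (hι : Measurable ι) (ha : IsVelocity m ι a)
    (q : ℤ) : Integrable (fun g => phiq ψ q (ι g) ^ 2 * (amp a g : ℝ) ^ 2) m := by
  obtain ⟨L, hL, hL1, -⟩ := hψ.exists_bound
  have h := ha.integrable_pow_mul_amp_sq hι 0
  simp only [pow_zero, one_mul] at h
  have := measurable_phiq hψ hι q
  refine h.bdd_mul (c := L ^ 2) (this.pow_const 2).aestronglyMeasurable (ae_of_all _ fun g => ?_)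
  rw [Real.norm_eq_abs, abs_pow]
  exact pow_le_pow_left₀ (abs_nonneg _) (hL1 _ _) 2

theorem IsVelocity.integrable_weight_amp_sq (hψ : IsCutoff ψ) (hι : Measurable ι)
    (ha : IsVelocity m ι a) (n : ℕ) :
    Integrable (fun g => weight ψ (ι g) * (‖ι g‖ ^ n * (amp a g : ℝ) ^ 2)) m := by
  obtain ⟨C, hC, h⟩ := exists_weight_le hψ
  have hw := measurable_weight hψ hι
  have hm := ha.measurable_amp
  refine ((ha.integrable_pow_mul_amp_sq hι (3 + n)).const_mul C).mono (by fun_prop)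
    (ae_of_all _ fun g => ?_)
  have h0 := weight_nonneg ψ (ι g)
  rw [Real.norm_of_nonneg (by positivity), Real.norm_of_nonneg (by positivity), pow_add]
  calc _ ≤ C * ‖ι g‖ ^ 3 * (‖ι g‖ ^ n * (amp a g : ℝ) ^ 2) := by gcongr; exact h _
    _ = _ := by ring

theorem shellHat_nonneg (q : ℤ) : 0 ≤ shellHat m ι ψ a q :=
  mul_nonneg (pow_nonneg (lam_pos q).le _) (integral_nonneg fun g => by positivity)

theorem ofReal_shellHat (hψ : IsCutoff ψ) (hι : Measurable ι) (ha : IsVelocity m ι a) (q : ℤ) :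
    ENNReal.ofReal (shellHat m ι ψ a q) =
      (lamN q ^ 3 : ℝ≥0) * ∫⁻ g, ENNReal.ofReal (phiq ψ q (ι g) ^ 2 * (amp a g : ℝ) ^ 2) ∂m := by
  have h : (lam q ^ 3 : ℝ) = ((lamN q ^ 3 : ℝ≥0) : ℝ) := by push_cast; rw [coe_lamN]
  rw [shellHat, h, ENNReal.ofReal_mul (NNReal.coe_nonneg _), ENNReal.ofReal_coe_nnreal,
    ofReal_integral_eq_lintegral_ofReal (ha.integrable_phiq hψ hι q)
      (ae_of_all _ fun g => by positivity)]

/-- All terms are nonnegative, so sum and integral are exchanged in `ℝ≥0∞`. The total is finite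
because W grows at most cubically and the velocity has all moments. -/
theorem hasSum_shellHat (hψ : IsCutoff ψ) (hι : Measurable ι) (ha : IsVelocity m ι a) :
    HasSum (shellHat m ι ψ a) (∫ g, weight ψ (ι g) * (amp a g : ℝ) ^ 2 ∂m) := by
  have hm := ha.measurable_amp
  have hw := ha.integrable_weight_amp_sq hψ hι 0
  simp only [pow_zero, one_mul] at hw
  have key : ∑' q, ENNReal.ofReal (shellHat m ι ψ a q) =
      ENNReal.ofReal (∫ g, weight ψ (ι g) * (amp a g : ℝ) ^ 2 ∂m) := by
    rw [ofReal_integral_eq_lintegral_ofReal hw (ae_of_all _ fun g =>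
      mul_nonneg (weight_nonneg _ _) (sq_nonneg _))]
    have e : ∀ q, ENNReal.ofReal (shellHat m ι ψ a q) =
        ∫⁻ g, ENNReal.ofReal (lam q ^ 3 * phiq ψ q (ι g) ^ 2 * (amp a g : ℝ) ^ 2) ∂m := by
      intro q
      rw [ofReal_shellHat hψ hι ha, ← lintegral_const_mul' _ _ ENNReal.coe_ne_top]
      refine lintegral_congr fun g => ?_
      rw [← ENNReal.ofReal_coe_nnreal, ← ENNReal.ofReal_mul (NNReal.coe_nonneg _)]
      push_cast
      rw [coe_lamN, mul_assoc]
    simp_rw [e]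
    rw [← lintegral_tsum fun q => by have := measurable_phiq hψ hι q; fun_prop]
    refine lintegral_congr fun g => ?_
    have hs := weight_summable hψ (ι g)
    rw [← ENNReal.ofReal_tsum_of_nonneg (fun q => by have := lam_pos q; positivity)
      (hs.mul_right _), tsum_mul_right]
    rfl
  have hfin : ∑' q, ENNReal.ofReal (shellHat m ι ψ a q) ≠ ⊤ := by rw [key]; exact ENNReal.ofReal_ne_top
  have h := ENNReal.hasSum_toReal hfin
  rw [← ENNReal.tsum_toReal_eq (fun q => ENNReal.ofReal_ne_top), key,
    ENNReal.toReal_ofReal (integral_nonneg fun g =>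
      mul_nonneg (weight_nonneg _ _) (sq_nonneg _))] at h
  simpa only [ENNReal.toReal_ofReal (shellHat_nonneg _)] using h

theorem summable_shellHat_sq (hψ : IsCutoff ψ) (hι : Measurable ι) (ha : IsVelocity m ι a) :
    Summable fun q => shellHat m ι ψ a q ^ 2 := by
  have hs := (hasSum_shellHat hψ hι ha).summable
  refine Summable.of_nonneg_of_le (fun q => sq_nonneg _) (fun q => ?_)
    (hs.mul_left (∑' q, shellHat m ι ψ a q))
  rw [sq]
  exact mul_le_mul_of_nonneg_right (hs.le_tsum q fun _ _ => shellHat_nonneg _) (shellHat_nonneg _)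

/-- The mass of a sharp annulus is controlled by three neighbouring shells. -/
theorem annulus_mass_le (hψ : IsCutoff ψ) (hι : Measurable ι) (ha : IsVelocity m ι a) (q : ℤ) :
    (lamN q ^ 3 : ℝ≥0) * ∫⁻ x in annulus (fun g => ‖ι g‖₊) q, (amp a x ^ 2 : ℝ≥0) ∂m ≤
      24 * (ENNReal.ofReal (shellHat m ι ψ a (q - 1)) + ENNReal.ofReal (shellHat m ι ψ a q)
        + ENNReal.ofReal (shellHat m ι ψ a (q + 1))) := by
  have hm := ha.measurable_amp
  have hp := fun q => measurable_phiq hψ hι q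
  set S : ℤ → ℝ≥0∞ := fun q => ∫⁻ g, ENNReal.ofReal (phiq ψ q (ι g) ^ 2 * (amp a g : ℝ) ^ 2) ∂m
  have h1 : ∫⁻ x in annulus (fun g => ‖ι g‖₊) q, (amp a x ^ 2 : ℝ≥0) ∂m ≤
      3 * (S (q - 1) + S q + S (q + 1)) := by
    calc _ ≤ ∫⁻ x in annulus (fun g => ‖ι g‖₊) q, 3 *
        (ENNReal.ofReal (phiq ψ (q - 1) (ι x) ^ 2 * (amp a x : ℝ) ^ 2)
        + ENNReal.ofReal (phiq ψ q (ι x) ^ 2 * (amp a x : ℝ) ^ 2)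
        + ENNReal.ofReal (phiq ψ (q + 1) (ι x) ^ 2 * (amp a x : ℝ) ^ 2)) ∂m := by
          refine setLIntegral_mono' (measurableSet_annulus (by fun_prop) q) fun x hx => ?_
          have hx1 : lam q ≤ ‖ι x‖ := by rw [← coe_lamN]; exact_mod_cast hx.1
          have hx2 : ‖ι x‖ < lam (q + 1) := by rw [← coe_lamN]; exact_mod_cast hx.2
          have h := hψ.one_le_sum_phiq_sq hx1 hx2
          rw [← ENNReal.ofReal_add (by positivity) (by positivity),
            ← ENNReal.ofReal_add (by positivity) (by positivity),
            show (3 : ℝ≥0∞) = ENNReal.ofReal 3 by simp, ← ENNReal.ofReal_mul (by norm_num),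
            ← ENNReal.ofReal_coe_nnreal]
          refine ENNReal.ofReal_le_ofReal ?_
          push_cast
          nlinarith [mul_le_mul_of_nonneg_right h (sq_nonneg (amp a x : ℝ))]
      _ ≤ ∫⁻ x, 3 *
        (ENNReal.ofReal (phiq ψ (q - 1) (ι x) ^ 2 * (amp a x : ℝ) ^ 2)
        + ENNReal.ofReal (phiq ψ q (ι x) ^ 2 * (amp a x : ℝ) ^ 2)
        + ENNReal.ofReal (phiq ψ (q + 1) (ι x) ^ 2 * (amp a x : ℝ) ^ 2)) ∂m :=
          setLIntegral_le_lintegral _ _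
      _ = _ := by
          have h1 := hp (q - 1)
          have h2 := hp q
          have h3 := hp (q + 1)
          rw [lintegral_const_mul' _ _ (by simp), lintegral_add_left (by fun_prop),
            lintegral_add_left (by fun_prop)]
  rw [ofReal_shellHat hψ hι ha, ofReal_shellHat hψ hι ha, ofReal_shellHat hψ hι ha]
  -- Replacing λ_q³ by the factor of the lower neighbour costs 8, which is also enough for the other
  -- two. With the 3 of the partition of unity this gives 24.
  have e1 : lamN q = 2 * lamN (q - 1) := by rw [← lamN_add_one, sub_add_cancel]
  have l1 : ((lamN q ^ 3 : ℝ≥0) : ℝ≥0∞) ≤ 8 * (lamN (q - 1) ^ 3 : ℝ≥0) := by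
    rw [e1]; norm_cast; rw [mul_pow]; norm_num
  have l2 : ((lamN q ^ 3 : ℝ≥0) : ℝ≥0∞) ≤ 8 * (lamN q ^ 3 : ℝ≥0) :=
    le_mul_of_one_le_left zero_le (by norm_num)
  have l3 : ((lamN q ^ 3 : ℝ≥0) : ℝ≥0∞) ≤ 8 * (lamN (q + 1) ^ 3 : ℝ≥0) := by
    rw [lamN_add_one]
    norm_cast
    calc lamN q ^ 3 = 1 * lamN q ^ 3 := (one_mul _).symm
      _ ≤ 64 * lamN q ^ 3 := by gcongr; norm_num
      _ = _ := by ring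
  calc _ ≤ ((lamN q ^ 3 : ℝ≥0) : ℝ≥0∞) * (3 * (S (q - 1) + S q + S (q + 1))) := by gcongr
    _ = 3 * ((lamN q ^ 3 : ℝ≥0) * S (q - 1) + (lamN q ^ 3 : ℝ≥0) * S q
        + (lamN q ^ 3 : ℝ≥0) * S (q + 1)) := by ring
    _ ≤ 3 * (8 * (lamN (q - 1) ^ 3 : ℝ≥0) * S (q - 1) + 8 * (lamN q ^ 3 : ℝ≥0) * S q
        + 8 * (lamN (q + 1) ^ 3 : ℝ≥0) * S (q + 1)) := by gcongr
    _ = _ := by ring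

/-- Squaring gives 24² · 9 = 5184, and the three shifted sums over ℤ coincide, giving 15552. -/
theorem tsum_annulus_mass_sq_le (hψ : IsCutoff ψ) (hι : Measurable ι) (ha : IsVelocity m ι a) :
    ∑' q : ℤ, ((lamN q ^ 3 : ℝ≥0) *
      ∫⁻ x in annulus (fun g => ‖ι g‖₊) q, (amp a x ^ 2 : ℝ≥0) ∂m) ^ 2 ≤
      15552 * ENNReal.ofReal (∑' q, shellHat m ι ψ a q ^ 2) := by
  set σ : ℤ → ℝ≥0∞ := fun q => ENNReal.ofReal (shellHat m ι ψ a q) ^ 2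
  have e : ENNReal.ofReal (∑' q, shellHat m ι ψ a q ^ 2) = ∑' q, σ q := by
    rw [ENNReal.ofReal_tsum_of_nonneg (fun q => sq_nonneg _) (summable_shellHat_sq hψ hι ha)]
    exact tsum_congr fun q => ENNReal.ofReal_pow (shellHat_nonneg q) 2
  rw [e]
  calc _ ≤ ∑' q, 5184 * (σ (q - 1) + σ q + σ (q + 1)) := by
        refine ENNReal.tsum_le_tsum fun q => ?_
        refine (pow_le_pow_left' (annulus_mass_le hψ hι ha q) 2).trans ?_
        rw [mul_pow]
        refine (mul_le_mul_right (ENNReal_add_three_sq_le _ _ _) _).trans (le_of_eq ?_)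
        rw [← mul_assoc]
        norm_num
        rfl
    _ = 5184 * (∑' q, σ q + ∑' q, σ q + ∑' q, σ q) := by
        have h1 : ∑' q, σ (q - 1) = ∑' q, σ q := (Equiv.subRight (1 : ℤ)).tsum_eq σ
        have h2 : ∑' q, σ (q + 1) = ∑' q, σ q := (Equiv.addRight (1 : ℤ)).tsum_eq σ
        rw [ENNReal.tsum_mul_left, ENNReal.tsum_add, ENNReal.tsum_add, h1, h2]
    _ = _ := by ring

variable [MeasurableAdd₂ G] [MeasurableNeg G] [SFinite m] [m.IsAddLeftInvariant] [m.IsNegInvariant]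

/-- The energy flux is absorbed by the dissipation, up to the sum of the squares of the shells. -/
theorem exists_abs_trilinear_le (hψ : IsCutoff ψ) (hG : IsFreq m ι) :
    ∃ C : ℝ, 0 < C ∧ ∀ ν : ℝ, 0 < ν → ∀ a : Fin 3 → G → ℂ, IsVelocity m ι a →
      |∫ g, weight ψ (ι g) * (∑ i, advect m ι a (a i) g * conj (a i g)).re ∂m| ≤
        ν * ∫ g, weight ψ (ι g) * (‖ι g‖ ^ 2 * (amp a g : ℝ) ^ 2) ∂m
        + C * ν⁻¹ * ∑' q, shellHat m ι ψ a q ^ 2 := by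
  obtain ⟨C₀, hC₀, hW⟩ := exists_abs_weight_sub_le hψ
  obtain ⟨K, hK⟩ := hG.vol
  have hι := hG.meas
  -- K may vanish; K + 1 keeps the constant positive.
  refine ⟨C₀ * 6 * 2048 * (K + 1) * (1152 * C₀) * 15552, by positivity, fun ν hν a ha => ?_⟩
  lift C₀ to ℝ≥0 using hC₀.le
  lift ν to ℝ≥0 using hν.le
  have hC0 : C₀ ≠ 0 := by rintro rfl; simp at hC₀
  have hν0 : ν ≠ 0 := by rintro rfl; simp at hν
  have hm := ha.measurable_amp
  have h1 := ofReal_abs_trilinear_le hψ hG hW ha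
  -- Young's parameter is chosen so that C₀ · 6 · δ · 192 = ν: symmetrized kernel, six interactions,
  -- and comparison of |ξ|³ with W. The absorbed part is then exactly the dissipation.
  have hδ : ν / (1152 * C₀) ≠ 0 := by positivity
  have h2 := lintegral_lintegral_lowHigh_le (μ := m) (n := fun g => ‖ι g‖₊) (by fun_prop) hm hK hδ
  have hint := ha.integrable_weight_amp_sq hψ hι 2
  have hD0 : 0 ≤ ∫ g, weight ψ (ι g) * (‖ι g‖ ^ 2 * (amp a g : ℝ) ^ 2) ∂m :=
    integral_nonneg fun g => mul_nonneg (weight_nonneg _ _) (by positivity)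
  have hS0 : 0 ≤ ∑' q, shellHat m ι ψ a q ^ 2 := tsum_nonneg fun q => sq_nonneg _
  have h3 : ∫⁻ y, (‖ι y‖₊ ^ 5 * amp a y ^ 2 : ℝ≥0) ∂m ≤
      192 * ENNReal.ofReal (∫ g, weight ψ (ι g) * (‖ι g‖ ^ 2 * (amp a g : ℝ) ^ 2) ∂m) := by
    rw [ofReal_integral_eq_lintegral_ofReal hint (ae_of_all _ fun g =>
      mul_nonneg (weight_nonneg _ _) (by positivity)), ← lintegral_const_mul' _ _ (by simp)]
    refine lintegral_mono fun g => ?_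
    rw [← ENNReal.ofReal_coe_nnreal, show (192 : ℝ≥0∞) = ENNReal.ofReal 192 by simp,
      ← ENNReal.ofReal_mul (by norm_num)]
    refine ENNReal.ofReal_le_ofReal ?_
    push_cast
    calc ‖ι g‖ ^ 5 * (amp a g : ℝ) ^ 2 = ‖ι g‖ ^ 3 * (‖ι g‖ ^ 2 * (amp a g : ℝ) ^ 2) := by ring
      _ ≤ 192 * weight ψ (ι g) * (‖ι g‖ ^ 2 * (amp a g : ℝ) ^ 2) := by
          gcongr; exact le_weight hψ _
      _ = _ := by ring
  have h4 := tsum_annulus_mass_sq_le hψ hι ha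
  set D := ∫ g, weight ψ (ι g) * (‖ι g‖ ^ 2 * (amp a g : ℝ) ^ 2) ∂m
  set S := ∑' q, shellHat m ι ψ a q ^ 2
  have h5 := h1.trans (mul_le_mul_right (mul_le_mul_right (h2.trans
    (add_le_add (mul_le_mul_right h3 _) (mul_le_mul_right h4 _))) _) _)
  obtain ⟨D', hD'⟩ : ∃ D' : ℝ≥0, (D' : ℝ) = D := ⟨⟨D, hD0⟩, rfl⟩
  obtain ⟨S', hS'⟩ : ∃ S' : ℝ≥0, (S' : ℝ) = S := ⟨⟨S, hS0⟩, rfl⟩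
  rw [← hD', ← hS', ENNReal.ofReal_coe_nnreal, ENNReal.ofReal_coe_nnreal] at h5
  have h6 : (C₀ : ℝ≥0∞) * (6 * (((ν / (1152 * C₀) : ℝ≥0) : ℝ≥0∞) * (192 * D')
      + ((2048 * K * (ν / (1152 * C₀))⁻¹ : ℝ≥0) : ℝ≥0∞) * (15552 * S'))) =
      ((C₀ * (6 * ((ν / (1152 * C₀)) * (192 * D')
      + (2048 * K * (ν / (1152 * C₀))⁻¹) * (15552 * S'))) : ℝ≥0) : ℝ≥0∞) := by
    push_cast
    rfl
  rw [h6, ENNReal.ofReal_le_coe] at h5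
  refine h5.trans ?_
  rw [← hD', ← hS']
  push_cast
  have hK1 : (K : ℝ) ≤ K + 1 := by linarith
  have hC0' : (C₀ : ℝ) ≠ 0 := by exact_mod_cast hC0
  have hν0' : (ν : ℝ) ≠ 0 := by exact_mod_cast hν0
  calc _ = (ν : ℝ) * D' + C₀ * 6 * 2048 * K * (1152 * C₀) * 15552 * (ν : ℝ)⁻¹ * S' := by
        field_simp; ring
    _ ≤ _ := by gcongr

end ShellHat

end

section

open scoped ENNReal NNReal InnerProductSpace

/-! ### Weak differentiability in a Hilbert space -/

section Hilbert

variable {H : Type*} [NormedAddCommGroup H] [InnerProductSpace ℝ H]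

/-- The condition on y is closed, so it passes from the dense set to y = x. -/
theorem norm_le_of_abs_inner_le {S : Set H} (hS : Dense S) {x : H} {K : ℝ} (hK : 0 ≤ K)
    (h : ∀ y ∈ S, |⟪x, y⟫_ℝ| ≤ K * ‖y‖) : ‖x‖ ≤ K := by
  have hc : IsClosed {y : H | |⟪x, y⟫_ℝ| ≤ K * ‖y‖} :=
    isClosed_le (by fun_prop) (by fun_prop)
  have h1 : |⟪x, x⟫_ℝ| ≤ K * ‖x‖ := hc.closure_subset_iff.2 h (hS x)
  rcases (norm_nonneg x).eq_or_lt with h0 | h0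
  · rwa [← h0]
  · rw [real_inner_self_eq_norm_sq, abs_of_nonneg (sq_nonneg _), sq] at h1
    exact le_of_mul_le_mul_right h1 h0

variable {Z D : ℝ → H} {S : Set H} {α β M : ℝ}

/-- A curve that is weakly differentiable on a dense set of test vectors, with bounded derivative,
is Lipschitz. -/
theorem norm_sub_le_of_weak_deriv (hS : Dense S) (hM : 0 ≤ M) (hD : ∀ t ∈ Icc α β, ‖D t‖ ≤ M)
    (h : ∀ y ∈ S, ∀ t ∈ Icc α β, HasDerivAt (fun t => ⟪Z t, y⟫_ℝ) ⟪D t, y⟫_ℝ t) {s t : ℝ}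
    (hs : s ∈ Icc α β) (ht : t ∈ Icc α β) : ‖Z t - Z s‖ ≤ M * |t - s| := by
  refine norm_le_of_abs_inner_le hS (by positivity) fun y hy => ?_
  have h1 := (convex_Icc α β).norm_image_sub_le_of_norm_hasDerivWithin_le (C := M * ‖y‖)
    (fun t ht => (h y hy t ht).hasDerivWithinAt) (fun t ht => ?_) hs ht
  · rw [inner_sub_left, ← Real.norm_eq_abs]
    refine h1.trans (le_of_eq ?_)
    rw [Real.norm_eq_abs]; ring
  · refine (norm_inner_le_norm _ _).trans ?_
    gcongr
    exact hD t ht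

/-- Weak differentiability extends from a dense set of test vectors to all of them. -/
theorem hasDerivAt_inner_of_dense (hS : Dense S) (hM : 0 ≤ M) (hD : ∀ t ∈ Icc α β, ‖D t‖ ≤ M)
    (h : ∀ y ∈ S, ∀ t ∈ Icc α β, HasDerivAt (fun t => ⟪Z t, y⟫_ℝ) ⟪D t, y⟫_ℝ t) {s : ℝ}
    (hs : s ∈ Ioo α β) (y : H) : HasDerivAt (fun t => ⟪Z t, y⟫_ℝ) ⟪D s, y⟫_ℝ s := by
  have hs' := Ioo_subset_Icc_self hs
  rw [hasDerivAt_iff_isLittleO, Asymptotics.isLittleO_iff]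
  intro ε hε
  -- The error y - y' is paired once with the increment of Z and once with D. Each costs at most
  -- (ε/4)|t - s|, which leaves ε/2 for the derivative along y'.
  obtain ⟨y', hy', hyy⟩ := Metric.mem_closure_iff.1 (hS y) (ε / (4 * (M + 1))) (by positivity)
  rw [dist_eq_norm] at hyy
  have h1 := (hasDerivAt_iff_isLittleO.1 (h y' hy' s hs'))
  rw [Asymptotics.isLittleO_iff] at h1
  filter_upwards [h1 (half_pos hε), Icc_mem_nhds hs.1 hs.2] with t ht1 ht2
  have h2 := norm_sub_le_of_weak_deriv hS hM hD h hs' ht2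
  have e : ⟪Z t, y⟫_ℝ - ⟪Z s, y⟫_ℝ - (t - s) • ⟪D s, y⟫_ℝ =
      (⟪Z t, y'⟫_ℝ - ⟪Z s, y'⟫_ℝ - (t - s) • ⟪D s, y'⟫_ℝ) + (⟪Z t - Z s, y - y'⟫_ℝ
        - (t - s) * ⟪D s, y - y'⟫_ℝ) := by
    simp only [inner_sub_left, inner_sub_right, smul_eq_mul]; ring
  rw [e]
  have h3 : ‖⟪Z t - Z s, y - y'⟫_ℝ‖ ≤ M * |t - s| * ‖y - y'‖ :=
    (norm_inner_le_norm _ _).trans (by gcongr)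
  have h4 : ‖(t - s) * ⟪D s, y - y'⟫_ℝ‖ ≤ |t - s| * (M * ‖y - y'‖) := by
    rw [norm_mul, Real.norm_eq_abs]
    gcongr
    exact (norm_inner_le_norm _ _).trans (by gcongr; exact hD s hs')
  have h5 : M * ‖y - y'‖ ≤ ε / 4 := by
    calc M * ‖y - y'‖ ≤ (M + 1) * (ε / (4 * (M + 1))) := by gcongr; linarith
      _ = ε / 4 := by field_simp
  calc _ ≤ ε / 2 * ‖t - s‖ + (M * |t - s| * ‖y - y'‖ + |t - s| * (M * ‖y - y'‖)) :=
        (norm_add_le _ _).trans (add_le_add ht1 ((norm_sub_le _ _).trans (add_le_add h3 h4)))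
    _ = ε / 2 * ‖t - s‖ + 2 * (M * ‖y - y'‖) * |t - s| := by ring
    _ ≤ ε / 2 * ‖t - s‖ + 2 * (ε / 4) * |t - s| := by gcongr
    _ = _ := by rw [Real.norm_eq_abs]; ring

/-- Derivative of a symmetric pairing of a Lipschitz, weakly differentiable curve with a curve that
is only known to be continuous. -/
theorem hasDerivAt_inner_of_symm {Y : ℝ → H} {s d : ℝ}
    (hsymm : ∀ᶠ t in 𝓝 s, ⟪Z t, Y s⟫_ℝ = ⟪Z s, Y t⟫_ℝ)
    (hZ : ∀ᶠ t in 𝓝 s, ‖Z t - Z s‖ ≤ M * |t - s|)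
    (hd : HasDerivAt (fun t => ⟪Z t, Y s⟫_ℝ) d s) (hY : Tendsto Y (𝓝 s) (𝓝 (Y s))) :
    HasDerivAt (fun t => ⟪Z t, Y t⟫_ℝ) (2 * d) s := by
  rw [hasDerivAt_iff_isLittleO] at hd ⊢
  have hY0 : Tendsto (fun t => ‖Y t - Y s‖) (𝓝 s) (𝓝 0) := tendsto_iff_norm_sub_tendsto_zero.1 hY
  -- By symmetry the increment of ⟪Z t, Y t⟫ is 2⟪Z t - Z s, Y s⟫ + ⟪Z t - Z s, Y t - Y s⟫. The last
  -- term is O(|t - s|) times o(1), so no rate for Y is needed.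
  have h1 : (fun t => ⟪Z t - Z s, Y t - Y s⟫_ℝ) =o[𝓝 s] fun t => t - s := by
    have hb : (fun t => ⟪Z t - Z s, Y t - Y s⟫_ℝ) =O[𝓝 s] fun t => ‖Y t - Y s‖ * (t - s) := by
      refine Asymptotics.IsBigO.of_bound M ?_
      filter_upwards [hZ] with t ht
      refine (norm_inner_le_norm _ _).trans ?_
      rw [norm_mul, norm_norm, Real.norm_eq_abs]
      calc _ ≤ M * |t - s| * ‖Y t - Y s‖ := by gcongr
        _ = _ := by ring
    refine hb.trans_isLittleO ?_
    have := (Asymptotics.isLittleO_one_iff ℝ).2 hY0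
    simpa using this.mul_isBigO (Asymptotics.isBigO_refl (fun t => t - s) (𝓝 s))
  refine ((hd.const_mul_left 2).add h1).congr' ?_ EventuallyEq.rfl
  filter_upwards [hsymm] with t ht
  simp only [inner_sub_left, inner_sub_right, smul_eq_mul, ht]
  ring

end Hilbert

/-! ### Testing against compactly supported functions -/

section Testing

variable {μ : Measure E3} [IsLocallyFiniteMeasure μ]

/-- The classes of continuous compactly supported functions. -/
def testVectors (μ : Measure E3) : Set (Lp ℝ 2 μ) :=
  {y | ∃ (h : E3 → ℝ) (hm : MemLp h 2 μ), Continuous h ∧ HasCompactSupport h ∧ y = hm.toLp h}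

theorem dense_testVectors : Dense (testVectors μ) := by
  intro f
  rw [Metric.mem_closure_iff]
  intro ε hε
  obtain ⟨g, hg1, hg2, hg3, hg4⟩ := (Lp.memLp f).exists_hasCompactSupport_eLpNorm_sub_le
    (by simp) (ε := ENNReal.ofReal (ε / 2)) (by simpa using hε)
  refine ⟨hg4.toLp g, ⟨g, hg4, hg3, hg1, rfl⟩, ?_⟩
  rw [dist_eq_norm, Lp.norm_def]
  have : eLpNorm (⇑(f - hg4.toLp g)) 2 μ = eLpNorm (⇑f - g) 2 μ := by
    refine eLpNorm_congr_ae ?_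
    filter_upwards [Lp.coeFn_sub f (hg4.toLp g), hg4.coeFn_toLp] with x h1 h2
    rw [h1, Pi.sub_apply, Pi.sub_apply, h2]
  rw [this]
  refine lt_of_le_of_lt (ENNReal.toReal_mono ENNReal.ofReal_ne_top hg2) ?_
  rw [ENNReal.toReal_ofReal (by positivity)]
  linarith

theorem inner_toLp {f h : E3 → ℝ} (hf : MemLp f 2 μ) (hh : MemLp h 2 μ) :
    ⟪hf.toLp f, hh.toLp h⟫_ℝ = ∫ x, f x * h x ∂μ := by
  rw [L2.inner_def]
  refine integral_congr_ae ?_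
  filter_upwards [hf.coeFn_toLp, hh.coeFn_toLp] with x h1 h2
  rw [h1, h2]
  simp [mul_comm]

/-- Differentiation under the integral sign against a compactly supported function. -/
theorem hasDerivAt_integral_mul_of_hasCompactSupport {T : ℝ} {z zdot : ℝ → E3 → ℝ}
    (hz : ∀ t ∈ Ioo 0 T, ∀ x, HasDerivAt (fun t => z t x) (zdot t x) t)
    (hc : ∀ t ∈ Ioo 0 T, Continuous (z t))
    (hdot : ContinuousOn (fun p : ℝ × E3 => zdot p.1 p.2) (Ioo 0 T ×ˢ univ)) {h : E3 → ℝ}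
    (hh : Continuous h) (hs : HasCompactSupport h) {s : ℝ} (hsT : s ∈ Ioo 0 T) :
    HasDerivAt (fun t => ∫ x, z t x * h x ∂μ) (∫ x, zdot s x * h x ∂μ) s := by
  obtain ⟨δ, hδ, hsub⟩ := Metric.isOpen_iff.1 isOpen_Ioo s hsT
  have hK : IsCompact (Metric.closedBall s (δ / 2) ×ˢ tsupport h) :=
    (isCompact_closedBall s _).prod hs.isCompact
  have hball : Metric.closedBall s (δ / 2) ⊆ Ioo 0 T :=
    (Metric.closedBall_subset_ball (half_lt_self hδ)).trans hsub
  obtain ⟨C, hC⟩ := hK.exists_bound_of_continuousOn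
    (hdot.mono (prod_mono hball (subset_univ _)))
  have hint : ∀ f : E3 → ℝ, Continuous f → Integrable (fun x => f x * h x) μ := fun f hf =>
    (hf.mul hh).integrable_of_hasCompactSupport hs.mul_left
  have hnhds : Metric.closedBall s (δ / 2) ∈ 𝓝 s := Metric.closedBall_mem_nhds s (half_pos hδ)
  have hdots : Continuous (zdot s) := by
    have : ContinuousOn (fun x => zdot s x) univ :=
      hdot.comp (f := fun x => (s, x)) (by fun_prop) fun x _ => ⟨hsT, mem_univ _⟩
    exact continuousOn_univ.1 this
  refine (hasDerivAt_integral_of_dominated_loc_of_deriv_le (𝕜 := ℝ) hnhds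
    (F := fun t x => z t x * h x) (F' := fun t x => zdot t x * h x) (bound := fun x => C * ‖h x‖)
    (mem_of_superset hnhds fun t ht => (hint _ (hc t (hball ht))).aestronglyMeasurable)
    (hint _ (hc s hsT)) (hint _ hdots).aestronglyMeasurable (ae_of_all _ fun x t ht => ?_)
    ((hh.integrable_of_hasCompactSupport hs).norm.const_mul C)
    (ae_of_all _ fun x t ht => (hz t (hball ht) x).mul_const _)).2
  rw [norm_mul]
  by_cases hx : x ∈ tsupport h
  · gcongr
    exact hC (t, x) ⟨ht, hx⟩
  · rw [image_eq_zero_of_notMem_tsupport hx]; simp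

end Testing

end

section

open scoped ENNReal NNReal ComplexConjugate

/-! ### Fourier models of the domains -/

section Model

variable {G τ : Type*} [AddCommGroup G] [MeasurableSpace G] {m : Measure G} {ι : G →+ E3}

/-- The partial derivative `∂_j f`. -/
def pd (j : Fin 3) (f : E3 → ℝ) (x : E3) : ℝ := fderiv ℝ f x (EuclideanSpace.single j 1)

/-- What is used of Fourier analysis on a domain: Plancherel for synthesis, and a transform on
smooth square integrable functions that is bounded, diagonalizes derivatives and is inverted by
synthesis. -/
structure IsFourierModel (Ω : SpatialDomain) (m : Measure G) (ι : G →+ E3) (c : ℝ) : Prop where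
  freq : IsFreq m ι
  pos : 0 < c
  plancherel : ∀ a : G → ℂ, Measurable a → Integrable a m → MemLp a 2 m →
    MemLp (synth m ι a) 2 Ω.vol ∧ ∫ x, ‖synth m ι a x‖ ^ 2 ∂Ω.vol = c * ∫ g, ‖a g‖ ^ 2 ∂m
  transform : ∃ hat : (E3 → ℝ) → G → ℂ, ∃ C : ℝ≥0,
    ∀ f : E3 → ℝ, ContDiff ℝ ∞ f → Ω.IsFunctionOn f → MemLp f 2 Ω.vol →
      AEStronglyMeasurable (hat f) m ∧
      ∫⁻ g, ‖hat f g‖ₑ ^ 2 ∂m ≤ C * ∫⁻ x, ‖f x‖ₑ ^ 2 ∂Ω.vol ∧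
      (∀ j, MemLp (pd j f) 2 Ω.vol → hat (pd j f) =ᵐ[m] der ι j (hat f)) ∧
      (Integrable (hat f) m → ∀ x, (f x : ℂ) = synth m ι (hat f) x)
  lp : ∀ ψ, IsCutoff ψ → ∀ (q : ℤ) (f : E3 → ℝ) (a : G → ℂ), Measurable a → Integrable a m →
    (∀ x, (f x : ℂ) = synth m ι a x) →
    ∀ x, lpScalar Ω ψ q f x = synth m ι (fun g => (phiq ψ q (ι g) : ℂ) * a g) x

theorem contDiff_pd {f : E3 → ℝ} (hf : ContDiff ℝ ∞ f) (j : Fin 3) : ContDiff ℝ ∞ (pd j f) := by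
  unfold pd
  exact (hf.fderiv_right (m := ∞) (by simp)).clm_apply contDiff_const

theorem isFunctionOn_pd {Ω : SpatialDomain} {f : E3 → ℝ} (hf : Ω.IsFunctionOn f) (j : Fin 3) :
    Ω.IsFunctionOn (pd j f) := by
  cases Ω with
  | space => trivial
  | torus =>
    intro i x
    have e : (fun y => f (y + EuclideanSpace.single i (2 * Real.pi))) = f := funext fun y => hf i y
    unfold pd
    rw [← fderiv_comp_add_right, e]

theorem contDiff_iterate_pd {f : E3 → ℝ} (hf : ContDiff ℝ ∞ f) (j : Fin 3) (n : ℕ) :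
    ContDiff ℝ ∞ ((pd j)^[n] f) := by
  induction n with
  | zero => exact hf
  | succ n ih => rw [Function.iterate_succ_apply']; exact contDiff_pd ih j

theorem isFunctionOn_iterate_pd {Ω : SpatialDomain} {f : E3 → ℝ} (hf : Ω.IsFunctionOn f)
    (j : Fin 3) (n : ℕ) : Ω.IsFunctionOn ((pd j)^[n] f) := by
  induction n with
  | zero => exact hf
  | succ n ih => rw [Function.iterate_succ_apply']; exact isFunctionOn_pd ih j

theorem iterate_pd_eq {f : E3 → ℝ} (hf : ContDiff ℝ ∞ f) (j : Fin 3) (n : ℕ) (x : E3) :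
    (pd j)^[n] f x = iteratedFDeriv ℝ n f x fun _ => EuclideanSpace.single j 1 := by
  induction n generalizing x with
  | zero => simp
  | succ n ih =>
    rw [Function.iterate_succ_apply', iteratedFDeriv_succ_apply_left]
    have e : (pd j)^[n] f = fun x => iteratedFDeriv ℝ n f x fun _ => EuclideanSpace.single j 1 :=
      funext ih
    rw [e, pd, fderiv_continuousMultilinear_apply_const]
    · rfl
    · exact (hf.differentiable_iteratedFDeriv (mod_cast ENat.natCast_lt_top n)).differentiableAt

theorem norm_iterate_pd_le {v : E3 → E3} (hv : ContDiff ℝ ∞ v) (i j : Fin 3) (n : ℕ) (x : E3) :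
    ‖(pd j)^[n] (fun y => v y i) x‖ ≤ ‖iteratedFDeriv ℝ n v x‖ := by
  have hf : ContDiff ℝ ∞ fun y => v y i := by fun_prop
  rw [iterate_pd_eq hf]
  refine (ContinuousMultilinearMap.le_opNorm _ _).trans ?_
  simp only [PiLp.norm_single, norm_one, Finset.prod_const_one, mul_one]
  have h := (EuclideanSpace.proj (𝕜 := ℝ) i : E3 →L[ℝ] ℝ).norm_iteratedFDeriv_comp_left
    (f := v) (x := x) (N := ∞) hv.contDiffAt (n := n) (mod_cast le_top)
  refine h.trans (mul_le_of_le_one_left (norm_nonneg _) ?_)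
  exact ContinuousLinearMap.opNorm_le_bound _ zero_le_one fun y => by
    rw [one_mul]; exact PiLp.norm_apply_le y i

theorem pd_eq_synth (hG : IsFreq m ι) {f : E3 → ℝ} {a : G → ℂ} (ha : Decay m ι fun _ : Unit => a)
    (hf : Differentiable ℝ f) (h : ∀ x, (f x : ℂ) = synth m ι a x) (j : Fin 3) (x : E3) :
    (pd j f x : ℂ) = synth m ι (der ι j a) x := by
  have h1 := hasDerivAt_synth hG.meas (ha.meas ()) (ha.integrable hG ())
    (ha.integrable_weight hG 1 ()) j x 0
  have h2 : HasDerivAt (fun s : ℝ => f (x + s • EuclideanSpace.single j 1)) (pd j f x) 0 := by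
    have h3 : HasDerivAt (fun s : ℝ => x + s • (EuclideanSpace.single j 1 : E3))
        (EuclideanSpace.single j 1) 0 := by
      simpa using ((hasDerivAt_id (0 : ℝ)).smul_const (EuclideanSpace.single j 1 : E3)).const_add x
    have h4 := (hf (x + (0 : ℝ) • EuclideanSpace.single j 1)).hasFDerivAt.comp_hasDerivAt (0 : ℝ) h3
    rw [zero_smul, add_zero] at h4
    exact h4
  have h5 := h2.ofReal_comp
  simp only [h] at h5
  have := h5.unique h1
  simpa using this

namespace IsFourierModel

variable {Ω : SpatialDomain} {c : ℝ}

/-- Plancherel makes the synthesis injective up to null sets; this is how reality and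
incompressibility pass from a field to its transform. -/
theorem eq_zero_of_synth_eq_zero (hM : IsFourierModel Ω m ι c) {a : G → ℂ}
    (ha : Decay m ι fun _ : Unit => a) (h : ∀ x, synth m ι a x = 0) : a =ᵐ[m] 0 := by
  have h2 := ha.memLp_two ()
  have h1 := (hM.plancherel a (ha.meas ()) (ha.integrable hM.freq ()) h2).2
  simp only [h, norm_zero, ne_eq, OfNat.ofNat_ne_zero, not_false_eq_true, zero_pow,
    integral_zero] at h1
  have h3 : ∫ g, ‖a g‖ ^ 2 ∂m = 0 := by
    rcases mul_eq_zero.1 h1.symm with h | h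
    · exact absurd h hM.pos.ne'
    · exact h
  rw [integral_eq_zero_iff_of_nonneg (fun g => sq_nonneg _)
    ((memLp_two_iff_integrable_sq_norm h2.1).1 h2)] at h3
  filter_upwards [h3] with g hg
  simpa using hg

end IsFourierModel

/-- The largest coordinate carries at least a third of |v|². Hence moments of a transform need only
the pure derivatives ∂_jⁿ, not the mixed ones. -/
theorem norm_pow_two_mul_le (v : E3) (n : ℕ) : ‖v‖ ^ (2 * n) ≤ 3 ^ n * ∑ j, |v j| ^ (2 * n) := by
  obtain ⟨j, -, hj⟩ := Finset.exists_max_image Finset.univ (fun j => |v j|) ⟨0, Finset.mem_univ _⟩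
  have h1 : ‖v‖ ^ 2 ≤ 3 * |v j| ^ 2 := by
    rw [EuclideanSpace.norm_sq_eq]
    calc ∑ i, ‖v i‖ ^ 2 ≤ ∑ _i : Fin 3, |v j| ^ 2 := by
          gcongr with i
          exact hj i (Finset.mem_univ _)
      _ = _ := by simp
  calc ‖v‖ ^ (2 * n) = (‖v‖ ^ 2) ^ n := pow_mul _ _ _
    _ ≤ (3 * |v j| ^ 2) ^ n := by gcongr
    _ = 3 ^ n * |v j| ^ (2 * n) := by rw [mul_pow, ← pow_mul]
    _ ≤ _ := by
        gcongr
        exact Finset.single_le_sum (f := fun j => |v j| ^ (2 * n)) (fun i _ => by positivity)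
          (Finset.mem_univ j)

theorem decay_congr {a b : τ → G → ℂ} (ha : Decay m ι a) (hb : ∀ t, Measurable (b t))
    (h : ∀ t, a t =ᵐ[m] b t) : Decay m ι b := by
  refine ⟨hb, fun n => (ha.bound n).imp fun M hM t => le_trans (le_of_eq ?_) (hM t)⟩
  refine lintegral_congr_ae ?_
  filter_upwards [h t] with g hg
  rw [hg]

/-- A measurable family with bounds on the even coordinate moments decays. -/
theorem decay_of_coord {b : τ → G → ℂ} (hι : Measurable ι) (hb : ∀ t, Measurable (b t))
    (h : ∀ (n : ℕ) (j : Fin 3), ∃ M : ℝ≥0, ∀ t, ∫⁻ g, ‖ι g j‖ₑ ^ (2 * n) * ‖b t g‖ₑ ^ 2 ∂m ≤ M) :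
    Decay m ι b := by
  have hj : ∀ j, Measurable fun g => ι g j := fun j =>
    (EuclideanSpace.proj (𝕜 := ℝ) j).measurable.comp hι
  have heven : ∀ n : ℕ, ∃ M : ℝ≥0, ∀ t, ∫⁻ g, ‖ι g‖ₑ ^ (2 * n) * ‖b t g‖ₑ ^ 2 ∂m ≤ M := by
    intro n
    choose M hM using h n
    refine ⟨3 ^ n * ∑ j, M j, fun t => ?_⟩
    have hbt := hb t
    calc _ ≤ ∫⁻ g, 3 ^ n * ∑ j, ‖ι g j‖ₑ ^ (2 * n) * ‖b t g‖ₑ ^ 2 ∂m := by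
          refine lintegral_mono fun g => ?_
          have h1 := norm_pow_two_mul_le (ι g) n
          have h2 : ‖ι g‖ₑ ^ (2 * n) ≤ 3 ^ n * ∑ j, ‖ι g j‖ₑ ^ (2 * n) := by
            simp only [enorm_eq_nnnorm]
            norm_cast
            rw [← NNReal.coe_le_coe]
            push_cast
            exact h1
          rw [← Finset.sum_mul, ← mul_assoc]
          gcongr
      _ ≤ _ := by
          rw [lintegral_const_mul' _ _ (by finiteness), lintegral_finsetSum _ fun j _ => by
            have := hj j; fun_prop]
          push_cast
          gcongr with j
          exact hM j t
  refine ⟨hb, fun n => ?_⟩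
  -- The n-th moment, of either parity, is bounded by the moments of orders 0 and 2n.
  obtain ⟨M0, h0⟩ := heven 0
  obtain ⟨M1, h1⟩ := heven n
  refine ⟨M0 + M1, fun t => ?_⟩
  have hbt := hb t
  calc _ ≤ ∫⁻ g, (‖ι g‖ₑ ^ (2 * 0) * ‖b t g‖ₑ ^ 2 + ‖ι g‖ₑ ^ (2 * n) * ‖b t g‖ₑ ^ 2) ∂m := by
        refine lintegral_mono fun g => ?_
        rw [← add_mul]
        gcongr
        have := ENNReal_le_one_add_sq (‖ι g‖ₑ ^ n)
        rwa [← pow_mul, mul_comm n] at this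
    _ ≤ _ := by
        rw [lintegral_add_left (by fun_prop)]
        push_cast
        exact add_le_add (h0 t) (h1 t)

theorem lintegral_sq_le_of_eLpNorm_le {μ : Measure E3} {F : Type*} [NormedAddCommGroup F]
    {f : E3 → F} {M : ℝ≥0∞} (h : eLpNorm f 2 μ ≤ M) : ∫⁻ x, ‖f x‖ₑ ^ 2 ∂μ ≤ M ^ 2 := by
  have e : ∫⁻ x, ‖f x‖ₑ ^ 2 ∂μ = eLpNorm f 2 μ ^ 2 := by
    rw [eLpNorm_eq_lintegral_rpow_enorm_toReal (by simp) (by simp), ← ENNReal.rpow_natCast,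
      ← ENNReal.rpow_mul]
    norm_num
  rw [e]
  gcongr

/-- The transforms of the components of a bounded family of smooth fields. -/
theorem IsFourierModel.exists_decay {Ω : SpatialDomain} {c : ℝ} (hM : IsFourierModel Ω m ι c)
    {v : τ → E3 → E3} (hv : ∀ t, ContDiff ℝ ∞ (v t)) (hΩ : ∀ t, Ω.IsFunctionOn (v t))
    (hb : ∀ n : ℕ, ∃ M : ℝ, ∀ t, eLpNorm (iteratedFDeriv ℝ n (v t)) 2 Ω.vol ≤ ENNReal.ofReal M)
    (i : Fin 3) :
    ∃ a : τ → G → ℂ, Decay m ι a ∧ ∀ t x, (v t x i : ℂ) = synth m ι (a t) x := by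
  obtain ⟨hat, C, hhat⟩ := hM.transform
  have hι := hM.freq.meas
  set f : τ → E3 → ℝ := fun t x => v t x i
  have hf : ∀ t, ContDiff ℝ ∞ (f t) := fun t => by have := hv t; fun_prop
  have hfΩ : ∀ t, Ω.IsFunctionOn (f t) := by
    intro t
    have := hΩ t
    cases Ω with
    | space => trivial
    | torus => intro k x; exact congrArg (fun w : E3 => w i) (this k x)
  have hsm : ∀ t j n, ContDiff ℝ ∞ ((pd j)^[n] (f t)) := fun t j n => contDiff_iterate_pd (hf t) j n
  have hfn : ∀ t j n, Ω.IsFunctionOn ((pd j)^[n] (f t)) := fun t j n =>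
    isFunctionOn_iterate_pd (hfΩ t) j n
  have hle : ∀ n t j, eLpNorm ((pd j)^[n] (f t)) 2 Ω.vol ≤
      eLpNorm (iteratedFDeriv ℝ n (v t)) 2 Ω.vol := fun n t j =>
    eLpNorm_mono fun x => norm_iterate_pd_le (hv t) i j n x
  have hLp : ∀ t j n, MemLp ((pd j)^[n] (f t)) 2 Ω.vol := fun t j n => by
    obtain ⟨M, hM⟩ := hb n
    exact ⟨(hsm t j n).continuous.aestronglyMeasurable,
      ((hle n t j).trans (hM t)).trans_lt ENNReal.ofReal_lt_top⟩
  have hiter : ∀ t j n, hat ((pd j)^[n] (f t)) =ᵐ[m]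
      fun g => (Complex.I * ((ι g j : ℝ) : ℂ)) ^ n * hat (f t) g := by
    intro t j n
    induction n with
    | zero => simp
    | succ n ih =>
      have h1 := (hhat _ (hsm t j n) (hfn t j n) (hLp t j n)).2.2.1 j (by
        have := hLp t j (n + 1)
        rwa [Function.iterate_succ_apply'] at this)
      rw [Function.iterate_succ_apply']
      filter_upwards [h1, ih] with g hg1 hg2
      rw [hg1, der, hg2, pow_succ]
      ring
  -- The transform is measurable only up to null sets, whereas `Decay` asks for measurability; a
  -- representative is fixed for each t.
  have hm0 : ∀ t, AEStronglyMeasurable (hat (f t)) m := fun t =>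
    (hhat _ (hf t) (hfΩ t) (hLp t 0 0)).1
  set a : τ → G → ℂ := fun t => (hm0 t).mk _
  have ham : ∀ t, Measurable (a t) := fun t => (hm0 t).stronglyMeasurable_mk.measurable
  have hae : ∀ t, hat (f t) =ᵐ[m] a t := fun t => (hm0 t).ae_eq_mk
  have hdec : Decay m ι a := by
    refine decay_of_coord hι ham fun n j => ?_
    obtain ⟨M, hM⟩ := hb n
    refine ⟨C * M.toNNReal ^ 2, fun t => ?_⟩
    calc _ = ∫⁻ g, ‖hat ((pd j)^[n] (f t)) g‖ₑ ^ 2 ∂m := by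
          refine lintegral_congr_ae ?_
          filter_upwards [hiter t j n, hae t] with g h1 h2
          have hI : ‖Complex.I‖ₑ = 1 := by simp [enorm_eq_nnnorm]
          have hr : ‖((ι g j : ℝ) : ℂ)‖ₑ = ‖ι g j‖ₑ := by simp [enorm_eq_nnnorm]
          rw [h1, ← h2, enorm_mul, enorm_pow, enorm_mul, hI, one_mul, hr]
          ring
      _ ≤ C * ∫⁻ x, ‖(pd j)^[n] (f t) x‖ₑ ^ 2 ∂Ω.vol :=
          (hhat _ (hsm t j n) (hfn t j n) (hLp t j n)).2.1
      _ ≤ _ := by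
          push_cast
          gcongr
          exact lintegral_sq_le_of_eLpNorm_le ((hle n t j).trans (hM t))
  refine ⟨a, hdec, fun t x => ?_⟩
  have h1 := (hhat _ (hf t) (hfΩ t) (hLp t 0 0)).2.2.2
    ((hdec.integrable hM.freq t).congr (hae t).symm) x
  refine h1.trans ?_
  unfold synth
  refine integral_congr_ae ?_
  filter_upwards [hae t] with g hg
  rw [hg]

end Model

end

/-! ### Transforms of real divergence-free fields -/

section

open scoped ENNReal NNReal ComplexConjugate

section Velocity

variable {G τ : Type*} [AddCommGroup G] [MeasurableSpace G] {m : Measure G} {ι : G →+ E3}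

theorem pd_comp {v : E3 → E3} {x : E3} (hv : DifferentiableAt ℝ v x) (i j : Fin 3) :
    pd j (fun y => v y i) x = fderiv ℝ v x (EuclideanSpace.single j 1) i := by
  have h := ((EuclideanSpace.proj (𝕜 := ℝ) i : E3 →L[ℝ] ℝ).hasFDerivAt.comp x hv.hasFDerivAt).fderiv
  unfold pd
  exact congrArg (fun L : E3 →L[ℝ] ℝ => L (EuclideanSpace.single j 1)) h

variable [MeasurableNeg G] [m.IsNegInvariant]

theorem Decay.reflect {a : τ → G → ℂ} (ha : Decay m ι a) :
    Decay m ι fun t g => conj (a t (-g)) := by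
  refine ⟨fun t => Complex.continuous_conj.measurable.comp ((ha.meas t).comp measurable_neg),
    fun n => (ha.bound n).imp fun M hM t => le_trans (le_of_eq ?_) (hM t)⟩
  rw [← lintegral_neg_eq_self]
  refine lintegral_congr fun g => ?_
  rw [map_neg, enorm_neg, neg_neg, enorm_eq_nnnorm (conj _), RCLike.nnnorm_conj, ← enorm_eq_nnnorm]

theorem synth_reflect (a : G → ℂ) (x : E3) :
    synth m ι (fun g => conj (a (-g))) x = conj (synth m ι a x) := by
  unfold synth
  rw [← integral_conj, ← integral_neg_eq_self]
  refine integral_congr_ae (ae_of_all _ fun g => ?_)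
  simp only [neg_neg, map_mul, ← Complex.exp_conj, Complex.conj_I, Complex.conj_ofReal, map_neg,
    inner_neg_left, Complex.ofReal_neg, mul_neg, neg_mul]

/-- The Leray projection of `b` is orthogonal to `v`. At v = 0 the quotient by zero is harmless,
since every term carries a factor v_i. -/
theorem ofReal_ι_mul_sum_div (v : E3) (b : Fin 3 → ℂ) :
    ∑ i, ((v i : ℝ) : ℂ) * (b i - ((v i : ℝ) : ℂ) * (∑ k, ((v k : ℝ) : ℂ) * b k) / ((‖v‖ ^ 2 : ℝ) : ℂ))
      = 0 := by
  rcases eq_or_ne v 0 with rfl | hv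
  · simp
  have h0 : ((‖v‖ ^ 2 : ℝ) : ℂ) ≠ 0 := by
    have : ‖v‖ ≠ 0 := norm_ne_zero_iff.2 hv
    exact_mod_cast pow_ne_zero 2 this
  have h1 : ((‖v‖ ^ 2 : ℝ) : ℂ) = ∑ i, ((v i : ℝ) : ℂ) * ((v i : ℝ) : ℂ) := by
    rw [EuclideanSpace.norm_sq_eq]
    push_cast
    refine Finset.sum_congr rfl fun i _ => ?_
    rw [← Complex.ofReal_pow, Real.norm_eq_abs, sq_abs, Complex.ofReal_pow, sq]
  set S := ∑ k, ((v k : ℝ) : ℂ) * b k with hS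
  calc _ = S - (∑ i, ((v i : ℝ) : ℂ) * ((v i : ℝ) : ℂ)) * S / ((‖v‖ ^ 2 : ℝ) : ℂ) := by
        rw [Finset.sum_mul, Finset.sum_div, hS, ← Finset.sum_sub_distrib]
        refine Finset.sum_congr rfl fun i _ => ?_
        ring
    _ = 0 := by rw [← h1, mul_div_cancel_left₀ _ h0, sub_self]

/-- The transform of a bounded family of smooth divergence-free fields, normalized so that reality
and incompressibility hold at every frequency. -/
theorem IsFourierModel.exists_velocity {Ω : SpatialDomain} {c : ℝ} (hM : IsFourierModel Ω m ι c)
    {v : τ → E3 → E3} (hv : ∀ t, ContDiff ℝ ∞ (v t)) (hΩ : ∀ t, Ω.IsFunctionOn (v t))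
    (hb : ∀ n : ℕ, ∃ M : ℝ, ∀ t, eLpNorm (iteratedFDeriv ℝ n (v t)) 2 Ω.vol ≤ ENNReal.ofReal M)
    (hdiv : ∀ t x, divergence (v t) x = 0) :
    ∃ a : Fin 3 → τ → G → ℂ, (∀ i, Decay m ι (a i)) ∧ (∀ t, IsVelocity m ι fun i => a i t) ∧
      ∀ t x i, (v t x i : ℂ) = synth m ι (a i t) x := by
  have hι := hM.freq.meas
  choose a ha hsyn using hM.exists_decay hv hΩ hb
  have hιi : ∀ i, Measurable fun g => ι g i := fun i =>
    (EuclideanSpace.proj (𝕜 := ℝ) i).measurable.comp hι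
  -- Averaging with the reflected conjugate forces reality at every frequency. It changes `a` only
  -- on a null set, because the field is real.
  set b : Fin 3 → τ → G → ℂ := fun i t g => 2⁻¹ * (a i t g + conj (a i t (-g))) with hbdef
  have hbdec : ∀ i, Decay m ι (b i) := fun i => ((ha i).add hι (ha i).reflect).mul_const hι _
  have hreal : ∀ i t, a i t =ᵐ[m] b i t := by
    intro i t
    have h1 : (fun g => a i t g - conj (a i t (-g))) =ᵐ[m] 0 := by
      refine hM.eq_zero_of_synth_eq_zero (((ha i).sub hι (ha i).reflect).single t) fun x => ?_
      rw [synth_sub hι ((ha i).integrable hM.freq t) ((ha i).reflect.integrable hM.freq t),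
        synth_reflect, ← hsyn, Complex.conj_ofReal, sub_self]
    filter_upwards [h1] with g hg
    simp only [Pi.zero_apply, sub_eq_zero] at hg
    simp only [hbdef, ← hg]
    ring
  have hsynb : ∀ t x i, (v t x i : ℂ) = synth m ι (b i t) x := by
    intro t x i
    rw [hsyn]
    unfold synth
    refine integral_congr_ae ?_
    filter_upwards [hreal i t] with g hg
    rw [hg]
  have hdivb : ∀ t, ∀ᵐ g ∂m, ∑ k, ((ι g k : ℝ) : ℂ) * b k t g = 0 := by
    intro t
    have h1 : (fun g => ∑ k, der ι k (b k t) g) =ᵐ[m] 0 := by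
      refine hM.eq_zero_of_synth_eq_zero
        (Decay.sum hι _ fun k _ => ((hbdec k).der hι k).single t) fun x => ?_
      rw [synth_sum hι _ fun k _ => ((hbdec k).der hι k).integrable hM.freq t]
      have h2 : ∀ k, synth m ι (der ι k (b k t)) x = (pd k (fun y => v t y k) x : ℂ) := by
        intro k
        refine (pd_eq_synth hM.freq ((hbdec k).single t) ?_ (fun x => hsynb t x k) k x).symm
        have h3 : ContDiff ℝ ∞ fun y => v t y k := by have := hv t; fun_prop
        exact h3.differentiable (by simp)
      simp only [h2]
      rw [← Complex.ofReal_sum, Complex.ofReal_eq_zero]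
      refine Eq.trans (Finset.sum_congr rfl fun k _ => ?_) (hdiv t x)
      exact pd_comp ((hv t).differentiable (by simp) x) k k
    filter_upwards [h1] with g hg
    simp only [der, Pi.zero_apply, mul_assoc, ← Finset.mul_sum] at hg
    exact (mul_eq_zero.1 hg).resolve_left Complex.I_ne_zero
  -- The Leray projection forces incompressibility at every frequency. Almost everywhere it is the
  -- identity, because the field is divergence-free.
  set d : Fin 3 → τ → G → ℂ := fun i t g =>
    b i t g - ((ι g i : ℝ) : ℂ) * (∑ k, ((ι g k : ℝ) : ℂ) * b k t g) / ((‖ι g‖ ^ 2 : ℝ) : ℂ) with hd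
  have hbd : ∀ i t, b i t =ᵐ[m] d i t := by
    intro i t
    filter_upwards [hdivb t] with g hg
    simp [hd, hg]
  have hdm : ∀ i t, Measurable (d i t) := by
    intro i t
    have h1 := fun k => (hbdec k).meas t
    simp only [hd]
    fun_prop
  have hddec : ∀ i, Decay m ι (d i) := fun i => decay_congr (hbdec i) (hdm i) (hbd i)
  refine ⟨d, hddec, fun t => ⟨fun i => (hddec i).single t, fun i g => ?_, fun g => ?_⟩, ?_⟩
  · have hbneg : ∀ k, b k t (-g) = conj (b k t g) := by
      intro k
      simp only [hbdef, neg_neg, map_mul, map_add, Complex.conj_conj, map_inv₀, map_ofNat]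
      ring
    simp only [hd, hbneg, map_neg, norm_neg, PiLp.neg_apply, Complex.ofReal_neg, map_sub, map_div₀,
      map_mul, map_sum, Complex.conj_ofReal, neg_mul, Finset.sum_neg_distrib, neg_neg, mul_neg]
  · exact ofReal_ι_mul_sum_div (ι g) fun k => b k t g
  · intro t x i
    rw [hsynb]
    unfold synth
    refine integral_congr_ae ?_
    filter_upwards [hbd i t] with g hg
    rw [hg]

end Velocity

/-! ### The vorticity equation -/

section Vorticity

/-- Time and space derivatives commute. -/
theorem hasDerivAt_fderiv_comm {f : ℝ × E3 → ℝ} {t : ℝ} {x : E3} (hf : ContDiffAt ℝ 2 f (t, x))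
    (w : E3) :
    HasDerivAt (fun s => fderiv ℝ (fun y => f (s, y)) x w)
      (fderiv ℝ (fun y => fderiv ℝ f (t, y) (1, 0)) x w) t := by
  have h2 : ContDiffAt ℝ 1 (fderiv ℝ f) (t, x) := hf.fderiv_right (by norm_num)
  have hd : DifferentiableAt ℝ (fderiv ℝ f) (t, x) := h2.differentiableAt (by simp)
  have hsymm : IsSymmSndFDerivAt ℝ f (t, x) := hf.isSymmSndFDerivAt (by simp)
  have hev : ∀ᶠ s in 𝓝 t, DifferentiableAt ℝ f (s, x) := by
    have h1 : ∀ᶠ z in 𝓝 (t, x), ContDiffAt ℝ 1 f z := by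
      exact (hf.of_le one_le_two).eventually (by simp)
    have hc : Tendsto (fun s : ℝ => (s, x)) (𝓝 t) (𝓝 (t, x)) :=
      (Continuous.prodMk_left x).continuousAt
    exact (hc.eventually h1).mono fun s hs => hs.differentiableAt (by simp)
  have e1 : (fun s => fderiv ℝ (fun y => f (s, y)) x w) =ᶠ[𝓝 t] fun s => fderiv ℝ f (s, x) (0, w) := by
    filter_upwards [hev] with s hs
    have h := (hs.hasFDerivAt.comp x (hasFDerivAt_prodMk_right s x)).fderiv
    have h' : fderiv ℝ (fun y => f (s, y)) x = _ := h
    rw [h']; rfl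
  have h3 : HasDerivAt (fun s => fderiv ℝ f (s, x) (0, w)) (fderiv ℝ (fderiv ℝ f) (t, x) (1, 0) (0, w)) t := by
    have h := hd.hasFDerivAt.comp_hasDerivAt t ((hasDerivAt_id t).prodMk (hasDerivAt_const t x))
    exact h.clm_apply (hasDerivAt_const t ((0 : ℝ), w)) |>.congr_deriv (by simp)
  have h4 : fderiv ℝ (fun y => fderiv ℝ f (t, y) (1, 0)) x w =
      fderiv ℝ (fderiv ℝ f) (t, x) (0, w) (1, 0) := by
    have h := hd.hasFDerivAt.comp x (hasFDerivAt_prodMk_right t x)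
    have h' := (h.clm_apply (hasFDerivAt_const ((1 : ℝ), (0 : E3)) x)).fderiv
    have h'' : fderiv ℝ (fun y => fderiv ℝ f (t, y) (1, 0)) x = _ := h'
    rw [h'']
    simp
  rw [h4, ← hsymm.eq]
  exact h3.congr_of_eventuallyEq e1

theorem pd_comm {f : E3 → ℝ} (hf : ContDiff ℝ 2 f) (i j : Fin 3) (x : E3) :
    pd i (pd j f) x = pd j (pd i f) x := by
  have hd : DifferentiableAt ℝ (fderiv ℝ f) x :=
    (hf.fderiv_right (m := 1) (by norm_num)).differentiable (by simp) x
  have key : ∀ i j, pd i (pd j f) x = fderiv ℝ (fderiv ℝ f) x (EuclideanSpace.single i 1)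
      (EuclideanSpace.single j 1) := by
    intro i j
    have h := (hd.hasFDerivAt.clm_apply (hasFDerivAt_const (EuclideanSpace.single j (1 : ℝ)) x)).fderiv
    have h' : fderiv ℝ (pd j f) x = _ := h
    rw [pd, h']
    simp
  have hsymm : IsSymmSndFDerivAt ℝ f x := hf.contDiffAt.isSymmSndFDerivAt (by simp)
  rw [key, key, hsymm.eq]

end Vorticity

end

section

open scoped ENNReal NNReal ComplexConjugate

/-! ### The vorticity of a solution -/

section Rate

/-- The right-hand side of the momentum equation without the pressure. -/
def rhs (ν : ℝ) (v : E3 → E3) (i : Fin 3) (x : E3) : ℝ :=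
  ν * ∑ l, pd l (pd l fun y => v y i) x - ∑ l, v x l * pd l (fun y => v y i) x

/-- The vorticity `∂_i v_j - ∂_j v_i`. -/
def vort (v : E3 → E3) (i j : Fin 3) (x : E3) : ℝ :=
  pd i (fun y => v y j) x - pd j (fun y => v y i) x

/-- The time derivative of the vorticity along a solution. -/
def vortRate (ν : ℝ) (v : E3 → E3) (i j : Fin 3) (x : E3) : ℝ :=
  pd i (rhs ν v j) x - pd j (rhs ν v i) x

theorem contDiff_comp_coord {v : E3 → E3} (hv : ContDiff ℝ ∞ v) (i : Fin 3) :
    ContDiff ℝ ∞ fun y => v y i := by fun_prop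

theorem contDiff_rhs {v : E3 → E3} (hv : ContDiff ℝ ∞ v) (ν : ℝ) (i : Fin 3) :
    ContDiff ℝ ∞ (rhs ν v i) := by
  have h0 := contDiff_comp_coord hv
  have h1 := fun l => contDiff_pd (h0 i) l
  have h2 := fun l => contDiff_pd (h1 l) l
  unfold rhs
  refine (contDiff_const.mul (ContDiff.sum fun l _ => h2 l)).sub
    (ContDiff.sum fun l _ => (h0 l).mul (h1 l))

theorem fderiv_apply_eq_sum_pd {v : E3 → E3} {x : E3} (hv : DifferentiableAt ℝ v x) (w : E3)
    (i : Fin 3) : fderiv ℝ v x w i = ∑ l, w l * pd l (fun y => v y i) x := by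
  have hw : w = ∑ l, w l • (EuclideanSpace.single l 1 : E3) := by
    have := (EuclideanSpace.basisFun (Fin 3) ℝ).sum_repr w
    simpa using this.symm
  conv_lhs => rw [hw]
  simp [map_sum, map_smul, pd_comp hv]

theorem gradient_apply (f : E3 → ℝ) (x : E3) (i : Fin 3) : gradient f x i = pd i f x := by
  have h := InnerProductSpace.toDual_symm_apply (𝕜 := ℝ) (y := fderiv ℝ f x)
    (x := EuclideanSpace.single i (1 : ℝ))
  rw [EuclideanSpace.inner_single_right] at h
  simpa [gradient, pd] using h

theorem laplacian_apply {v : E3 → E3} (hv : ContDiff ℝ ∞ v) (x : E3) (i : Fin 3) :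
    Laplacian.laplacian v x i = ∑ l, pd l (pd l fun y => v y i) x := by
  have h2 : ContDiffAt ℝ 2 v x := (hv.of_le ENat.LEInfty.out).contDiffAt
  have h := h2.laplacian_CLM_comp_left (l := (EuclideanSpace.proj (𝕜 := ℝ) i : E3 →L[ℝ] ℝ))
  refine h.symm.trans ?_
  rw [InnerProductSpace.laplacian_eq_iteratedFDeriv_orthonormalBasis _
    (EuclideanSpace.basisFun (Fin 3) ℝ)]
  refine Finset.sum_congr rfl fun l _ => ?_
  have h3 := iterate_pd_eq (contDiff_comp_coord hv i) l 2 x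
  simp only [Function.iterate_succ, Function.iterate_zero, Function.comp_apply, id] at h3
  rw [h3]
  congr 1
  ext k
  fin_cases k <;> simp

variable {Ω : SpatialDomain} {ν T : ℝ} {u₀ : E3 → E3} {u : ℝ → E3 → E3} {p : ℝ → E3 → ℝ}

theorem isOpen_slab : IsOpen (Ioo 0 T ×ˢ (univ : Set E3)) := isOpen_Ioo.prod isOpen_univ

theorem contDiff_slice {F : Type*} [NormedAddCommGroup F] [NormedSpace ℝ F] {f : ℝ → E3 → F}
    (h : ContDiffOn ℝ ∞ (fun z : ℝ × E3 => f z.1 z.2) (Ioo 0 T ×ˢ univ)) {t : ℝ}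
    (ht : t ∈ Ioo 0 T) : ContDiff ℝ ∞ (f t) := by
  have h1 : ContDiffOn ℝ ∞ (fun x : E3 => f t x) univ :=
    h.comp (f := fun x : E3 => (t, x)) (by fun_prop) fun x _ => ⟨ht, trivial⟩
  exact contDiffOn_univ.1 h1

namespace IsSmoothSolution

theorem contDiff (hs : IsSmoothSolution Ω ν T u₀ u p) {t : ℝ} (ht : t ∈ Ioo 0 T) :
    ContDiff ℝ ∞ (u t) := contDiff_slice hs.smooth_velocity ht

theorem contDiffAt (hs : IsSmoothSolution Ω ν T u₀ u p) {t : ℝ} (ht : t ∈ Ioo 0 T) (x : E3)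
    (i : Fin 3) : ContDiffAt ℝ ∞ (fun z : ℝ × E3 => u z.1 z.2 i) (t, x) := by
  have h := hs.smooth_velocity.contDiffAt (isOpen_slab.mem_nhds (mk_mem_prod ht (mem_univ x)))
  fun_prop

theorem hasDerivAt_coord (hs : IsSmoothSolution Ω ν T u₀ u p) {t : ℝ} (ht : t ∈ Ioo 0 T) (x : E3)
    (i : Fin 3) :
    HasDerivAt (fun s => u s x i) (fderiv ℝ (fun z : ℝ × E3 => u z.1 z.2 i) (t, x) (1, 0)) t := by
  have h := ((hs.contDiffAt ht x i).differentiableAt (by simp)).hasFDerivAt.comp_hasDerivAt t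
    ((hasDerivAt_id t).prodMk (hasDerivAt_const t x))
  exact h

theorem fderiv_time (hs : IsSmoothSolution Ω ν T u₀ u p) {t : ℝ} (ht : t ∈ Ioo 0 T) (x : E3)
    (i : Fin 3) :
    fderiv ℝ (fun z : ℝ × E3 => u z.1 z.2 i) (t, x) (1, 0) = rhs ν (u t) i x - pd i (p t) x := by
  have h0 : DifferentiableAt ℝ (fun s => u s x) t := by
    rw [differentiableAt_piLp]
    exact fun i => (hs.hasDerivAt_coord ht x i).differentiableAt
  have h1 : HasDerivAt (fun s => u s x i) (deriv (fun s => u s x) t i) t :=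
    (EuclideanSpace.proj (𝕜 := ℝ) i : E3 →L[ℝ] ℝ).hasFDerivAt.comp_hasDerivAt t h0.hasDerivAt
  rw [(hs.hasDerivAt_coord ht x i).unique h1]
  have h2 := congrArg (fun w : E3 => w i) (hs.momentum t ht x)
  simp only [PiLp.add_apply, PiLp.neg_apply, PiLp.smul_apply, smul_eq_mul, gradient_apply,
    laplacian_apply (hs.contDiff ht),
    fderiv_apply_eq_sum_pd ((hs.contDiff ht).differentiable (by simp) x)] at h2
  rw [rhs]
  linarith

theorem hasDerivAt_pd (hs : IsSmoothSolution Ω ν T u₀ u p) {t : ℝ} (ht : t ∈ Ioo 0 T) (x : E3)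
    (i j : Fin 3) :
    HasDerivAt (fun s => pd j (fun y => u s y i) x)
      (pd j (rhs ν (u t) i) x - pd j (pd i (p t)) x) t := by
  have h := hasDerivAt_fderiv_comm ((hs.contDiffAt ht x i).of_le ENat.LEInfty.out)
    (EuclideanSpace.single j (1 : ℝ))
  have e : (fun y => fderiv ℝ (fun z : ℝ × E3 => u z.1 z.2 i) (t, y) (1, 0)) =
      fun y => rhs ν (u t) i y - pd i (p t) y := funext fun y => hs.fderiv_time ht y i
  rw [e, fderiv_fun_sub ((contDiff_rhs (hs.contDiff ht) ν i).differentiable (by simp) x)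
    ((contDiff_pd (contDiff_slice hs.smooth_pressure ht) i).differentiable (by simp) x)] at h
  exact h

/-- The pressure enters only through ∂_i∂_j p - ∂_j∂_i p = 0. No growth condition on it and no
normalization are needed. -/
theorem hasDerivAt_vort (hs : IsSmoothSolution Ω ν T u₀ u p) {t : ℝ} (ht : t ∈ Ioo 0 T)
    (i j : Fin 3) (x : E3) :
    HasDerivAt (fun s => vort (u s) i j x) (vortRate ν (u t) i j x) t := by
  have h := (hs.hasDerivAt_pd ht x j i).sub (hs.hasDerivAt_pd ht x i j)
  refine h.congr_deriv ?_
  rw [vortRate, pd_comm ((contDiff_slice hs.smooth_pressure ht).of_le ENat.LEInfty.out) i j]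
  ring

/-- The rate is recognized as the time derivative of the vorticity, a smooth function of (t, x).
Joint continuity follows without touching the formula that defines the rate. -/
theorem continuousOn_vortRate (hs : IsSmoothSolution Ω ν T u₀ u p) (i j : Fin 3) :
    ContinuousOn (fun z : ℝ × E3 => vortRate ν (u z.1) i j z.2) (Ioo 0 T ×ˢ univ) := by
  intro z hz
  obtain ⟨t, x⟩ := z
  refine ContinuousAt.continuousWithinAt ?_
  have hf : ∀ i, ContDiffAt ℝ 2 (fderiv ℝ (fun z : ℝ × E3 => u z.1 z.2 i)) (t, x) := fun i =>
    ((hs.contDiffAt hz.1 x i).of_le (m := 3) ENat.LEInfty.out).fderiv_right (by norm_num)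
  set w : ℝ × E3 → ℝ := fun z =>
    fderiv ℝ (fun z : ℝ × E3 => u z.1 z.2 j) z (0, EuclideanSpace.single i 1) -
    fderiv ℝ (fun z : ℝ × E3 => u z.1 z.2 i) z (0, EuclideanSpace.single j 1) with hw
  have hwd : ContDiffAt ℝ 2 w (t, x) :=
    ((hf j).clm_apply contDiffAt_const).sub ((hf i).clm_apply contDiffAt_const)
  have hw1 : ContDiffAt ℝ 1 (fderiv ℝ w) (t, x) := hwd.fderiv_right (by norm_num)
  have hc : ContinuousAt (fun z => fderiv ℝ w z (1, 0)) (t, x) :=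
    (hw1.clm_apply contDiffAt_const).continuousAt
  have hwe : ∀ s ∈ Ioo 0 T, ∀ y, w (s, y) = vort (u s) i j y := by
    have key : ∀ s ∈ Ioo 0 T, ∀ y, ∀ k l, pd l (fun y => u s y k) y =
        fderiv ℝ (fun z : ℝ × E3 => u z.1 z.2 k) (s, y) (0, EuclideanSpace.single l 1) := by
      intro s hs' y k l
      have h := (((hs.contDiffAt hs' y k).differentiableAt (by simp)).hasFDerivAt.comp y
        (hasFDerivAt_prodMk_right s y)).fderiv
      have h' : fderiv ℝ (fun y => u s y k) y = _ := h
      rw [pd, h']; rfl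
    intro s hs' y
    rw [vort, key s hs', key s hs']
  refine hc.congr ?_
  have hev : ∀ᶠ z in 𝓝 (t, x), DifferentiableAt ℝ w z :=
    (hwd.eventually (by simp)).mono fun z hz => hz.differentiableAt (by simp)
  filter_upwards [hev, isOpen_slab.mem_nhds hz] with z hz1 hz2
  obtain ⟨s, y⟩ := z
  have h1 : HasDerivAt (fun r => w (r, y)) (fderiv ℝ w (s, y) (1, 0)) s :=
    hz1.hasFDerivAt.comp_hasDerivAt (f := fun r : ℝ => (r, y)) s
      ((hasDerivAt_id s).prodMk (hasDerivAt_const s y))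
  have h2 := hs.hasDerivAt_vort hz2.1 i j y
  refine (h1.congr_of_eventuallyEq ?_).unique h2
  filter_upwards [isOpen_Ioo.mem_nhds hz2.1] with r hr
  exact (hwe r hr y).symm

end IsSmoothSolution

end Rate

end

section

open scoped ENNReal NNReal ComplexConjugate InnerProductSpace

/-! ### Elements of `L²` given by their transforms -/

section Elements

variable {G τ : Type*} [AddCommGroup G] [MeasurableSpace G] {m : Measure G} {ι : G →+ E3}
  {Ω : SpatialDomain} {c : ℝ} {a b : G → ℂ} {ψ : E3 → ℝ}

theorem Decay.integrable_mul_conj (ha : Decay m ι fun _ : Unit => a)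
    (hb : Decay m ι fun _ : Unit => b) : Integrable (fun g => a g * conj (b g)) m := by
  have h1 := ha.memLp_two ()
  have h2 := (hb.memLp_two ()).star
  exact h1.integrable_mul h2

theorem Decay.ofReal_integral_norm_sq (ha : Decay m ι fun _ : Unit => a) :
    ENNReal.ofReal (∫ g, ‖a g‖ ^ 2 ∂m) = ∫⁻ g, ‖a g‖ₑ ^ 2 ∂m := by
  have h := ha.memLp_two ()
  rw [ofReal_integral_eq_lintegral_ofReal ((memLp_two_iff_integrable_sq_norm h.1).1 h)
    (ae_of_all _ fun g => sq_nonneg _)]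
  refine lintegral_congr fun g => ?_
  rw [ENNReal.ofReal_pow (norm_nonneg _), ofReal_norm]

namespace IsFourierModel

theorem memLp_synth (hM : IsFourierModel Ω m ι c) (ha : Decay m ι fun _ : Unit => a) :
    MemLp (synth m ι a) 2 Ω.vol :=
  (hM.plancherel a (ha.meas ()) (ha.integrable hM.freq ()) (ha.memLp_two ())).1

theorem integral_norm_sq_synth (hM : IsFourierModel Ω m ι c) (ha : Decay m ι fun _ : Unit => a) :
    ∫ x, ‖synth m ι a x‖ ^ 2 ∂Ω.vol = c * ∫ g, ‖a g‖ ^ 2 ∂m :=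
  (hM.plancherel a (ha.meas ()) (ha.integrable hM.freq ()) (ha.memLp_two ())).2

theorem memLp_re_synth (hM : IsFourierModel Ω m ι c) (ha : Decay m ι fun _ : Unit => a) :
    MemLp (fun x => (synth m ι a x).re) 2 Ω.vol := (hM.memLp_synth ha).re

theorem norm_add_sq_sub_norm_sub_sq (z w : ℂ) :
    ‖z + w‖ ^ 2 - ‖z - w‖ ^ 2 = 4 * (z * conj w).re := by
  rw [← Complex.normSq_eq_norm_sq, ← Complex.normSq_eq_norm_sq, Complex.normSq_add,
    Complex.normSq_sub]
  ring

/-- The polarized Plancherel identity. -/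
theorem integral_synth_mul_conj (hM : IsFourierModel Ω m ι c)
    (ha : Decay m ι fun _ : Unit => a) (hb : Decay m ι fun _ : Unit => b) :
    ∫ x, (synth m ι a x * conj (synth m ι b x)).re ∂Ω.vol = c * ∫ g, (a g * conj (b g)).re ∂m := by
  have hι := hM.freq.meas
  have hadd := ha.add hι hb
  have hsub := ha.sub hι hb
  have h1 := hM.integral_norm_sq_synth hadd
  have h2 := hM.integral_norm_sq_synth hsub
  simp only [synth_add hι (ha.integrable hM.freq ()) (hb.integrable hM.freq ())] at h1
  simp only [synth_sub hι (ha.integrable hM.freq ()) (hb.integrable hM.freq ())] at h2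
  have i1 := ((hM.memLp_synth ha).add (hM.memLp_synth hb))
  have i2 := ((hM.memLp_synth ha).sub (hM.memLp_synth hb))
  have i1' := (memLp_two_iff_integrable_sq_norm i1.1).1 i1
  have i2' := (memLp_two_iff_integrable_sq_norm i2.1).1 i2
  have j1 := hadd.memLp_two ()
  have j2 := hsub.memLp_two ()
  have j1' := (memLp_two_iff_integrable_sq_norm j1.1).1 j1
  have j2' := (memLp_two_iff_integrable_sq_norm j2.1).1 j2
  have h3 : ∫ x, (‖synth m ι a x + synth m ι b x‖ ^ 2 - ‖synth m ι a x - synth m ι b x‖ ^ 2) ∂Ω.vol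
      = c * ∫ g, (‖a g + b g‖ ^ 2 - ‖a g - b g‖ ^ 2) ∂m := by
    rw [integral_sub j1' j2', mul_sub, ← h1, ← h2]
    exact integral_sub i1' i2'
  simp only [norm_add_sq_sub_norm_sub_sq, integral_const_mul] at h3
  linarith

instance : IsLocallyFiniteMeasure Ω.vol := by
  unfold SpatialDomain.vol; infer_instance

/-- The real part of the synthesis, as an element of `L²`. -/
def reElem (hM : IsFourierModel Ω m ι c) (ha : Decay m ι fun _ : Unit => a) : Lp ℝ 2 Ω.vol :=
  (hM.memLp_re_synth ha).toLp _

/-- Reality of one factor suffices. This matters because ψ need not be even, so multiplying the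
transform of a real field by the weight may give a complex field. -/
theorem inner_reElem (hM : IsFourierModel Ω m ι c) (ha : Decay m ι fun _ : Unit => a)
    (hb : Decay m ι fun _ : Unit => b) (hr : ∀ x, (synth m ι a x).im = 0) :
    ⟪hM.reElem ha, hM.reElem hb⟫_ℝ = c * ∫ g, (a g * conj (b g)).re ∂m := by
  rw [reElem, reElem, inner_toLp, ← hM.integral_synth_mul_conj ha hb]
  refine integral_congr_ae (ae_of_all _ fun x => ?_)
  simp [Complex.mul_re, hr x]

theorem norm_reElem_sq_le (hM : IsFourierModel Ω m ι c) (ha : Decay m ι fun _ : Unit => a) :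
    ‖hM.reElem ha‖ ^ 2 ≤ c * ∫ g, ‖a g‖ ^ 2 ∂m := by
  rw [← real_inner_self_eq_norm_sq, reElem, inner_toLp, ← hM.integral_norm_sq_synth ha]
  have h1 := hM.memLp_re_synth ha
  have h2 := hM.memLp_synth ha
  refine integral_mono ?_ ((memLp_two_iff_integrable_sq_norm h2.1).1 h2) fun x => ?_
  · exact h1.integrable_mul h1
  · have := Complex.abs_re_le_norm (synth m ι a x)
    simp only [← sq]
    exact sq_le_sq.2 (by rwa [abs_norm])

theorem norm_reElem_sq (hM : IsFourierModel Ω m ι c) (ha : Decay m ι fun _ : Unit => a)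
    (hr : ∀ x, (synth m ι a x).im = 0) : ‖hM.reElem ha‖ ^ 2 = c * ∫ g, ‖a g‖ ^ 2 ∂m := by
  rw [← real_inner_self_eq_norm_sq, hM.inner_reElem ha ha hr]
  simp only [Complex.mul_conj, Complex.normSq_eq_norm_sq, Complex.ofReal_re]

theorem reElem_sub (hM : IsFourierModel Ω m ι c) (ha : Decay m ι fun _ : Unit => a)
    (hb : Decay m ι fun _ : Unit => b) :
    hM.reElem ha - hM.reElem hb = hM.reElem (ha.sub hM.freq.meas hb) := by
  rw [reElem, reElem, ← MemLp.toLp_sub, reElem]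
  refine MemLp.toLp_congr _ _ (ae_of_all _ fun x => ?_)
  simp [synth_sub hM.freq.meas (ha.integrable hM.freq ()) (hb.integrable hM.freq ())]

end IsFourierModel

/-! ### The weight of the vorticity -/

/-- The weight that the vorticity carries when the velocity carries `weight ψ`. -/
def pot (ψ : E3 → ℝ) (x : E3) : ℝ := weight ψ x / ‖x‖ ^ 2

theorem pot_mul_sq (ψ : E3 → ℝ) (x : E3) : pot ψ x * ‖x‖ ^ 2 = weight ψ x := by
  rcases eq_or_ne x 0 with rfl | hx
  · simp [weight_zero]
  · rw [pot, div_mul_cancel₀ _ (pow_ne_zero 2 (norm_ne_zero_iff.2 hx))]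

theorem exists_pot_le (hψ : IsCutoff ψ) : ∃ C : ℝ≥0, ∀ x, ‖(pot ψ x : ℂ)‖ₑ ≤ C * ‖x‖ₑ := by
  obtain ⟨C, hC, h⟩ := exists_weight_le hψ
  refine ⟨C.toNNReal, fun x => ?_⟩
  have h1 : ‖(pot ψ x : ℂ)‖ ≤ C * ‖x‖ := by
    rw [Complex.norm_real, pot, Real.norm_of_nonneg (div_nonneg (weight_nonneg _ _) (sq_nonneg _))]
    refine div_le_of_le_mul₀ (sq_nonneg _) (by positivity) ((h x).trans (le_of_eq (by ring)))
  calc _ = ENNReal.ofReal ‖(pot ψ x : ℂ)‖ := (ofReal_norm _).symm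
    _ ≤ ENNReal.ofReal (C * ‖x‖) := ENNReal.ofReal_le_ofReal h1
    _ = _ := by rw [ENNReal.ofReal_mul hC.le, ofReal_norm]; rfl

theorem measurable_pot (hψ : IsCutoff ψ) (hι : Measurable ι) :
    Measurable fun g => pot ψ (ι g) :=
  ((continuous_weight hψ).measurable.comp hι).div (hι.norm.pow_const 2)

theorem Decay.pot_mul (hψ : IsCutoff ψ) (hι : Measurable ι) {a : τ → G → ℂ} (ha : Decay m ι a) :
    Decay m ι fun t g => (pot ψ (ι g) : ℂ) * a t g := by
  obtain ⟨C, hC⟩ := exists_pot_le hψ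
  have hm := measurable_pot hψ hι
  refine Decay.of_norm_le hι (C := C) (k := 1) ha (fun t => ?_) fun t g => ?_
  · have := ha.meas t
    fun_prop
  · rw [enorm_mul]
    gcongr
    refine (hC _).trans ?_
    rw [pow_one]
    gcongr
    exact le_add_self

/-- The weighted element is controlled by the unweighted one, by interpolation. -/
theorem IsFourierModel.exists_norm_reElem_pot_le (hM : IsFourierModel Ω m ι c) (hψ : IsCutoff ψ)
    {a : τ → G → ℂ} (ha : Decay m ι a) (hr : ∀ t x, (synth m ι (a t) x).im = 0) :
    ∃ K : ℝ, ∀ t, ‖hM.reElem ((ha.single t).pot_mul hψ hM.freq.meas)‖ ^ 4 ≤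
      K * ‖hM.reElem (ha.single t)‖ ^ 2 := by
  have hι := hM.freq.meas
  obtain ⟨C, hC⟩ := exists_pot_le hψ
  obtain ⟨M, hbd⟩ := ha.bound 4
  refine ⟨c * C ^ 4 * M, fun t => ?_⟩
  have h1 := hM.norm_reElem_sq_le ((ha.single t).pot_mul hψ hι)
  have h2 := hM.norm_reElem_sq (ha.single t) (hr t)
  have hm := ha.meas t
  set P := ∫ g, ‖(pot ψ (ι g) : ℂ) * a t g‖ ^ 2 ∂m with hP
  set Q := ∫ g, ‖a t g‖ ^ 2 ∂m with hQ
  have hQ0 : 0 ≤ Q := integral_nonneg fun g => sq_nonneg _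
  have hP0 : 0 ≤ P := integral_nonneg fun g => sq_nonneg _
  -- As |pot| ≤ C|ξ|, Cauchy-Schwarz on ∫ (|ξ|²|a|)|a| leaves the fourth moment, bounded uniformly
  -- in t, and the plain L² norm.
  have h3 : P ^ 2 ≤ C ^ 4 * M * Q := by
    rw [← ENNReal.ofReal_le_ofReal_iff (by positivity), ENNReal.ofReal_pow hP0,
      ENNReal.ofReal_mul (by positivity), ENNReal.ofReal_mul (by positivity),
      ENNReal.ofReal_pow (by positivity), ENNReal.ofReal_coe_nnreal, ENNReal.ofReal_coe_nnreal,
      hP, hQ, ((ha.single t).pot_mul hψ hι).ofReal_integral_norm_sq,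
      (ha.single t).ofReal_integral_norm_sq]
    calc _ ≤ (∫⁻ g, C ^ 2 * ((‖ι g‖ₑ ^ 2 * ‖a t g‖ₑ) * ‖a t g‖ₑ) ∂m) ^ 2 := by
          gcongr with g
          rw [enorm_mul]
          calc _ ≤ (C * ‖ι g‖ₑ * ‖a t g‖ₑ) ^ 2 := by gcongr; exact hC _
            _ = _ := by ring
      _ = C ^ 4 * (∫⁻ g, (‖ι g‖ₑ ^ 2 * ‖a t g‖ₑ) * ‖a t g‖ₑ ∂m) ^ 2 := by
          rw [lintegral_const_mul _ (by fun_prop), mul_pow, ← pow_mul]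
      _ ≤ C ^ 4 * ((∫⁻ g, (‖ι g‖ₑ ^ 2 * ‖a t g‖ₑ) ^ 2 ∂m) * ∫⁻ g, ‖a t g‖ₑ ^ 2 ∂m) := by
          gcongr
          exact sq_lintegral_mul_le (by fun_prop) (by fun_prop)
      _ ≤ C ^ 4 * (M * ∫⁻ g, ‖a t g‖ₑ ^ 2 ∂m) := by
          gcongr
          refine le_trans (le_of_eq ?_) (hbd t)
          refine lintegral_congr fun g => ?_
          ring
      _ = _ := by ring
  have hc := hM.pos
  calc _ = (‖hM.reElem ((ha.single t).pot_mul hψ hι)‖ ^ 2) ^ 2 := by ring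
    _ ≤ (c * P) ^ 2 := by gcongr
    _ = c ^ 2 * P ^ 2 := by ring
    _ ≤ c ^ 2 * (C ^ 4 * M * Q) := by gcongr
    _ = _ := by rw [h2]; ring

end Elements

end

section

open scoped ENNReal NNReal ComplexConjugate InnerProductSpace

/-! ### The vorticity equation on the frequency side -/

section Hat

variable {G τ : Type*} [AddCommGroup G] [MeasurableSpace G] {m : Measure G} {ι : G →+ E3}
  {Ω : SpatialDomain} {c ν : ℝ} {ψ : E3 → ℝ}

/-- The transform of `vort`. -/
def vortHat (ι : G →+ E3) (a : Fin 3 → G → ℂ) (i j : Fin 3) (g : G) : ℂ :=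
  der ι i (a j) g - der ι j (a i) g

/-- The transform of `rhs`. -/
def rhsHat (m : Measure G) (ι : G →+ E3) (ν : ℝ) (a : Fin 3 → G → ℂ) (i : Fin 3) (g : G) : ℂ :=
  ν * ∑ l, der ι l (der ι l (a i)) g - advect m ι a (a i) g

theorem Decay.vortHat (hι : Measurable ι) {a : Fin 3 → τ → G → ℂ} (ha : ∀ i, Decay m ι (a i))
    (i j : Fin 3) : Decay m ι fun t => vortHat ι (fun i => a i t) i j :=
  ((ha j).der hι i).sub hι ((ha i).der hι j)

/-- Lagrange's identity: the double sum is 2|ξ|² F·ā - 2(ξ·F)(ξ·ā). The second term vanishes by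
incompressibility of `a` alone, so `F` may have a gradient part, as the right-hand side without
pressure does. -/
theorem sum_vortHat_mul_conj (F a : Fin 3 → G → ℂ) {g : G}
    (hdiv : ∑ i, ((ι g i : ℝ) : ℂ) * a i g = 0) :
    ∑ i, ∑ j, vortHat ι F i j g * conj (vortHat ι a i j g) =
      2 * ((‖ι g‖ ^ 2 : ℝ) : ℂ) * ∑ i, F i g * conj (a i g) := by
  have h1 : ((‖ι g‖ ^ 2 : ℝ) : ℂ) = ∑ i, ((ι g i : ℝ) : ℂ) ^ 2 := by
    rw [EuclideanSpace.norm_sq_eq]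
    push_cast
    refine Finset.sum_congr rfl fun i _ => ?_
    rw [← Complex.ofReal_pow, Real.norm_eq_abs, sq_abs, Complex.ofReal_pow]
  have h2 := congrArg conj hdiv
  simp only [map_sum, map_mul, Complex.conj_ofReal, map_zero] at h2
  rw [h1]
  simp only [vortHat, der, map_sub, map_mul, Complex.conj_I, Complex.conj_ofReal,
    Fin.sum_univ_three] at h2 ⊢
  have hI := Complex.I_mul_I
  generalize ((ι g 0 : ℝ) : ℂ) = x at *
  generalize ((ι g 1 : ℝ) : ℂ) = y at *
  generalize ((ι g 2 : ℝ) : ℂ) = z at *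
  generalize conj (a 0 g) = a0 at *
  generalize conj (a 1 g) = a1 at *
  generalize conj (a 2 g) = a2 at *
  generalize F 0 g = f0
  generalize F 1 g = f1
  generalize F 2 g = f2
  have e : ∀ s t s' t' : ℂ, (Complex.I * s - Complex.I * t) * (-Complex.I * s' - -Complex.I * t') =
      (s - t) * (s' - t') := fun s t s' t' => by linear_combination -(s - t) * (s' - t') * hI
  simp only [mul_assoc] at e ⊢
  simp only [e]
  linear_combination (-2) * (x * f0 + y * f1 + z * f2) * h2

/-- `pot` is designed for this: multiplied by |ξ|² it restores `weight`, also at ξ = 0. -/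
theorem sum_vortHat_mul_conj_pot (F a : Fin 3 → G → ℂ) {g : G}
    (hdiv : ∑ i, ((ι g i : ℝ) : ℂ) * a i g = 0) :
    ∑ i, ∑ j, (vortHat ι F i j g * conj ((pot ψ (ι g) : ℂ) * vortHat ι a i j g)).re =
      2 * (weight ψ (ι g) * (∑ i, F i g * conj (a i g)).re) := by
  have h := sum_vortHat_mul_conj F a hdiv
  have e : ∀ i j, vortHat ι F i j g * conj ((pot ψ (ι g) : ℂ) * vortHat ι a i j g) =
      (pot ψ (ι g) : ℂ) * (vortHat ι F i j g * conj (vortHat ι a i j g)) := fun i j => by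
    rw [map_mul, Complex.conj_ofReal]; ring
  simp only [e, ← Complex.re_sum, ← Finset.mul_sum, h, ← pot_mul_sq ψ (ι g)]
  rw [← Complex.re_ofReal_mul, ← Complex.re_ofReal_mul]
  congr 1
  push_cast
  ring

variable [MeasurableAdd₂ G] [MeasurableNeg G] [SFinite m] [m.IsAddLeftInvariant] [m.IsNegInvariant]

theorem Decay.rhsHat (hG : IsFreq m ι) {a : Fin 3 → τ → G → ℂ} (ha : ∀ i, Decay m ι (a i))
    (ν : ℝ) (i : Fin 3) : Decay m ι fun t => rhsHat m ι ν (fun i => a i t) i := by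
  have hι := hG.meas
  exact ((Decay.sum hι _ fun l _ => ((ha i).der hι l).der hι l).mul_const hι _).sub hι
    (Decay.advect hG ha (ha i))

theorem sum_rhsHat_mul_conj (ν : ℝ) (a : Fin 3 → G → ℂ) (g : G) :
    (∑ i, rhsHat m ι ν a i g * conj (a i g)).re =
      -ν * (‖ι g‖ ^ 2 * (amp a g : ℝ) ^ 2) - (∑ i, advect m ι a (a i) g * conj (a i g)).re := by
  have h1 : ((‖ι g‖ ^ 2 : ℝ) : ℂ) = ∑ i, ((ι g i : ℝ) : ℂ) ^ 2 := by
    rw [EuclideanSpace.norm_sq_eq]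
    push_cast
    refine Finset.sum_congr rfl fun i _ => ?_
    rw [← Complex.ofReal_pow, Real.norm_eq_abs, sq_abs, Complex.ofReal_pow]
  have h2 : ∀ i, rhsHat m ι ν a i g * conj (a i g) =
      ((-ν * (‖ι g‖ ^ 2 * ‖a i g‖ ^ 2) : ℝ) : ℂ) - advect m ι a (a i) g * conj (a i g) := by
    intro i
    have h3 : a i g * conj (a i g) = ((‖a i g‖ ^ 2 : ℝ) : ℂ) := by
      rw [Complex.mul_conj, Complex.normSq_eq_norm_sq]
    have h4 : ∑ l, der ι l (der ι l (a i)) g = -((‖ι g‖ ^ 2 : ℝ) : ℂ) * a i g := by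
      rw [h1, ← Finset.sum_neg_distrib, Finset.sum_mul]
      refine Finset.sum_congr rfl fun l _ => ?_
      simp only [der]
      linear_combination ((ι g l : ℝ) : ℂ) ^ 2 * a i g * Complex.I_mul_I
    rw [rhsHat, h4]
    push_cast at h3 ⊢
    linear_combination -(ν : ℂ) * (‖ι g‖ : ℂ) ^ 2 * h3
  simp only [h2, Finset.sum_sub_distrib, Complex.sub_re, ← Complex.ofReal_sum, Complex.ofReal_re,
    amp_sq, Finset.mul_sum]

theorem rhs_eq_synth (hG : IsFreq m ι) {v : E3 → E3} (hv : ContDiff ℝ ∞ v) {a : Fin 3 → G → ℂ}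
    (ha : ∀ i, Decay m ι fun _ : Unit => a i) (h : ∀ x i, (v x i : ℂ) = synth m ι (a i) x)
    (ν : ℝ) (i : Fin 3) (x : E3) : (rhs ν v i x : ℂ) = synth m ι (rhsHat m ι ν a i) x := by
  have hι := hG.meas
  have h0 := contDiff_comp_coord hv
  have h1 : ∀ l x, (pd l (fun y => v y i) x : ℂ) = synth m ι (der ι l (a i)) x := fun l =>
    pd_eq_synth hG (ha i) ((h0 i).differentiable (by simp)) (fun x => h x i) l
  have h2 : ∀ l x, (pd l (pd l fun y => v y i) x : ℂ) = synth m ι (der ι l (der ι l (a i))) x :=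
    fun l => pd_eq_synth hG ((ha i).der hι l)
      ((contDiff_pd (h0 i) l).differentiable (by simp)) (h1 l) l
  have d2 := fun l => ((ha i).der hι l).der hι l
  have e1 : synth m ι (rhsHat m ι ν a i) x =
      synth m ι (fun g => (ν : ℂ) * ∑ l, der ι l (der ι l (a i)) g) x -
        synth m ι (advect m ι a (a i)) x :=
    synth_sub hι (((Decay.sum hι Finset.univ fun l _ => d2 l).mul_const hι (ν : ℂ)).integrable hG ())
      ((Decay.advect hG ha (ha i)).integrable hG ()) x
  have e2 : synth m ι (advect m ι a (a i)) x =
      ∑ l, synth m ι (a l) x * synth m ι (der ι l (a i)) x := by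
    have e3 : synth m ι (advect m ι a (a i)) x = ∑ l, synth m ι (conv m (a l) (der ι l (a i))) x :=
      synth_sum hι _ (fun l _ => (Decay.conv hG (ha l) ((ha i).der hι l)).integrable hG ()) x
    rw [e3]
    refine Finset.sum_congr rfl fun l _ => ?_
    exact synth_conv hι ((ha l).meas ()) (((ha i).der hι l).meas ()) ((ha l).integrable hG ())
      (((ha i).der hι l).integrable hG ()) x
  rw [e1, e2, synth_const_mul, synth_sum hι _ fun l _ => (d2 l).integrable hG (), rhs]
  push_cast
  simp only [h2, h1, h]

theorem vort_eq_synth (hG : IsFreq m ι) {f : Fin 3 → E3 → ℝ} (hf : ∀ i, ContDiff ℝ ∞ (f i))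
    {a : Fin 3 → G → ℂ} (ha : ∀ i, Decay m ι fun _ : Unit => a i)
    (h : ∀ i x, (f i x : ℂ) = synth m ι (a i) x) (i j : Fin 3) (x : E3) :
    ((pd i (f j) x - pd j (f i) x : ℝ) : ℂ) = synth m ι (vortHat ι a i j) x := by
  have hι := hG.meas
  have h1 : ∀ k l x, (pd l (f k) x : ℂ) = synth m ι (der ι l (a k)) x := fun k l =>
    pd_eq_synth hG (ha k) ((hf k).differentiable (by simp)) (h k) l
  rw [Complex.ofReal_sub, h1, h1]
  exact (synth_sub hι (((ha j).der hι i).integrable hG ()) (((ha i).der hι j).integrable hG ()) x).symm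

end Hat

end

section

open scoped ENNReal NNReal ComplexConjugate InnerProductSpace

/-! ### The evolution of the weighted energy -/

section Evolution

variable {G : Type*} [AddCommGroup G] [MeasurableSpace G] {m : Measure G} {ι : G →+ E3}
  {Ω : SpatialDomain} {c ν T : ℝ} {ψ : E3 → ℝ} {u₀ : E3 → E3} {u : ℝ → E3 → E3} {p : ℝ → E3 → ℝ}
  [MeasurableAdd₂ G] [MeasurableNeg G] [SFinite m] [m.IsAddLeftInvariant] [m.IsNegInvariant]

/-- The transforms of a solution on a compact time interval, extended by constants. -/
theorem IsFourierModel.exists_solution_hat (hM : IsFourierModel Ω m ι c)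
    (hs : IsSmoothSolution Ω ν T u₀ u p) {α β : ℝ} (hα : 0 < α) (hαβ : α ≤ β) (hβ : β < T) :
    ∃ A : Fin 3 → ℝ → G → ℂ, (∀ i, Decay m ι (A i)) ∧ (∀ t, IsVelocity m ι fun i => A i t) ∧
      ∀ t x i, (u (projIcc α β hαβ t) x i : ℂ) = synth m ι (A i t) x := by
  have hmem : ∀ t : Icc α β, (t : ℝ) ∈ Ioo 0 T := fun t => ⟨hα.trans_le t.2.1, t.2.2.trans_lt hβ⟩
  obtain ⟨a, h1, h2, h3⟩ := hM.exists_velocity (v := fun t : Icc α β => u t)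
    (fun t => hs.contDiff (hmem t)) (fun t => hs.velocity_on t (hmem t))
    (fun n => (hs.sobolev n α β hα hβ).imp fun M h t => h t t.2)
    (fun t => hs.incompressible t (hmem t))
  exact ⟨fun i t => a i (projIcc α β hαβ t), fun i => (h1 i).comp _, fun t => h2 _,
    fun t x i => h3 _ x i⟩

/-- The transforms are not known to depend regularly on time, so the derivative is taken on the
physical side: Z is the vorticity in L², D its rate, Y the weighted vorticity. Z is weakly
differentiable and Lipschitz, Y only continuous, and the pairing is symmetric. -/
theorem IsFourierModel.hasDerivAt_pairing (hM : IsFourierModel Ω m ι c) (hψ : IsCutoff ψ)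
    (hs : IsSmoothSolution Ω ν T u₀ u p) {α β : ℝ} (hα : 0 < α) (hαβ : α ≤ β) (hβ : β < T)
    {A : Fin 3 → ℝ → G → ℂ} (hA : ∀ i, Decay m ι (A i))
    (hu : ∀ t x i, (u (projIcc α β hαβ t) x i : ℂ) = synth m ι (A i t) x) {s : ℝ}
    (hsαβ : s ∈ Ioo α β) (i j : Fin 3) :
    HasDerivAt (fun t => c * ∫ g, (vortHat ι (fun i => A i t) i j g *
        conj ((pot ψ (ι g) : ℂ) * vortHat ι (fun i => A i t) i j g)).re ∂m)
      (2 * (c * ∫ g, (vortHat ι (rhsHat m ι ν fun i => A i s) i j g *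
        conj ((pot ψ (ι g) : ℂ) * vortHat ι (fun i => A i s) i j g)).re ∂m)) s := by
  have hι := hM.freq.meas
  have hmem : ∀ t, (projIcc α β hαβ t : ℝ) ∈ Ioo 0 T := fun t =>
    ⟨hα.trans_le (projIcc α β hαβ t).2.1, (projIcc α β hαβ t).2.2.trans_lt hβ⟩
  have hω : Decay m ι fun t => vortHat ι (fun i => A i t) i j := Decay.vortHat hι hA i j
  have hF := Decay.rhsHat hM.freq hA ν
  have hdω : Decay m ι fun t => vortHat ι (rhsHat m ι ν fun i => A i t) i j :=
    Decay.vortHat hι hF i j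
  have hωsyn : ∀ t x, (vort (u (projIcc α β hαβ t)) i j x : ℂ) =
      synth m ι (vortHat ι (fun i => A i t) i j) x := fun t x =>
    vort_eq_synth hM.freq (contDiff_comp_coord (hs.contDiff (hmem t)))
      (fun i => (hA i).single t) (fun i x => hu t x i) i j x
  have hdωsyn : ∀ t x, (vortRate ν (u (projIcc α β hαβ t)) i j x : ℂ) =
      synth m ι (vortHat ι (rhsHat m ι ν fun i => A i t) i j) x := fun t x =>
    vort_eq_synth hM.freq (contDiff_rhs (hs.contDiff (hmem t)) ν)
      (fun i => (hF i).single t)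
      (fun i x => rhs_eq_synth hM.freq (hs.contDiff (hmem t)) (fun i => (hA i).single t)
        (fun x i => hu t x i) ν i x) i j x
  have hωr : ∀ t x, (synth m ι (vortHat ι (fun i => A i t) i j) x).im = 0 := fun t x => by
    rw [← hωsyn, Complex.ofReal_im]
  have hdωr : ∀ t x, (synth m ι (vortHat ι (rhsHat m ι ν fun i => A i t) i j) x).im = 0 :=
    fun t x => by rw [← hdωsyn, Complex.ofReal_im]
  set Z : ℝ → Lp ℝ 2 Ω.vol := fun t => hM.reElem (hω.single t) with hZ
  set D : ℝ → Lp ℝ 2 Ω.vol := fun t => hM.reElem (hdω.single t) with hD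
  set Y : ℝ → Lp ℝ 2 Ω.vol := fun t => hM.reElem ((hω.single t).pot_mul hψ hι) with hY
  have hZY : ∀ t r, ⟪Z t, Y r⟫_ℝ = c * ∫ g, (vortHat ι (fun i => A i t) i j g *
      conj ((pot ψ (ι g) : ℂ) * vortHat ι (fun i => A i r) i j g)).re ∂m := fun t r =>
    hM.inner_reElem _ _ (hωr t)
  have hDY : ∀ t r, ⟪D t, Y r⟫_ℝ = c * ∫ g, (vortHat ι (rhsHat m ι ν fun i => A i t) i j g *
      conj ((pot ψ (ι g) : ℂ) * vortHat ι (fun i => A i r) i j g)).re ∂m := fun t r =>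
    hM.inner_reElem _ _ (hdωr t)
  obtain ⟨M0, hM0⟩ := hdω.bound 0
  have hDb : ∀ t, ‖D t‖ ≤ Real.sqrt (c * M0) := by
    intro t
    refine Real.le_sqrt_of_sq_le ((hM.norm_reElem_sq_le (hdω.single t)).trans ?_)
    have hc := hM.pos
    gcongr
    rw [← ENNReal.ofReal_le_ofReal_iff (by positivity), (hdω.single t).ofReal_integral_norm_sq,
      ENNReal.ofReal_coe_nnreal]
    simpa using hM0 t
  -- A smaller interval about s, inside the open interval on which the extension by constants is the
  -- solution itself.
  set α' := (α + s) / 2 with hα'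
  set β' := (s + β) / 2 with hβ'
  obtain ⟨hs1, hs2⟩ := hsαβ
  have hweak : ∀ y ∈ testVectors Ω.vol, ∀ t ∈ Icc α' β',
      HasDerivAt (fun t => ⟪Z t, y⟫_ℝ) ⟪D t, y⟫_ℝ t := by
    rintro y ⟨h, hm, hc, hsupp, rfl⟩ t ⟨ht1, ht2⟩
    have htαβ : t ∈ Ioo α β := ⟨by linarith, by linarith⟩
    have hpt : ∀ r ∈ Ioo α β, (projIcc α β hαβ r : ℝ) = r := fun r hr => by
      rw [projIcc_of_mem hαβ (Ioo_subset_Icc_self hr)]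
    have htT : t ∈ Ioo 0 T := by rw [← hpt t htαβ]; exact hmem t
    have h1 := hasDerivAt_integral_mul_of_hasCompactSupport (μ := Ω.vol)
      (z := fun t => vort (u t) i j) (zdot := fun t => vortRate ν (u t) i j)
      (fun t ht x => hs.hasDerivAt_vort ht i j x)
      (fun t ht => by
        have h0 := contDiff_comp_coord (hs.contDiff ht)
        exact ((contDiff_pd (h0 j) i).sub (contDiff_pd (h0 i) j)).continuous)
      (hs.continuousOn_vortRate i j) hc hsupp htT
    have e1 : ⟪D t, hm.toLp h⟫_ℝ = ∫ x, vortRate ν (u t) i j x * h x ∂Ω.vol := by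
      refine (inner_toLp (hM.memLp_re_synth (hdω.single t)) hm).trans ?_
      refine integral_congr_ae (ae_of_all _ fun x => ?_)
      simp only
      rw [← hdωsyn, Complex.ofReal_re, hpt t htαβ]
    rw [e1]
    refine h1.congr_of_eventuallyEq ?_
    filter_upwards [isOpen_Ioo.mem_nhds htαβ] with r hr
    refine (inner_toLp (hM.memLp_re_synth (hω.single r)) hm).trans ?_
    refine integral_congr_ae (ae_of_all _ fun x => ?_)
    simp only
    rw [← hωsyn, Complex.ofReal_re, hpt r hr]
  have hLip : ∀ t ∈ Icc α' β', ‖Z t - Z s‖ ≤ Real.sqrt (c * M0) * |t - s| := fun t ht =>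
    norm_sub_le_of_weak_deriv dense_testVectors (Real.sqrt_nonneg _) (fun t _ => hDb t) hweak
      ⟨by linarith, by linarith⟩ ht
  have hnhds : Icc α' β' ∈ 𝓝 s := Icc_mem_nhds (by linarith) (by linarith)
  have hd : HasDerivAt (fun t => ⟪Z t, Y s⟫_ℝ) ⟪D s, Y s⟫_ℝ s :=
    hasDerivAt_inner_of_dense dense_testVectors (Real.sqrt_nonneg _) (fun t _ => hDb t) hweak
      ⟨by linarith, by linarith⟩ (Y s)
  -- The multiplier is unbounded, so continuity of Z is not enough by itself. Interpolation against
  -- the uniform fourth moment of the increments gives ‖Y t - Y s‖⁴ ≤ K‖Z t - Z s‖².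
  have hYc : Tendsto Y (𝓝 s) (𝓝 (Y s)) := by
    have hΔ : Decay m ι fun t g => vortHat ι (fun i => A i t) i j g -
        vortHat ι (fun i => A i s) i j g := hω.sub hι (hω.comp fun _ => s)
    obtain ⟨K, hK⟩ := hM.exists_norm_reElem_pot_le hψ hΔ fun t x => by
      rw [synth_sub hι (hω.integrable hM.freq t) (hω.integrable hM.freq s), Complex.sub_im, hωr,
        hωr, sub_zero]
    have e1 : ∀ t, hM.reElem (hΔ.single t) = Z t - Z s := fun t =>
      (hM.reElem_sub (hω.single t) (hω.single s)).symm
    have e2 : ∀ t, ‖hM.reElem ((hΔ.single t).pot_mul hψ hι)‖ = ‖Y t - Y s‖ := fun t => by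
      rw [hY]
      simp only
      rw [hM.reElem_sub ((hω.single t).pot_mul hψ hι) ((hω.single s).pot_mul hψ hι)]
      simp only [mul_sub]
    rw [tendsto_iff_norm_sub_tendsto_zero]
    have hbd : ∀ᶠ t in 𝓝 s, ‖Y t - Y s‖ ^ 4 ≤ |K| * (Real.sqrt (c * M0) * |t - s|) ^ 2 := by
      filter_upwards [hnhds] with t ht
      have h1 := hK t
      rw [e1, e2] at h1
      refine h1.trans ?_
      gcongr
      · exact le_abs_self K
      · exact hLip t ht
    have hz : Tendsto (fun t => |K| * (Real.sqrt (c * M0) * |t - s|) ^ 2) (𝓝 s) (𝓝 0) := by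
      have : Continuous fun t => |K| * (Real.sqrt (c * M0) * |t - s|) ^ 2 := by fun_prop
      simpa using this.tendsto s
    have h4 : Tendsto (fun t => ‖Y t - Y s‖ ^ 4) (𝓝 s) (𝓝 0) :=
      squeeze_zero' (Eventually.of_forall fun t => by positivity) hbd hz
    -- The fourth root is taken as two square roots.
    have h5 := ((Real.continuous_sqrt.comp Real.continuous_sqrt).tendsto 0).comp h4
    simp only [Function.comp_apply, Real.sqrt_zero] at h5
    refine h5.congr fun t => ?_
    simp only [Function.comp_apply]
    rw [show ‖Y t - Y s‖ ^ 4 = (‖Y t - Y s‖ ^ 2) ^ 2 by ring, Real.sqrt_sq (by positivity),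
      Real.sqrt_sq (norm_nonneg _)]
  have hfin := hasDerivAt_inner_of_symm (Y := Y) (M := Real.sqrt (c * M0)) ?_
    (Filter.eventually_of_mem hnhds hLip) hd hYc
  · rw [hDY] at hfin
    exact hfin.congr_of_eventuallyEq (Eventually.of_forall fun t => (hZY t t).symm)
  -- Symmetry holds because the multiplier is real: Re(z · conj(r w)) = Re(w · conj(r z)).
  · refine Eventually.of_forall fun t => ?_
    rw [hZY, hZY]
    congr 1
    refine integral_congr_ae (ae_of_all _ fun g => ?_)
    simp only [map_mul, Complex.conj_ofReal, Complex.mul_re, Complex.mul_im, Complex.ofReal_re,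
      Complex.ofReal_im, Complex.conj_re, Complex.conj_im]
    ring

end Evolution

end

section

open scoped ENNReal NNReal ComplexConjugate InnerProductSpace

/-! ### The differential inequality on a domain with a Fourier model -/

section Inequality

variable {G : Type*} [AddCommGroup G] [MeasurableSpace G] {m : Measure G} {ι : G →+ E3}
  {Ω : SpatialDomain} {c : ℝ} {ψ : E3 → ℝ}

theorem Decay.phiq_mul {τ : Type*} (hψ : IsCutoff ψ) (hι : Measurable ι) {a : τ → G → ℂ}
    (ha : Decay m ι a) (q : ℤ) : Decay m ι fun t g => (phiq ψ q (ι g) : ℂ) * a t g := by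
  obtain ⟨L, hL, hL1, -⟩ := hψ.exists_bound
  have hm := measurable_phiq hψ hι q
  refine Decay.of_norm_le hι (C := L.toNNReal) (k := 0) ha (fun t => ?_) fun t g => ?_
  · have := ha.meas t
    fun_prop
  · rw [enorm_mul]
    gcongr
    have h1 : ‖(phiq ψ q (ι g) : ℂ)‖ ≤ L := by
      rw [Complex.norm_real]; exact hL1 _ _
    calc _ = ENNReal.ofReal ‖(phiq ψ q (ι g) : ℂ)‖ := (ofReal_norm _).symm
      _ ≤ ENNReal.ofReal L := ENNReal.ofReal_le_ofReal h1
      _ = L.toNNReal * 1 := by rw [mul_one]; rfl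
      _ ≤ _ := by gcongr; exact le_self_add

/-- The Littlewood-Paley pieces of a field, on the frequency side. -/
theorem IsFourierModel.memLp_lpPiece (hM : IsFourierModel Ω m ι c) (hψ : IsCutoff ψ) {v : E3 → E3}
    {a : Fin 3 → G → ℂ} (ha : IsVelocity m ι a) (hv : ∀ x i, (v x i : ℂ) = synth m ι (a i) x)
    (q : ℤ) :
    MemLp (lpPiece Ω ψ q v) 2 Ω.vol ∧ shell Ω ψ v q = c * shellHat m ι ψ a q := by
  have hι := hM.freq.meas
  have hd : ∀ i, Decay m ι fun _ : Unit => fun g => (phiq ψ q (ι g) : ℂ) * a i g := fun i =>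
    (ha.decay i).phiq_mul hψ hι q
  have hlp : ∀ x i, lpPiece Ω ψ q v x i = synth m ι (fun g => (phiq ψ q (ι g) : ℂ) * a i g) x :=
    fun x i => hM.lp ψ hψ q (fun z => v z i) (a i) ((ha.decay i).meas ())
      ((ha.decay i).integrable hM.freq ()) (fun x => hv x i) x
  have hmem : ∀ i, MemLp (fun x => lpPiece Ω ψ q v x i) 2 Ω.vol := fun i => by
    simp only [hlp]
    exact hM.memLp_synth (hd i)
  refine ⟨memLp_piLp_iff.2 hmem, ?_⟩
  have e1 : ∀ x, ‖lpPiece Ω ψ q v x‖ ^ 2 =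
      ∑ i, ‖synth m ι (fun g => (phiq ψ q (ι g) : ℂ) * a i g) x‖ ^ 2 := fun x => by
    rw [EuclideanSpace.norm_sq_eq]
    simp only [hlp]
  have e2 : ∀ g, phiq ψ q (ι g) ^ 2 * (amp a g : ℝ) ^ 2 =
      ∑ i, ‖(phiq ψ q (ι g) : ℂ) * a i g‖ ^ 2 := fun g => by
    rw [amp_sq, Finset.mul_sum]
    refine Finset.sum_congr rfl fun i _ => ?_
    rw [norm_mul, mul_pow, Complex.norm_real, Real.norm_eq_abs, sq_abs]
  have i1 := fun i => (memLp_two_iff_integrable_sq_norm (hM.memLp_synth (hd i)).1).1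
    (hM.memLp_synth (hd i))
  have i2 := fun i => (memLp_two_iff_integrable_sq_norm ((hd i).memLp_two ()).1).1
    ((hd i).memLp_two ())
  rw [shell, shellHat]
  simp only [e1, e2]
  rw [integral_finsetSum _ fun i _ => i1 i, integral_finsetSum _ fun i _ => i2 i, Finset.mul_sum,
    Finset.mul_sum, Finset.mul_sum]
  refine Finset.sum_congr rfl fun i _ => ?_
  rw [hM.integral_norm_sq_synth (hd i)]
  ring

/-- With F = a this expresses the energy through the vorticity; with F the transform of the
right-hand side it converts the derivative back to the velocity. -/
theorem sum_integral_vortHat (hψ : IsCutoff ψ) (hι : Measurable ι)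
    {a F : Fin 3 → G → ℂ} (ha : IsVelocity m ι a) (hF : ∀ i, Decay m ι fun _ : Unit => F i) :
    ∑ i, ∑ j, ∫ g, (vortHat ι F i j g * conj ((pot ψ (ι g) : ℂ) * vortHat ι a i j g)).re ∂m =
      2 * ∫ g, weight ψ (ι g) * (∑ i, F i g * conj (a i g)).re ∂m := by
  have hint : ∀ i j, Integrable
      (fun g => (vortHat ι F i j g * conj ((pot ψ (ι g) : ℂ) * vortHat ι a i j g)).re) m :=
    fun i j => ((Decay.vortHat hι hF i j).integrable_mul_conj
      ((Decay.vortHat hι ha.decay i j).pot_mul hψ hι)).re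
  simp only [← integral_finsetSum _ fun j _ => hint _ j]
  rw [← integral_finsetSum _ fun i _ => integrable_finsetSum _ fun j _ => hint i j,
    ← integral_const_mul]
  exact integral_congr_ae (ae_of_all _ fun g => sum_vortHat_mul_conj_pot F a (ha.div g))

variable [MeasurableAdd₂ G] [MeasurableNeg G] [SFinite m] [m.IsAddLeftInvariant] [m.IsNegInvariant]

theorem integral_weight_rhsHat (hψ : IsCutoff ψ) (hG : IsFreq m ι) {a : Fin 3 → G → ℂ}
    (ha : IsVelocity m ι a) (ν : ℝ) :
    ∫ g, weight ψ (ι g) * (∑ i, rhsHat m ι ν a i g * conj (a i g)).re ∂m =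
      -ν * ∫ g, weight ψ (ι g) * (‖ι g‖ ^ 2 * (amp a g : ℝ) ^ 2) ∂m -
        ∫ g, weight ψ (ι g) * (∑ i, advect m ι a (a i) g * conj (a i g)).re ∂m := by
  have hι := hG.meas
  have h1 := ha.integrable_weight_amp_sq hψ hι 2
  have h2 : Integrable
      (fun g => weight ψ (ι g) * (∑ i, advect m ι a (a i) g * conj (a i g)).re) m := by
    have h3 : Integrable (fun g => (∑ i, advect m ι a (a i) g *
        conj ((weight ψ (ι g) : ℂ) * a i g)).re) m :=
      (integrable_finsetSum Finset.univ fun i _ =>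
        (Decay.advect (a := fun i _ => a i) hG ha.decay (ha.decay i)).integrable_mul_conj
        ((ha.decay i).weight_mul hψ hι)).re
    refine h3.congr (ae_of_all _ fun g => ?_)
    simp only
    rw [← Complex.re_ofReal_mul, Finset.mul_sum]
    congr 1
    refine Finset.sum_congr rfl fun i _ => ?_
    rw [map_mul, Complex.conj_ofReal]
    ring
  rw [← integral_const_mul, ← integral_sub (h1.const_mul _) h2]
  refine integral_congr_ae (ae_of_all _ fun g => ?_)
  simp only [sum_rhsHat_mul_conj]
  ring

/-- Near t the sum of the shells is half the sum of the nine vorticity pairings. Their derivatives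
recombine into the weighted pairing of the right-hand side with the velocity, where viscosity
supplies the dissipation that absorbs the flux. -/
theorem IsFourierModel.exists_energy_inequality (hM : IsFourierModel Ω m ι c) (hψ : IsCutoff ψ) :
    ∃ C : ℝ, 0 < C ∧ ∀ (ν T : ℝ) (u₀ : E3 → E3) (u : ℝ → E3 → E3) (p : ℝ → E3 → ℝ),
      0 < ν → IsSmoothSolution Ω ν T u₀ u p → ∀ t ∈ Ioo 0 T,
        (∀ q : ℤ, MemLp (lpPiece Ω ψ q (u t)) 2 Ω.vol) ∧
        Summable (fun q : ℤ => shell Ω ψ (u t) q) ∧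
        Summable (fun q : ℤ => shell Ω ψ (u t) q ^ 2) ∧
        (∀ q : ℤ, 0 ≤ shell Ω ψ (u t) q) ∧
        DifferentiableAt ℝ (fun s => ∑' q : ℤ, shell Ω ψ (u s) q) t ∧
        deriv (fun s => ∑' q : ℤ, shell Ω ψ (u s) q) t
          ≤ C * ν⁻¹ * ∑' q : ℤ, shell Ω ψ (u t) q ^ 2 := by
  obtain ⟨C, hC, hbound⟩ := exists_abs_trilinear_le (m := m) hψ hM.freq
  have hc := hM.pos
  have hι := hM.freq.meas
  -- A shell is c times its frequency-side counterpart, so 2cC ∑ (frequency-side shell)² equals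
  -- (2C/c) ∑ (shell)².
  refine ⟨2 * C / c, by positivity, fun ν T u₀ u p hν hs t ht => ?_⟩
  obtain ⟨ht1, ht2⟩ := ht
  -- A compact interval around t inside (0, T), on which all Sobolev norms are uniformly bounded.
  have hα : 0 < t / 2 := by linarith
  have hαβ : t / 2 ≤ (t + T) / 2 := by linarith
  have hβ : (t + T) / 2 < T := by linarith
  have htm : t ∈ Ioo (t / 2) ((t + T) / 2) := ⟨by linarith, by linarith⟩
  obtain ⟨A, hA, hvel, hu⟩ := hM.exists_solution_hat hs hα hαβ hβ
  have hpt : ∀ r ∈ Ioo (t / 2) ((t + T) / 2), (projIcc _ _ hαβ r : ℝ) = r := fun r hr => by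
    rw [projIcc_of_mem hαβ (Ioo_subset_Icc_self hr)]
  have hpiece := fun r q => hM.memLp_lpPiece hψ (hvel r) (hu r) q
  have hshell : ∀ r ∈ Ioo (t / 2) ((t + T) / 2), ∀ q,
      shell Ω ψ (u r) q = c * shellHat m ι ψ (fun i => A i r) q := fun r hr q => by
    have h := (hpiece r q).2
    rwa [hpt r hr] at h
  have hsum := fun r => hasSum_shellHat hψ hι (hvel r)
  have henergy : ∀ r ∈ Ioo (t / 2) ((t + T) / 2), ∑' q, shell Ω ψ (u r) q =
      2⁻¹ * ∑ i, ∑ j, c * ∫ g, (vortHat ι (fun i => A i r) i j g *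
        conj ((pot ψ (ι g) : ℂ) * vortHat ι (fun i => A i r) i j g)).re ∂m := by
    intro r hr
    simp only [hshell r hr]
    rw [tsum_mul_left, (hsum r).tsum_eq]
    simp only [← Finset.mul_sum]
    rw [sum_integral_vortHat hψ hι (hvel r) (hvel r).decay]
    have e : ∀ g, (∑ i, A i r g * conj (A i r g)).re = (amp (fun i => A i r) g : ℝ) ^ 2 := by
      intro g
      simp only [Complex.mul_conj, Complex.normSq_eq_norm_sq, amp_sq, ← Complex.ofReal_sum,
        Complex.ofReal_re]
    simp only [e]
    ring
  have hderiv : HasDerivAt (fun r => ∑' q, shell Ω ψ (u r) q)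
      (2 * c * ∫ g, weight ψ (ι g) * (∑ i, rhsHat m ι ν (fun i => A i t) i g *
        conj (A i t g)).re ∂m) t := by
    have h1 := (HasDerivAt.fun_sum (u := Finset.univ) fun i _ =>
      HasDerivAt.fun_sum (u := Finset.univ) fun j _ =>
        hM.hasDerivAt_pairing hψ hs hα hαβ hβ hA hu htm i j).const_mul (2⁻¹ : ℝ)
    refine (h1.congr_of_eventuallyEq ?_).congr_deriv ?_
    · filter_upwards [isOpen_Ioo.mem_nhds htm] with r hr
      exact henergy r hr
    · simp only [← Finset.mul_sum]
      rw [sum_integral_vortHat hψ hι (hvel t) fun i =>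
        (Decay.rhsHat hM.freq (fun i => (hA i).single t) ν i)]
      ring
  have hsq : ∀ q, shell Ω ψ (u t) q ^ 2 = c ^ 2 * shellHat m ι ψ (fun i => A i t) q ^ 2 :=
    fun q => by rw [hshell t htm, mul_pow]
  refine ⟨fun q => ?_, ?_, ?_, fun q => ?_, hderiv.differentiableAt, ?_⟩
  · have h := (hpiece t q).1
    rwa [hpt t htm] at h
  · simp only [hshell t htm]
    exact (hsum t).summable.mul_left c
  · simp only [hsq]
    exact (summable_shellHat_sq hψ hι (hvel t)).mul_left _
  · rw [hshell t htm]
    exact mul_nonneg hc.le (shellHat_nonneg q)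
  · rw [hderiv.deriv, integral_weight_rhsHat hψ hM.freq (hvel t) ν]
    simp only [hsq]
    rw [tsum_mul_left]
    -- Only the lower bound for the trilinear term is needed, as it enters with a minus sign; its
    -- dissipative part cancels the viscous term exactly.
    have h1 := (abs_le.1 (hbound ν hν _ (hvel t))).1
    set S := ∑' q, shellHat m ι ψ (fun i => A i t) q ^ 2
    calc _ ≤ 2 * c * (C * ν⁻¹ * S) := by gcongr; linarith
      _ = _ := by field_simp

end Inequality

end

section

open scoped ENNReal NNReal ComplexConjugate Pointwise

/-! ### Periodic functions and the torus -/

section Torus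

attribute [local instance] instMeasureSpaceUnitAddCircle

local instance : Measure.IsAddHaarMeasure (volume : Measure UnitAddCircle) :=
  inferInstanceAs (Measure.IsAddHaarMeasure AddCircle.haarAddCircle)

local instance : IsProbabilityMeasure (volume : Measure UnitAddCircle) :=
  inferInstanceAs (IsProbabilityMeasure AddCircle.haarAddCircle)

/-- The projection of `ℝ³` onto the torus. -/
def toTorus (x : E3) : UnitAddTorus (Fin 3) := fun i => ((x i / (2 * Real.pi) : ℝ) : UnitAddCircle)

theorem toTorus_add (x y : E3) : toTorus (x + y) = toTorus x + toTorus y := by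
  funext i
  simp [toTorus, add_div]

theorem isOpenQuotientMap_toTorus : IsOpenQuotientMap toTorus := by
  have h1 : IsOpenQuotientMap (Pi.map fun (_ : Fin 3) (t : ℝ) => (t : UnitAddCircle)) :=
    IsOpenQuotientMap.piMap fun _ => QuotientAddGroup.isOpenQuotientMap_mk
  have hπ : (2 * Real.pi)⁻¹ ≠ 0 := by positivity
  have h2 : IsOpenQuotientMap fun x : E3 => WithLp.ofLp ((2 * Real.pi)⁻¹ • x) :=
    ((Homeomorph.smulOfNeZero _ hπ).trans
      (PiLp.homeomorph 2 fun _ : Fin 3 => ℝ)).isOpenQuotientMap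
  have h3 := h1.comp h2
  have e : toTorus = (Pi.map fun (_ : Fin 3) (t : ℝ) => (t : UnitAddCircle)) ∘
      fun x : E3 => WithLp.ofLp ((2 * Real.pi)⁻¹ • x) := by
    funext x i
    simp only [toTorus, Function.comp_apply, Pi.map_apply, PiLp.smul_apply, smul_eq_mul]
    rw [div_eq_inv_mul]
  rw [e]
  exact h3

theorem periodic_sum_zsmul {F : Type} {f : E3 → F}
    (hf : SpatialDomain.torus.IsFunctionOn f) (n : Fin 3 → ℤ) (x : E3) :
    f (x + ∑ i, n i • EuclideanSpace.single i (2 * Real.pi)) = f x := by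
  have h : ∀ i, Function.Periodic f (EuclideanSpace.single i (2 * Real.pi)) := fun i x => hf i x
  have h1 := fun i => (h i).zsmul (n i)
  rw [Fin.sum_univ_three, ← add_assoc, ← add_assoc, h1 2, h1 1, h1 0]

/-- Continuous periodic functions are continuous functions on the torus. -/
theorem exists_lift {f : E3 → ℂ} (hc : Continuous f) (hf : SpatialDomain.torus.IsFunctionOn f) :
    ∃ F : C(UnitAddTorus (Fin 3), ℂ), ∀ x, F (toTorus x) = f x := by
  have hq := isOpenQuotientMap_toTorus.isQuotientMap
  have hfac : Function.FactorsThrough f toTorus := by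
    intro x y hxy
    have h1 : ∀ i, ∃ n : ℤ, n • (1 : ℝ) = x i / (2 * Real.pi) - y i / (2 * Real.pi) := fun i => by
      rw [← AddCircle.coe_eq_zero_iff, AddCircle.coe_sub, sub_eq_zero]
      exact congrFun hxy i
    choose n hn using h1
    have e : x = y + ∑ i, n i • EuclideanSpace.single i (2 * Real.pi) := by
      ext j
      have hj := hn j
      rw [zsmul_one, ← sub_div, eq_div_iff Real.two_pi_pos.ne'] at hj
      have h2 : (∑ i, n i • EuclideanSpace.single i (2 * Real.pi) : E3) j = n j * (2 * Real.pi) := by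
        simp [WithLp.ofLp_sum, Finset.sum_apply, Pi.single_apply]
      rw [PiLp.add_apply, h2, hj]
      ring
    rw [e, periodic_sum_zsmul hf]
  refine ⟨hq.lift (f := ⟨toTorus, hq.continuous⟩) ⟨f, hc⟩ hfac, fun x => ?_⟩
  exact DFunLike.congr_fun (hq.lift_comp (f := ⟨toTorus, hq.continuous⟩) ⟨f, hc⟩ hfac) x

theorem mode_eq_mFourier (k : Fin 3 → ℤ) (x : E3) :
    mode k x = UnitAddTorus.mFourier k (toTorus x) := by
  simp only [mode, UnitAddTorus.mFourier, ContinuousMap.coe_mk, toTorus, fourier_coe_apply,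
    ← Complex.exp_sum]
  congr 1
  have : inner ℝ (latticePt k) x = ∑ i, (k i : ℝ) * x i := by
    simp [latticePt, PiLp.inner_apply, mul_comm]
  rw [this]
  push_cast
  rw [Finset.mul_sum]
  refine Finset.sum_congr rfl fun i _ => ?_
  have hπ : (Real.pi : ℂ) ≠ 0 := Complex.ofReal_ne_zero.2 Real.pi_ne_zero
  field_simp

/-- Rescaling by (2π)⁻¹ produces the Jacobian (2π)³, while the torus carries Haar measure of mass
one. The cubes [0, 1)³ and (0, 1]³ differ by a null set. -/
theorem integral_cell {F : Type*} [NormedAddCommGroup F] [NormedSpace ℝ F]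
    (f : UnitAddTorus (Fin 3) → F) :
    ∫ x in SpatialDomain.torus.cell, f (toTorus x) = (2 * Real.pi) ^ 3 • ∫ y, f y := by
  have hπ : (2 * Real.pi)⁻¹ ≠ 0 := by positivity
  have hπ0 : (0 : ℝ) < 2 * Real.pi := by positivity
  set g : E3 → F := fun z => f fun i => ((z i : ℝ) : UnitAddCircle) with hg
  have e1 : ∀ x, f (toTorus x) = g ((2 * Real.pi)⁻¹ • x) := fun x => by
    simp only [hg, PiLp.smul_apply, smul_eq_mul]
    congr 1
    funext i
    rw [toTorus, div_eq_inv_mul]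
  have e2 : (2 * Real.pi)⁻¹ • SpatialDomain.torus.cell =
      WithLp.ofLp ⁻¹' (univ.pi fun _ : Fin 3 => Ico (0 : ℝ) 1) := by
    rw [← Set.preimage_smul_inv₀ hπ, inv_inv]
    ext z
    simp only [SpatialDomain.cell, mem_preimage, mem_ofPred_eq, PiLp.smul_apply, smul_eq_mul, mem_Ico,
      mem_univ_pi]
    refine forall_congr' fun i => and_congr ?_ ?_
    · exact mul_nonneg_iff_of_pos_left hπ0
    · exact mul_lt_iff_lt_one_right hπ0
  simp only [e1]
  rw [Measure.setIntegral_comp_smul volume g _ hπ, e2, UnitAddTorus.integral_preimage f 0]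
  have e3 := (PiLp.volume_preserving_ofLp (Fin 3)).setIntegral_preimage_emb
    (MeasurableEquiv.toLp 2 (Fin 3 → ℝ)).symm.measurableEmbedding
    (fun z => f fun i => ((z i : ℝ) : UnitAddCircle)) (univ.pi fun _ : Fin 3 => Ico (0 : ℝ) 1)
  rw [show ∫ x in WithLp.ofLp ⁻¹' (univ.pi fun _ : Fin 3 => Ico (0 : ℝ) 1), g x = _ from e3]
  have e4 : {x : Fin 3 → ℝ | ∀ i, x i ∈ Ioc ((0 : Fin 3 → ℝ) i) ((0 : Fin 3 → ℝ) i + 1)} =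
      univ.pi fun _ : Fin 3 => Ioc (0 : ℝ) 1 := by
    ext x; simp
  have e5 : (univ.pi fun _ : Fin 3 => Ico (0 : ℝ) 1) =ᵐ[volume]
      univ.pi fun _ : Fin 3 => Ioc (0 : ℝ) 1 :=
    (Measure.univ_pi_Ico_ae_eq_Icc (μ := fun _ : Fin 3 => (volume : Measure ℝ))
      (f := fun _ => 0) (g := fun _ => 1)).trans
    (Measure.univ_pi_Ioc_ae_eq_Icc (μ := fun _ : Fin 3 => (volume : Measure ℝ))
      (f := fun _ => 0) (g := fun _ => 1)).symm
  rw [e4, setIntegral_congr_set e5, finrank_euclideanSpace, Fintype.card_fin, inv_pow, inv_inv,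
    abs_of_pos (by positivity)]

/-- Integrals of periodic functions over the cell are invariant under translations. -/
theorem integral_cell_add {f : E3 → ℂ} (hc : Continuous f)
    (hf : SpatialDomain.torus.IsFunctionOn f) (h : E3) :
    ∫ x in SpatialDomain.torus.cell, f (x + h) = ∫ x in SpatialDomain.torus.cell, f x := by
  obtain ⟨F, hF⟩ := exists_lift hc hf
  simp only [← hF, toTorus_add]
  rw [integral_cell fun y => F (y + toTorus h), integral_cell fun y => F y,
    integral_add_right_eq_self]

theorem fourierCoeffTorus_eq {f : E3 → ℝ} {F : C(UnitAddTorus (Fin 3), ℂ)}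
    (hF : ∀ x, F (toTorus x) = f x) (k : Fin 3 → ℤ) :
    fourierCoeffTorus f k = UnitAddTorus.mFourierCoeff F k := by
  have h := integral_cell fun y => UnitAddTorus.mFourier (-k) y • F y
  simp only [hF, ← mode_eq_mFourier] at h
  rw [fourierCoeffTorus, UnitAddTorus.mFourierCoeff]
  have e : ∀ x, (f x : ℂ) * mode (-k) x = mode (-k) x • (f x : ℂ) := fun x => by
    rw [smul_eq_mul, mul_comm]
  simp only [e]
  rw [h, Complex.real_smul, ← mul_assoc, Complex.ofReal_pow, ← mul_pow, inv_mul_cancel₀, one_pow,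
    one_mul]
  exact_mod_cast Real.two_pi_pos.ne'

theorem continuous_mode (k : Fin 3 → ℤ) : Continuous (mode k) := by
  have : mode k = UnitAddTorus.mFourier k ∘ toTorus := funext (mode_eq_mFourier k)
  rw [this]
  exact (UnitAddTorus.mFourier k).continuous.comp isOpenQuotientMap_toTorus.continuous

theorem toTorus_single (i : Fin 3) : toTorus (EuclideanSpace.single i (2 * Real.pi)) = 0 := by
  funext j
  have hπ : 2 * Real.pi ≠ 0 := by positivity
  by_cases h : j = i
  · subst h
    simp only [toTorus, PiLp.single_apply, if_true, div_self hπ, Pi.zero_apply]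
    exact AddCircle.coe_period 1
  · simp [toTorus, h]

theorem isFunctionOn_comp_toTorus {F : Type} (f : UnitAddTorus (Fin 3) → F) :
    SpatialDomain.torus.IsFunctionOn fun x => f (toTorus x) := fun i x => by
  simp only [toTorus_add, toTorus_single, add_zero]

theorem isFunctionOn_mode (k : Fin 3 → ℤ) : SpatialDomain.torus.IsFunctionOn (mode k) := by
  have : mode k = fun x => UnitAddTorus.mFourier k (toTorus x) := funext (mode_eq_mFourier k)
  rw [this]
  exact isFunctionOn_comp_toTorus _

/-- The frequency map of the torus. -/
def latticeHom : (Fin 3 → ℤ) →+ E3 where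
  toFun := latticePt
  map_zero' := by ext i; simp [latticePt]
  map_add' k l := by ext i; simp [latticePt]

theorem synth_latticeHom {a : (Fin 3 → ℤ) → ℂ} (ha : Integrable a Measure.count) (x : E3) :
    synth Measure.count latticeHom a x = ∑' k, a k * mode k x := by
  have h1 : Integrable (fun k => a k * mode k x) Measure.count :=
    integrable_synth (ι := latticeHom) (measurable_of_countable _) ha x
  unfold synth
  refine (integral_countable h1).trans ?_
  simp [Measure.real]

/-- The function on the torus with given absolutely summable Fourier coefficients. -/
theorem exists_torus_synth {a : (Fin 3 → ℤ) → ℂ} (ha : Integrable a Measure.count) :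
    ∃ F : C(UnitAddTorus (Fin 3), ℂ), (∀ x, F (toTorus x) = synth Measure.count latticeHom a x) ∧
      ∀ k, UnitAddTorus.mFourierCoeff F k = a k := by
  have hs : Summable fun k => ‖a k‖ := integrable_count_iff.1 ha
  have hs' : Summable fun k => a k • UnitAddTorus.mFourier k := by
    refine Summable.of_norm ?_
    simpa only [norm_smul, UnitAddTorus.mFourier_norm, mul_one] using hs
  refine ⟨∑' k, a k • UnitAddTorus.mFourier k, fun x => ?_, fun k => ?_⟩
  · rw [synth_latticeHom ha]
    have h := (ContinuousMap.evalCLM ℂ (toTorus x)).hasSum hs'.hasSum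
    simp only [map_smul] at h
    refine h.tsum_eq.symm.trans (tsum_congr fun k => ?_)
    rw [mode_eq_mFourier]; rfl
  -- The series converges in L² as well, so each coefficient is read off by pairing with an
  -- orthonormal mode.
  · rw [← UnitAddTorus.mFourierCoeff_toLp, ← UnitAddTorus.mFourierBasis_repr,
      HilbertBasis.repr_apply_apply, UnitAddTorus.coe_mFourierBasis]
    have h := ((ContinuousMap.toLp (E := ℂ) 2 volume ℂ).hasSum hs'.hasSum).mapL
      (innerSL ℂ (UnitAddTorus.mFourierLp 2 k))
    simp only [map_smul, innerSL_apply_apply] at h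
    refine h.unique ?_
    have e : ∀ l, a l • inner ℂ (UnitAddTorus.mFourierLp (d := Fin 3) 2 k)
        (ContinuousMap.toLp 2 volume ℂ (UnitAddTorus.mFourier l)) = if l = k then a k else 0 := by
      intro l
      have := orthonormal_iff_ite.1 (UnitAddTorus.orthonormal_mFourier (d := Fin 3)) k l
      rw [show ContinuousMap.toLp 2 volume ℂ (UnitAddTorus.mFourier l) =
        UnitAddTorus.mFourierLp (d := Fin 3) 2 l from rfl, this]
      by_cases h : l = k
      · simp [h]
      · simp [h, Ne.symm h]
    simp only [e]
    exact hasSum_ite_eq k (a k)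

/-- Parseval's identity for continuous functions on the torus. -/
theorem hasSum_sq_mFourierCoeff_continuous (F : C(UnitAddTorus (Fin 3), ℂ)) :
    HasSum (fun k => ‖UnitAddTorus.mFourierCoeff F k‖ ^ 2) (∫ y, ‖F y‖ ^ 2) := by
  have h := UnitAddTorus.hasSum_sq_mFourierCoeff (ContinuousMap.toLp (E := ℂ) 2 volume ℂ F)
  simp only [UnitAddTorus.mFourierCoeff_toLp] at h
  have e : ∫ y, ‖(ContinuousMap.toLp (E := ℂ) 2 volume ℂ F) y‖ ^ 2 = ∫ y, ‖F y‖ ^ 2 := by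
    refine integral_congr_ae ?_
    filter_upwards [ContinuousMap.coeFn_toLp (p := 2) (𝕜 := ℂ) volume F] with y hy
    rw [hy]
  rwa [e] at h

theorem volume_torus_cell_lt_top : SpatialDomain.torus.vol univ < ⊤ := by
  rw [SpatialDomain.vol, Measure.restrict_apply_univ]
  refine (measure_mono (t := Metric.closedBall (0 : E3) (6 * Real.pi)) fun x hx => ?_).trans_lt
    (isCompact_closedBall _ _).measure_lt_top
  rw [mem_closedBall_zero_iff, ← abs_of_nonneg (norm_nonneg x)]
  refine abs_le_of_sq_le_sq ?_ (by positivity)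
  rw [EuclideanSpace.norm_sq_eq]
  have h : ∀ i, ‖x i‖ ^ 2 ≤ (2 * Real.pi) ^ 2 := fun i => by
    have := hx i
    rw [Real.norm_of_nonneg this.1]
    exact pow_le_pow_left₀ this.1 this.2.le 2
  calc _ ≤ ∑ _i : Fin 3, (2 * Real.pi) ^ 2 := Finset.sum_le_sum fun i _ => h i
    _ ≤ _ := by
      rw [Finset.sum_const, Finset.card_univ, Fintype.card_fin, nsmul_eq_mul]
      have := sq_nonneg Real.pi
      push_cast
      linarith

instance : IsFiniteMeasure SpatialDomain.torus.vol := ⟨volume_torus_cell_lt_top⟩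

theorem exists_norm_le_of_periodic {f : E3 → ℂ} (hc : Continuous f)
    (hf : SpatialDomain.torus.IsFunctionOn f) : ∃ B, ∀ x, ‖f x‖ ≤ B := by
  obtain ⟨F, hF⟩ := exists_lift hc hf
  exact ⟨‖F‖, fun x => by rw [← hF]; exact F.norm_coe_le_norm _⟩

theorem memLp_two_of_periodic {f : E3 → ℂ} (hc : Continuous f)
    (hf : SpatialDomain.torus.IsFunctionOn f) : MemLp f 2 SpatialDomain.torus.vol := by
  obtain ⟨B, hB⟩ := exists_norm_le_of_periodic hc hf
  exact MemLp.of_bound hc.aestronglyMeasurable B (ae_of_all _ hB)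

theorem integrable_of_periodic {f : E3 → ℂ} (hc : Continuous f)
    (hf : SpatialDomain.torus.IsFunctionOn f) : Integrable f SpatialDomain.torus.vol := by
  obtain ⟨B, hB⟩ := exists_norm_le_of_periodic hc hf
  exact Integrable.of_bound hc.aestronglyMeasurable B (ae_of_all _ hB)

theorem mode_neg_sub (k : Fin 3 → ℤ) (x h : E3) :
    mode (-k) x = mode (-k) (x + h) * Complex.exp (Complex.I * (inner ℝ (latticePt k) h : ℝ)) := by
  have e : latticePt (-k) = -latticePt k := latticeHom.map_neg k
  rw [mode, mode, ← Complex.exp_add, e]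
  congr 1
  simp only [inner_add_right, inner_neg_left]
  push_cast
  ring

/-- The Fourier coefficients of a partial derivative. -/
theorem fourierCoeffTorus_pd {f : E3 → ℝ} (hf : ContDiff ℝ ∞ f)
    (hp : SpatialDomain.torus.IsFunctionOn f) (j : Fin 3) (k : Fin 3 → ℤ) :
    fourierCoeffTorus (pd j f) k = der latticeHom j (fourierCoeffTorus f) k := by
  have hp' := isFunctionOn_pd hp j
  have hc' : Continuous fun x => (pd j f x : ℂ) := by
    have := (contDiff_pd hf j).continuous
    fun_prop
  have hc : Continuous fun x => (f x : ℂ) := by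
    have := hf.continuous
    fun_prop
  obtain ⟨B, hB⟩ := exists_norm_le_of_periodic hc' fun i x => by rw [hp' i x]
  have hm := continuous_mode (-k)
  set e : E3 := EuclideanSpace.single j 1 with he
  -- In place of integration by parts: translating `f` by s e_j multiplies its coefficient by e^{i
  -- k_j s}, and both sides are differentiated at s = 0.
  have h1 : ∀ s : ℝ, ∫ x in SpatialDomain.torus.cell, (f (x + s • e) : ℂ) * mode (-k) x =
      (∫ x in SpatialDomain.torus.cell, (f x : ℂ) * mode (-k) x) *
        Complex.exp (Complex.I * ((k j : ℝ) * s)) := by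
    intro s
    have h2 := integral_cell_add (f := fun x => (f x : ℂ) * mode (-k) x) (by fun_prop)
      (fun i x => by simp only; rw [hp i x, isFunctionOn_mode (-k) i x]) (s • e)
    rw [← h2, ← integral_mul_const]
    refine integral_congr_ae (ae_of_all _ fun x => ?_)
    simp only
    rw [mode_neg_sub k x (s • e)]
    have h3 : inner ℝ (latticePt k) (s • e) = k j * s := by
      rw [inner_smul_right, he, EuclideanSpace.inner_single_right]
      simp [latticePt, mul_comm]
    rw [h3]
    push_cast
    ring
  have h2 : HasDerivAt (fun s : ℝ => ∫ x in SpatialDomain.torus.cell,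
      (f (x + s • e) : ℂ) * mode (-k) x)
      (∫ x in SpatialDomain.torus.cell, (pd j f (x + (0 : ℝ) • e) : ℂ) * mode (-k) x) 0 := by
    refine (hasDerivAt_integral_of_dominated_loc_of_deriv_le (s := univ) (bound := fun _ => B)
      (F := fun s x => (f (x + s • e) : ℂ) * mode (-k) x)
      (F' := fun s x => (pd j f (x + s • e) : ℂ) * mode (-k) x) univ_mem
      (Eventually.of_forall fun s => Continuous.aestronglyMeasurable ?_) ?_
      (Continuous.aestronglyMeasurable ?_) (ae_of_all _ fun x s _ => ?_) ?_
      (ae_of_all _ fun x s _ => ?_)).2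
    · have := hf.continuous
      fun_prop
    · simp only [zero_smul, add_zero]
      exact integrable_of_periodic (by fun_prop)
        (fun i x => by rw [hp i x, isFunctionOn_mode (-k) i x])
    · have := (contDiff_pd hf j).continuous
      fun_prop
    · rw [norm_mul, mode_eq_mFourier]
      have h3 := (UnitAddTorus.mFourier (-k)).norm_coe_le_norm (toTorus x)
      rw [UnitAddTorus.mFourier_norm] at h3
      exact (mul_le_of_le_one_right (norm_nonneg _) h3).trans (hB _)
    · exact integrable_const (μ := SpatialDomain.torus.vol) B
    · refine HasDerivAt.mul_const ?_ _
      have h3 : HasDerivAt (fun s : ℝ => x + s • e) e s := by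
        simpa using ((hasDerivAt_id s).smul_const e).const_add x
      have h4 := (hf.differentiable (by simp) (x + s • e)).hasFDerivAt.comp_hasDerivAt s h3
      exact h4.ofReal_comp
  have h3 : HasDerivAt (fun s : ℝ => (∫ x in SpatialDomain.torus.cell, (f x : ℂ) * mode (-k) x) *
        Complex.exp (Complex.I * ((k j : ℝ) * s)))
      ((∫ x in SpatialDomain.torus.cell, (f x : ℂ) * mode (-k) x) * (Complex.I * (k j : ℝ))) 0 := by
    have h4 : HasDerivAt (fun s : ℝ => Complex.I * ((k j : ℝ) * s)) (Complex.I * (k j : ℝ)) 0 := by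
      have := ((hasDerivAt_id (0 : ℝ)).ofReal_comp.const_mul ((k j : ℝ) : ℂ)).const_mul Complex.I
      simpa using this
    have h5 := h4.cexp.const_mul (∫ x in SpatialDomain.torus.cell, (f x : ℂ) * mode (-k) x)
    simpa using h5
  have h4 := (h2.congr_of_eventuallyEq (Eventually.of_forall fun s => (h1 s).symm)).unique h3
  simp only [zero_smul, add_zero] at h4
  rw [fourierCoeffTorus, h4, der, fourierCoeffTorus]
  change _ = Complex.I * ((k j : ℝ) : ℂ) * _
  ring

/-! ### The Fourier model of the torus -/

theorem one_le_norm_latticePt {k : Fin 3 → ℤ} (hk : k ≠ 0) : 1 ≤ ‖latticePt k‖ := by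
  obtain ⟨i, hi⟩ := Function.ne_iff.1 hk
  refine le_trans ?_ (PiLp.norm_apply_le (latticePt k) i)
  change 1 ≤ |((k i : ℤ) : ℝ)|
  exact_mod_cast Int.one_le_abs hi

/-- Nonzero lattice points have norm at least 1, so there is nothing to count for r < 1. For r ≥ 1 a
cube with (2⌊r⌋ + 1)³ ≤ (3r)³ points contains the set. Omitting the zero frequency is essential for
small r. -/
theorem latticeHom_vol (r : ℝ≥0) :
    Measure.count {k | ‖latticeHom k‖₊ ≠ 0 ∧ ‖latticeHom k‖₊ ≤ r} ≤ (27 : ℝ≥0) * (r : ℝ≥0∞) ^ 3 := by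
  rcases lt_or_ge r 1 with hr | hr
  · have e : {k | ‖latticeHom k‖₊ ≠ 0 ∧ ‖latticeHom k‖₊ ≤ r} = ∅ := by
      refine eq_empty_of_forall_notMem fun k hk => ?_
      have h0 : k ≠ 0 := fun h => hk.1 (by rw [h, map_zero, nnnorm_zero])
      have h1 : (1 : ℝ) ≤ r := (one_le_norm_latticePt h0).trans (NNReal.coe_le_coe.2 hk.2)
      exact absurd (NNReal.coe_le_coe.1 (by simpa using h1) : 1 ≤ r) (not_le.2 hr)
    rw [e, measure_empty]
    exact bot_le
  · set n : ℕ := ⌊r⌋₊ with hn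
    have hsub : {k | ‖latticeHom k‖₊ ≠ 0 ∧ ‖latticeHom k‖₊ ≤ r} ⊆
        (Fintype.piFinset fun _ : Fin 3 => Finset.Icc (-(n : ℤ)) n : Finset (Fin 3 → ℤ)) := by
      intro k hk
      rw [Finset.mem_coe, Fintype.mem_piFinset]
      intro i
      rw [Finset.mem_Icc]
      have h1 : |((k i : ℤ) : ℝ)| ≤ r :=
        (PiLp.norm_apply_le (latticePt k) i).trans (NNReal.coe_le_coe.2 hk.2)
      have h2 : ((k i).natAbs : ℝ≥0) ≤ r := by
        rw [← NNReal.coe_le_coe, NNReal.coe_natCast, Nat.cast_natAbs]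
        exact_mod_cast h1
      have h3 : (k i).natAbs ≤ n := Nat.le_floor h2
      omega
    refine (measure_mono hsub).trans ?_
    rw [Measure.count_apply_finset, Fintype.card_piFinset]
    simp only [Int.card_Icc, Finset.prod_const, Finset.card_univ, Fintype.card_fin]
    have h1 : ((n : ℤ) + 1 - -(n : ℤ)).toNat = 2 * n + 1 := by omega
    have h2 : (n : ℝ≥0) ≤ r := Nat.floor_le bot_le
    rw [h1]
    have h3 : (((2 * n + 1) ^ 3 : ℕ) : ℝ≥0) ≤ 27 * r ^ 3 := by
      push_cast
      calc (2 * (n : ℝ≥0) + 1) ^ 3 ≤ (2 * r + r) ^ 3 := by gcongr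
        _ = _ := by ring
    exact_mod_cast h3

/-- Comparison with ∑ |k|⁻⁴, which converges because the lattice has rank 3 < 4. -/
theorem latticeHom_inv_sq :
    ∫⁻ k, ((1 + ‖latticeHom k‖ₑ ^ 2)⁻¹) ^ 2 ∂(Measure.count : Measure (Fin 3 → ℤ)) < ⊤ := by
  set B := (EuclideanSpace.basisFun (Fin 3) ℝ).toBasis with hB
  set b := B.restrictScalars ℤ with hb
  have hfin : Module.finrank ℤ (Submodule.span ℤ (range B)) = 3 := by
    rw [Module.finrank_eq_card_basis b, Fintype.card_fin]
  have hs := ZLattice.summable_norm_pow_inv (Submodule.span ℤ (range B)) 4 (by rw [hfin]; norm_num)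
  have hs2 := hs.comp_injective b.equivFun.symm.injective
  have e : ∀ k : Fin 3 → ℤ, ‖b.equivFun.symm k‖ = ‖latticePt k‖ := by
    intro k
    have : ((b.equivFun.symm k : Submodule.span ℤ (range B)) : E3) = latticePt k := by
      rw [Module.Basis.equivFun_symm_apply]
      push_cast
      ext j
      simp [hb, hB, latticePt, Pi.single_apply]
    rw [← this]; rfl
  have hs3 : Summable fun k : Fin 3 → ℤ => ‖latticePt k‖⁻¹ ^ 4 := by
    refine hs2.congr fun k => ?_
    simp only [Function.comp_apply, e]
  have hs4 : Summable fun k : Fin 3 → ℤ => ((1 + ‖latticePt k‖ ^ 2)⁻¹) ^ 2 := by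
    -- The comparison fails only at k = 0, where the inverse of the norm is 0 by convention.
    refine Summable.of_norm_bounded_eventually hs3 ?_
    refine (Set.finite_singleton (0 : Fin 3 → ℤ)).subset fun k hk => ?_
    by_contra h0
    refine hk ?_
    have h1 := one_le_norm_latticePt h0
    rw [mem_ofPred_eq, Real.norm_of_nonneg (by positivity), inv_pow, inv_pow]
    refine inv_anti₀ (by positivity) ?_
    nlinarith [sq_nonneg (‖latticePt k‖)]
  rw [lintegral_count]
  have e2 : ∀ k : Fin 3 → ℤ, ((1 + ‖latticeHom k‖ₑ ^ 2)⁻¹) ^ 2 =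
      ENNReal.ofReal (((1 + ‖latticePt k‖ ^ 2)⁻¹) ^ 2) := by
    intro k
    rw [ENNReal.ofReal_pow (by positivity), ENNReal.ofReal_inv_of_pos (by positivity),
      ENNReal.ofReal_add zero_le_one (by positivity), ENNReal.ofReal_one,
      ENNReal.ofReal_pow (norm_nonneg _), ofReal_norm]
    rfl
  simp only [e2]
  rw [← ENNReal.ofReal_tsum_of_nonneg (fun k => by positivity) hs4]
  exact ENNReal.ofReal_lt_top

/-- Parseval holds for Haar measure of mass one, so passing to Lebesgue measure on the cell makes
the Plancherel constant the volume (2π)³. Coefficients of an absolutely convergent series are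
unique, which makes the Littlewood-Paley piece a multiplier. -/
theorem isFourierModel_torus :
    IsFourierModel SpatialDomain.torus (Measure.count : Measure (Fin 3 → ℤ)) latticeHom
      ((2 * Real.pi) ^ 3) where
  freq := ⟨measurable_of_countable _, ⟨27, latticeHom_vol⟩, latticeHom_inv_sq⟩
  pos := by positivity
  plancherel a _ ha ha2 := by
    obtain ⟨F, hF, hFa⟩ := exists_torus_synth ha
    have e : synth Measure.count latticeHom a = fun x => F (toTorus x) := funext fun x => (hF x).symm
    refine ⟨?_, ?_⟩
    · rw [e]
      exact memLp_two_of_periodic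
        (F.continuous.comp isOpenQuotientMap_toTorus.continuous) (isFunctionOn_comp_toTorus _)
    · have h1 := integral_cell fun y => ‖F y‖ ^ 2
      have h2 := (hasSum_sq_mFourierCoeff_continuous F).tsum_eq
      simp only [hFa] at h2
      simp only [hF, smul_eq_mul] at h1
      have h3 : ∫ k, ‖a k‖ ^ 2 ∂(Measure.count : Measure (Fin 3 → ℤ)) = ∑' k, ‖a k‖ ^ 2 := by
        refine (integral_countable ((memLp_two_iff_integrable_sq_norm ha2.1).1 ha2)).trans ?_
        simp [Measure.real]
      rw [h3, h2]
      exact h1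
  transform := by
    have hlift : ∀ f : E3 → ℝ, ContDiff ℝ ∞ f → SpatialDomain.torus.IsFunctionOn f →
        ∃ F : C(UnitAddTorus (Fin 3), ℂ), ∀ x, F (toTorus x) = f x := fun f hf hp =>
      exists_lift (f := fun x => (f x : ℂ)) (by have := hf.continuous; fun_prop)
        fun i x => congrArg Complex.ofReal (hp i x)
    refine ⟨fourierCoeffTorus, ((2 * Real.pi) ^ 3)⁻¹.toNNReal, fun f hf hp hf2 =>
      ⟨(measurable_of_countable _).aestronglyMeasurable, ?_, fun j _ => ?_, fun hi x => ?_⟩⟩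
    · obtain ⟨F, hF⟩ := hlift f hf hp
      have h1 := integral_cell fun y => ‖F y‖ ^ 2
      have h2 := hasSum_sq_mFourierCoeff_continuous F
      simp only [hF, Complex.norm_real, smul_eq_mul] at h1
      have h3 : ∫⁻ x, ‖f x‖ₑ ^ 2 ∂SpatialDomain.torus.vol =
          ENNReal.ofReal ((2 * Real.pi) ^ 3 * ∫ y, ‖F y‖ ^ 2) := by
        rw [← h1, ← SpatialDomain.vol, ofReal_integral_eq_lintegral_ofReal
          ((memLp_two_iff_integrable_sq_norm hf2.1).1 hf2) (ae_of_all _ fun x => sq_nonneg _)]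
        refine lintegral_congr fun x => ?_
        rw [ENNReal.ofReal_pow (norm_nonneg _), ofReal_norm]
      have h4 : ∫⁻ k, ‖fourierCoeffTorus f k‖ₑ ^ 2 ∂(Measure.count : Measure (Fin 3 → ℤ)) =
          ENNReal.ofReal (∫ y, ‖F y‖ ^ 2) := by
        rw [lintegral_count, ← h2.tsum_eq, ENNReal.ofReal_tsum_of_nonneg (fun k => sq_nonneg _)
          h2.summable]
        refine tsum_congr fun k => ?_
        rw [fourierCoeffTorus_eq hF, ENNReal.ofReal_pow (norm_nonneg _), ofReal_norm]
      rw [h3, h4, ← ENNReal.ofReal, ← ENNReal.ofReal_mul (by positivity), ← mul_assoc,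
        inv_mul_cancel₀ (by positivity), one_mul]
    · exact ae_of_all _ fun k => fourierCoeffTorus_pd hf hp j k
    · obtain ⟨F, hF⟩ := hlift f hf hp
      have h1 : fourierCoeffTorus f = UnitAddTorus.mFourierCoeff F :=
        funext (fourierCoeffTorus_eq hF)
      have h2 : Summable (UnitAddTorus.mFourierCoeff F) := by
        rw [← h1]; exact (integrable_count_iff.1 hi).of_norm
      rw [synth_latticeHom hi, ← hF,
        ← (UnitAddTorus.hasSum_mFourier_series_apply_of_summable h2 (toTorus x)).tsum_eq]
      refine tsum_congr fun k => ?_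
      rw [h1, mode_eq_mFourier, smul_eq_mul]
  lp ψ hψ q f a ham ha hfa x := by
    obtain ⟨F, hF, hFa⟩ := exists_torus_synth ha
    have h1 : ∀ k, fourierCoeffTorus f k = a k := fun k => by
      rw [fourierCoeffTorus_eq (F := F) fun x => by rw [hF, hfa], hFa]
    obtain ⟨L, -, hL, -⟩ := hψ.exists_bound
    have h2 : Integrable (fun k => (phiq ψ q (latticeHom k) : ℂ) * a k) Measure.count := by
      rw [integrable_count_iff] at ha ⊢
      refine Summable.of_norm_bounded (ha.mul_left L) fun k => ?_
      rw [norm_norm, norm_mul, Complex.norm_real]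
      gcongr
      exact hL q _
    rw [synth_latticeHom h2]
    refine tsum_congr fun k => ?_
    rw [h1, mul_comm (a k)]
    rfl

end Torus

end

section

open scoped ENNReal NNReal ComplexConjugate SchwartzMap LineDeriv

/-! ### The Fourier model of `ℝ³` -/

section Space

theorem ae_eq_of_integral_schwartz_mul_eq {f f' : E3 → ℂ} (hf : LocallyIntegrable f)
    (hf' : LocallyIntegrable f')
    (h : ∀ g : 𝓢(E3, ℂ), ∫ x, g x * f x = ∫ x, g x * f' x) : f =ᵐ[volume] f' := by
  refine ae_eq_of_integral_contDiff_smul_eq hf hf' fun g hg hs => ?_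
  have h1 : HasCompactSupport fun x => (g x : ℂ) := hs.comp_left Complex.ofReal_zero
  have h2 : ContDiff ℝ ∞ fun x => (g x : ℂ) := Complex.ofRealCLM.contDiff.comp hg
  simp only [Complex.real_smul]
  exact h (h1.toSchwartzMap h2)

theorem integral_schwartz_mul_fourier (g : 𝓢(E3, ℂ)) (A : Lp ℂ 2 (volume : Measure E3)) :
    ∫ x, g x * (𝓕 A : Lp ℂ 2 (volume : Measure E3)) x = ∫ x, (𝓕 g) x * A x := by
  have h := DFunLike.congr_fun (Lp.fourier_toTemperedDistribution_eq A) g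
  rw [TemperedDistribution.fourier_apply, Lp.toTemperedDistribution_apply,
    Lp.toTemperedDistribution_apply] at h
  exact h.symm

theorem integral_schwartz_mul_fourierInv (g : 𝓢(E3, ℂ)) (A : Lp ℂ 2 (volume : Measure E3)) :
    ∫ x, g x * (𝓕⁻ A : Lp ℂ 2 (volume : Measure E3)) x = ∫ x, (𝓕⁻ g) x * A x := by
  have h := DFunLike.congr_fun (Lp.fourierInv_toTemperedDistribution_eq A) g
  rw [TemperedDistribution.fourierInv_apply, Lp.toTemperedDistribution_apply,
    Lp.toTemperedDistribution_apply] at h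
  exact h.symm

theorem integral_mul_fourierInv {g a : E3 → ℂ} (hg : Integrable g) (ha : Integrable a) :
    ∫ x, g x * 𝓕⁻ a x = ∫ x, 𝓕⁻ g x * a x := by
  have h := VectorFourier.integral_fourierIntegral_smul_eq_flip (L := innerₗ E3)
    (μ := volume) (ν := volume) Real.continuous_fourierChar continuous_inner hg.comp_neg ha
  rw [flip_innerₗ] at h
  have h' : ∫ x, 𝓕 (fun x => g (-x)) x * a x = ∫ x, g (-x) * 𝓕 a x := h
  rw [← Real.fourierInv_eq_fourier_comp_neg] at h'
  rw [h', ← integral_neg_eq_self]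
  simp only [neg_neg, Real.fourierInv_eq_fourier_neg]

theorem continuous_fourierInv {a : E3 → ℂ} (ha : Integrable a) : Continuous (𝓕⁻ a) := by
  have h : Continuous (𝓕 a) := VectorFourier.fourierIntegral_continuous (L := innerₗ E3)
    Real.continuous_fourierChar continuous_inner ha
  have e : 𝓕⁻ a = fun x => 𝓕 a (-x) := funext fun x => Real.fourierInv_eq_fourier_neg a x
  rw [e]
  exact h.comp continuous_neg

/-- The abstract L² inverse transform and the integral formula are compared by testing with Schwartz
functions: each can be moved onto the test function. -/
theorem coeFn_fourierInv_toLp {a : E3 → ℂ} (ha : Integrable a) (ha2 : MemLp a 2) :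
    (𝓕⁻ (ha2.toLp a) : Lp ℂ 2 (volume : Measure E3)) =ᵐ[volume] 𝓕⁻ a := by
  refine ae_eq_of_integral_schwartz_mul_eq
    ((Lp.memLp _).locallyIntegrable (by norm_num)) (continuous_fourierInv ha).locallyIntegrable
    fun g => ?_
  rw [integral_schwartz_mul_fourierInv, integral_mul_fourierInv g.integrable ha,
    ← SchwartzMap.fourierInv_coe]
  refine integral_congr_ae ?_
  filter_upwards [ha2.coeFn_toLp] with x hx
  rw [hx]

/-- The frequency map of `ℝ³`, in the normalization of Mathlib's Fourier transform. -/
def scaleHom : E3 →+ E3 := DistribSMul.toAddMonoidHom E3 (2 * Real.pi)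

theorem scaleHom_apply (ξ : E3) : scaleHom ξ = (2 * Real.pi) • ξ := rfl

theorem norm_scaleHom (ξ : E3) : ‖scaleHom ξ‖ = 2 * Real.pi * ‖ξ‖ := by
  rw [scaleHom_apply, norm_smul, Real.norm_of_nonneg Real.two_pi_pos.le]

theorem continuous_scaleHom : Continuous scaleHom := continuous_const_smul (2 * Real.pi)

theorem synth_scaleHom (a : E3 → ℂ) (x : E3) : synth volume scaleHom a x = 𝓕⁻ a x := by
  rw [synth, Real.fourierInv_eq']
  refine integral_congr_ae (ae_of_all _ fun ξ => ?_)
  simp only [scaleHom_apply, inner_smul_left, smul_eq_mul, conj_trivial]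
  rw [mul_comm]
  congr 2
  ring

theorem isFreq_scaleHom : IsFreq volume scaleHom where
  meas := continuous_scaleHom.measurable
  vol := by
    refine ⟨(volume (Metric.ball (0 : E3) 1)).toNNReal, fun r => ?_⟩
    have hsub : {g : E3 | ‖scaleHom g‖₊ ≠ 0 ∧ ‖scaleHom g‖₊ ≤ r} ⊆ Metric.closedBall 0 r := by
      intro g hg
      rw [mem_closedBall_zero_iff]
      have h1 : ‖scaleHom g‖ ≤ r := NNReal.coe_le_coe.2 hg.2
      rw [norm_scaleHom] at h1
      have h2 : (1 : ℝ) ≤ 2 * Real.pi := by linarith [Real.pi_gt_three]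
      exact (le_mul_of_one_le_left (norm_nonneg g) h2).trans h1
    refine (measure_mono hsub).trans (le_of_eq ?_)
    rw [Measure.addHaar_closedBall _ _ r.coe_nonneg, ENNReal.coe_toNNReal measure_ball_lt_top.ne,
      finrank_euclideanSpace, Fintype.card_fin, mul_comm, ENNReal.ofReal_pow r.coe_nonneg,
      ENNReal.ofReal_coe_nnreal]
  inv_sq := by
    have h := integrable_rpow_neg_one_add_norm_sq (E := E3) (μ := volume) (r := 4) (by
      rw [finrank_euclideanSpace, Fintype.card_fin]; norm_num)
    refine lt_of_le_of_lt (lintegral_mono fun ξ => ?_) h.2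
    have h1 : ((1 + ‖scaleHom ξ‖ₑ ^ 2)⁻¹) ^ 2 =
        ENNReal.ofReal (((1 + ‖scaleHom ξ‖ ^ 2)⁻¹) ^ 2) := by
      rw [ENNReal.ofReal_pow (by positivity), ENNReal.ofReal_inv_of_pos (by positivity),
        ENNReal.ofReal_add zero_le_one (by positivity), ENNReal.ofReal_one,
        ENNReal.ofReal_pow (norm_nonneg _), ofReal_norm]
    have h2 : (1 + ‖ξ‖ ^ 2) ^ (-(4 : ℝ) / 2) = ((1 + ‖ξ‖ ^ 2)⁻¹) ^ 2 := by
      rw [show -(4 : ℝ) / 2 = -(2 : ℕ) by norm_num, Real.rpow_neg (by positivity),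
        Real.rpow_natCast, inv_pow]
    simp only [h2]
    rw [h1, ← ofReal_norm, Real.norm_of_nonneg (by positivity), norm_scaleHom]
    refine ENNReal.ofReal_le_ofReal ?_
    have h3 : (1 : ℝ) ≤ 2 * Real.pi := by linarith [Real.pi_gt_three]
    gcongr
    exact le_mul_of_one_le_left (norm_nonneg _) h3

theorem memLp_synth_scaleHom {a : E3 → ℂ} (ha : Integrable a) (ha2 : MemLp a 2) :
    MemLp (synth volume scaleHom a) 2 ∧
      ∫ x, ‖synth volume scaleHom a x‖ ^ 2 = ∫ ξ, ‖a ξ‖ ^ 2 := by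
  have e : synth volume scaleHom a = 𝓕⁻ a := funext (synth_scaleHom a)
  have hae := coeFn_fourierInv_toLp ha ha2
  have hm : MemLp (𝓕⁻ a) 2 := (memLp_congr_ae hae).1 (Lp.memLp _)
  rw [e]
  refine ⟨hm, ?_⟩
  have h1 : ∀ f : Lp ℂ 2 (volume : Measure E3), ∫ x, ‖f x‖ ^ 2 = ‖f‖ ^ 2 := fun f => by
    have h := L2.inner_def (𝕜 := ℂ) f f
    simp only [inner_self_eq_norm_sq_to_K] at h
    have h' : ((‖f‖ ^ 2 : ℝ) : ℂ) = ∫ x, ((‖f x‖ ^ 2 : ℝ) : ℂ) := by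
      push_cast
      exact h
    rw [integral_complex_ofReal, Complex.ofReal_inj] at h'
    exact h'.symm
  have h2 : ‖(𝓕⁻ (ha2.toLp a) : Lp ℂ 2 (volume : Measure E3))‖ = ‖ha2.toLp a‖ :=
    (Lp.fourierTransformₗᵢ E3 ℂ).symm.norm_map _
  have h3 := h1 (𝓕⁻ (ha2.toLp a))
  rw [h2, ← h1] at h3
  refine Eq.trans ?_ (h3.trans ?_)
  · refine integral_congr_ae ?_
    filter_upwards [hae] with x hx
    rw [hx]
  · refine integral_congr_ae ?_
    filter_upwards [ha2.coeFn_toLp] with x hx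
    rw [hx]

/-- The transform of `ℝ³` on square integrable functions. -/
def fourierL2 (f : E3 → ℝ) : E3 → ℂ :=
  open scoped Classical in
  if hf : MemLp (fun x => (f x : ℂ)) 2 volume then
    (𝓕 (hf.toLp _) : Lp ℂ 2 (volume : Measure E3)) else 0

theorem fourierL2_eq {f : E3 → ℝ} (hf : MemLp (fun x => (f x : ℂ)) 2 volume) :
    fourierL2 f = (𝓕 (hf.toLp _) : Lp ℂ 2 (volume : Measure E3)) := dif_pos hf

theorem integral_schwartz_mul_fourierL2 (g : 𝓢(E3, ℂ)) {f : E3 → ℝ}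
    (hf : MemLp (fun x => (f x : ℂ)) 2 volume) :
    ∫ x, g x * fourierL2 f x = ∫ x, (𝓕 g) x * (f x : ℂ) := by
  rw [fourierL2_eq hf, integral_schwartz_mul_fourier]
  refine integral_congr_ae ?_
  filter_upwards [hf.coeFn_toLp] with x hx
  rw [hx]

theorem memLp_fourierL2 {f : E3 → ℝ} (hf : MemLp (fun x => (f x : ℂ)) 2 volume) :
    MemLp (fourierL2 f) 2 volume := by
  rw [fourierL2_eq hf]; exact Lp.memLp _

theorem locallyIntegrable_der {b : E3 → ℂ} (hb : LocallyIntegrable b) (j : Fin 3) :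
    LocallyIntegrable (der scaleHom j b) := by
  have hι : Continuous fun ξ : E3 => Complex.I * ((scaleHom ξ j : ℝ) : ℂ) := by
    have := continuous_scaleHom
    fun_prop
  rw [← locallyIntegrableOn_univ] at hb ⊢
  exact hb.continuousOn_mul hι.continuousOn isOpen_univ.isLocallyClosed

/-- All three products in the integration by parts are integrable, being products of two square
integrable functions, so there is no boundary term. -/
theorem integral_schwartz_mul_pd (h : 𝓢(E3, ℂ)) {f : E3 → ℝ} (hd : Differentiable ℝ f)
    (hf : MemLp (fun x => (f x : ℂ)) 2 volume) (j : Fin 3)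
    (hf' : MemLp (fun x => (pd j f x : ℂ)) 2 volume) :
    ∫ x, h x * (pd j f x : ℂ) = -∫ x, (∂_{EuclideanSpace.single j (1 : ℝ)} h) x * (f x : ℂ) := by
  have hpd : ∀ x, fderiv ℝ (fun x => (f x : ℂ)) x (EuclideanSpace.single j 1) = (pd j f x : ℂ) :=
    fun x => by
      have h := (Complex.ofRealCLM.hasFDerivAt.comp x (hd x).hasFDerivAt).fderiv
      exact congrArg (fun L : E3 →L[ℝ] ℂ => L (EuclideanSpace.single j 1)) h
  have i1 : Integrable (fun x => (∂_{EuclideanSpace.single j (1 : ℝ)} h) x * (f x : ℂ)) :=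
    ((∂_{EuclideanSpace.single j (1 : ℝ)} h).memLp 2).integrable_mul hf
  have i2 : Integrable (fun x => h x * (pd j f x : ℂ)) := (h.memLp 2).integrable_mul hf'
  have i3 : Integrable (fun x => h x * (f x : ℂ)) := (h.memLp 2).integrable_mul hf
  have h3 := integral_mul_fderiv_eq_neg_fderiv_mul_of_integrable (μ := (volume : Measure E3))
    (f := h) (g := fun x => (f x : ℂ)) (v := EuclideanSpace.single j 1) i1
    (by simp only [hpd]; exact i2) i3
    (fun x _ => h.differentiableAt)
    (fun x _ => (Complex.ofRealCLM.differentiableAt.comp x (hd x)))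
  simp only [hpd] at h3
  exact h3

/-- The transform of a partial derivative. -/
theorem fourierL2_pd {f : E3 → ℝ} (hd : Differentiable ℝ f)
    (hf : MemLp (fun x => (f x : ℂ)) 2 volume) (j : Fin 3)
    (hf' : MemLp (fun x => (pd j f x : ℂ)) 2 volume) :
    fourierL2 (pd j f) =ᵐ[volume] der scaleHom j (fourierL2 f) := by
  have l1 := (memLp_fourierL2 hf').locallyIntegrable (by norm_num)
  have l2 := locallyIntegrable_der ((memLp_fourierL2 hf).locallyIntegrable (by norm_num)) j
  refine ae_eq_of_integral_schwartz_mul_eq l1 l2 fun g => ?_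
  set e : E3 := EuclideanSpace.single j 1 with he
  have hinner : ∀ x : E3, inner ℝ x e = x j := fun x => by
    rw [he, EuclideanSpace.inner_single_right]; simp
  have htemp : (fun x : E3 => inner ℝ x e).HasTemperateGrowth := by fun_prop
  -- The function g' is -2πi x_j g, the multiplier whose transform is the derivative of the
  -- transform of g. Its 2π matches the scaling in `scaleHom`.
  obtain ⟨g', hg', h1⟩ : ∃ g' : 𝓢(E3, ℂ), (∀ x, g' x = -(2 * Real.pi * Complex.I) * (x j * g x)) ∧
      ∂_{e} (𝓕 g) = 𝓕 g' := by
    refine ⟨_, fun x => ?_, SchwartzMap.lineDerivOp_fourier_eq g e⟩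
    have h3 := SchwartzMap.smulLeftCLM_apply_apply (F := ℂ) htemp g x
    rw [smul_apply, h3, hinner]
    simp
  have h2 : ∀ x, g x * der scaleHom j (fourierL2 f) x = -(g' x * fourierL2 f x) := fun x => by
    rw [hg']
    simp only [der, scaleHom_apply, PiLp.smul_apply, smul_eq_mul]
    push_cast
    ring
  simp only [h2]
  rw [integral_neg, integral_schwartz_mul_fourierL2 g hf', integral_schwartz_mul_fourierL2 g' hf,
    ← h1]
  exact integral_schwartz_mul_pd (𝓕 g) hd hf j hf'

/-- A continuous square integrable function with integrable transform is the synthesis of it. -/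
theorem eq_synth_fourierL2 {f : E3 → ℝ} (hc : Continuous f)
    (hf : MemLp (fun x => (f x : ℂ)) 2 volume) (hi : Integrable (fourierL2 f) volume) (x : E3) :
    (f x : ℂ) = synth volume scaleHom (fourierL2 f) x := by
  rw [synth_scaleHom]
  have hm := memLp_fourierL2 hf
  have h1 := coeFn_fourierInv_toLp hi hm
  have h2 : hm.toLp (fourierL2 f) = 𝓕 (hf.toLp _) := by
    refine Lp.ext (hm.coeFn_toLp.trans ?_)
    rw [fourierL2_eq hf]
  rw [h2, FourierTransform.fourierInv_fourier_eq] at h1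
  have h3 := hf.coeFn_toLp.symm.trans h1
  have h4 : (fun x => (f x : ℂ)) = 𝓕⁻ (fourierL2 f) :=
    Measure.eq_of_ae_eq h3 (Complex.continuous_ofReal.comp hc) (continuous_fourierInv hi)
  exact congrFun h4 x

/-- By Fubini the convolution acts on each wave e^{iξ·x} separately and multiplies it by the
transform of the kernel, which is φ_q by Fourier inversion. The kernel is integrable since φ_q is
smooth with compact support. -/
theorem lpScalar_space {ψ : E3 → ℝ} (hψ : IsCutoff ψ) (q : ℤ) {f : E3 → ℝ} {a : E3 → ℂ}
    (ha : Integrable a) (hfa : ∀ x, (f x : ℂ) = synth volume scaleHom a x) (x : E3) :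
    lpScalar .space ψ q f x = synth volume scaleHom (fun ξ => (phiq ψ q (scaleHom ξ) : ℂ) * a ξ) x := by
  have hφs : ContDiff ℝ ∞ fun η : E3 => (phiq ψ q ((2 * Real.pi) • η) : ℂ) :=
    Complex.ofRealCLM.contDiff.comp ((contDiff_phiq hψ q).comp (contDiff_const_smul _))
  have hφc : HasCompactSupport fun η : E3 => (phiq ψ q ((2 * Real.pi) • η) : ℂ) :=
    ((hasCompactSupport_phiq hψ q).comp_homeomorph
      (Homeomorph.smulOfNeZero (2 * Real.pi) Real.two_pi_pos.ne')).comp_left Complex.ofReal_zero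
  set Φ : 𝓢(E3, ℂ) := hφc.toSchwartzMap hφs with hΦ
  have hker : lpKernel ψ q = (𝓕⁻ Φ : 𝓢(E3, ℂ)) := by
    rw [SchwartzMap.fourierInv_coe]; rfl
  have hki : Integrable (lpKernel ψ q) volume := by rw [hker]; exact (𝓕⁻ Φ).integrable
  have hinv : ∀ ξ, ∫ y, Complex.exp (-(Complex.I * (inner ℝ (scaleHom ξ) y : ℝ))) * lpKernel ψ q y =
      (phiq ψ q (scaleHom ξ) : ℂ) := by
    intro ξ
    have h1 : 𝓕 (𝓕⁻ Φ) = Φ := FourierTransform.fourier_fourierInv_eq Φ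
    have h2 := DFunLike.congr_fun h1 ξ
    rw [SchwartzMap.fourier_coe, ← hker, Real.fourier_eq'] at h2
    refine Eq.trans (integral_congr_ae (ae_of_all _ fun y => ?_)) h2
    simp only [scaleHom_apply, inner_smul_left, smul_eq_mul, conj_trivial, real_inner_comm ξ y]
    congr 2
    push_cast
    ring
  have hprod : Integrable (fun z : E3 × E3 => (a z.2 *
      Complex.exp (Complex.I * (inner ℝ (scaleHom z.2) (x - z.1) : ℝ))) * lpKernel ψ q z.1)
      (volume.prod volume) := by
    have h1 : Integrable (fun z : E3 × E3 => lpKernel ψ q z.1 * a z.2) (volume.prod volume) :=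
      hki.mul_prod ha
    have hcs := continuous_scaleHom
    refine h1.mono ?_ (ae_of_all _ fun z => ?_)
    · have h2 : Continuous fun z : E3 × E3 =>
          Complex.exp (Complex.I * (inner ℝ (scaleHom z.2) (x - z.1) : ℝ)) := by fun_prop
      refine (h1.aestronglyMeasurable.mul h2.aestronglyMeasurable).congr
        (ae_of_all _ fun z => ?_)
      simp only [Pi.mul_apply]
      ring
    · simp only [norm_mul, norm_exp_I_inner, mul_one]
      rw [mul_comm]
  calc lpScalar .space ψ q f x
      = ∫ y, ∫ ξ, (a ξ * Complex.exp (Complex.I * (inner ℝ (scaleHom ξ) (x - y) : ℝ))) *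
          lpKernel ψ q y := by
        simp only [lpScalar, hfa, synth, integral_mul_const]
    _ = ∫ ξ, ∫ y, (a ξ * Complex.exp (Complex.I * (inner ℝ (scaleHom ξ) (x - y) : ℝ))) *
          lpKernel ψ q y := integral_integral_swap hprod
    _ = _ := by
        refine integral_congr_ae (ae_of_all _ fun ξ => ?_)
        simp only
        rw [← hinv ξ, ← integral_mul_const, ← integral_mul_const]
        refine integral_congr_ae (ae_of_all _ fun y => ?_)
        simp only [inner_sub_right]
        push_cast
        rw [mul_sub, sub_eq_add_neg, Complex.exp_add]
        ring

theorem isFourierModel_space : IsFourierModel SpatialDomain.space (volume : Measure E3) scaleHom 1 := by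
  have hvol : SpatialDomain.space.vol = volume := Measure.restrict_univ
  have hC : ∀ {f : E3 → ℝ}, MemLp f 2 SpatialDomain.space.vol →
      MemLp (fun x => (f x : ℂ)) 2 volume := fun {f} hf => by
    rw [hvol] at hf; exact hf.ofReal
  refine ⟨isFreq_scaleHom, one_pos, fun a _ ha ha2 => ?_, ⟨fourierL2, 1, fun f hf _ hf2 => ⟨?_, ?_,
    fun j hj => fourierL2_pd (hf.differentiable (by simp)) (hC hf2) j (hC hj),
    eq_synth_fourierL2 hf.continuous (hC hf2)⟩⟩,
    fun ψ hψ q f a _ ha hfa x => lpScalar_space hψ q ha hfa x⟩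
  · rw [hvol, one_mul]
    exact memLp_synth_scaleHom ha ha2
  · exact (memLp_fourierL2 (hC hf2)).1
  · have h1 : eLpNorm (fourierL2 f) 2 volume = eLpNorm f 2 volume := by
      have h2 := Lp.norm_fourier_eq ((hC hf2).toLp _)
      rw [Lp.norm_def, Lp.norm_def, ENNReal.toReal_eq_toReal_iff' (Lp.eLpNorm_ne_top _)
        (Lp.eLpNorm_ne_top _), eLpNorm_congr_ae (hC hf2).coeFn_toLp] at h2
      rw [fourierL2_eq (hC hf2), h2]
      exact eLpNorm_congr_norm_ae (ae_of_all _ fun x => by simp)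
    rw [hvol, ENNReal.coe_one, one_mul]
    refine (lintegral_sq_le_of_eLpNorm_le h1.le).trans (le_of_eq ?_)
    rw [eLpNorm_eq_lintegral_rpow_enorm_toReal (by simp) (by simp), ← ENNReal.rpow_natCast,
      ← ENNReal.rpow_mul]
    norm_num

end Space

end

/-! ### The theorem -/

theorem tsum_sq_le_sq_tsum {f : ℤ → ℝ} (h0 : ∀ q, 0 ≤ f q) (hf : Summable f)
    (hf2 : Summable fun q => f q ^ 2) : ∑' q, f q ^ 2 ≤ (∑' q, f q) ^ 2 := by
  rw [sq (∑' q, f q), ← tsum_mul_left]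
  refine hf2.tsum_le_tsum (fun q => ?_) (hf.mul_left _)
  rw [sq]
  exact mul_le_mul_of_nonneg_right (hf.le_tsum q fun r _ => h0 r) (h0 q)

theorem exists_energy_inequality {ψ : E3 → ℝ} (hψ : IsCutoff ψ) :
    ∃ C : ℝ, 0 < C ∧ ∀ (Ω : SpatialDomain) (ν T : ℝ) (u₀ : E3 → E3) (u : ℝ → E3 → E3)
      (p : ℝ → E3 → ℝ), 0 < ν → IsSmoothSolution Ω ν T u₀ u p → ∀ t ∈ Ioo 0 T,
        (∀ q : ℤ, MemLp (lpPiece Ω ψ q (u t)) 2 Ω.vol) ∧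
        Summable (fun q : ℤ => shell Ω ψ (u t) q) ∧
        Summable (fun q : ℤ => shell Ω ψ (u t) q ^ 2) ∧
        (∀ q : ℤ, 0 ≤ shell Ω ψ (u t) q) ∧
        DifferentiableAt ℝ (fun s => ∑' q : ℤ, shell Ω ψ (u s) q) t ∧
        deriv (fun s => ∑' q : ℤ, shell Ω ψ (u s) q) t
          ≤ C * ν⁻¹ * ∑' q : ℤ, shell Ω ψ (u t) q ^ 2 := by
  obtain ⟨C₁, h₁, H₁⟩ := isFourierModel_space.exists_energy_inequality hψ
  obtain ⟨C₂, h₂, H₂⟩ := isFourierModel_torus.exists_energy_inequality hψ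
  -- Each domain has its own constant, depending only on ψ; the maximum serves both.
  refine ⟨max C₁ C₂, lt_max_of_lt_left h₁, fun Ω ν T u₀ u p hν hs t ht => ?_⟩
  have hmono : ∀ {C : ℝ}, C ≤ max C₁ C₂ →
      C * ν⁻¹ * ∑' q : ℤ, shell Ω ψ (u t) q ^ 2 ≤
        max C₁ C₂ * ν⁻¹ * ∑' q : ℤ, shell Ω ψ (u t) q ^ 2 := fun hC =>
    mul_le_mul_of_nonneg_right (mul_le_mul_of_nonneg_right hC (inv_nonneg.2 hν.le))
      (tsum_nonneg fun q => sq_nonneg _)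
  cases Ω with
  | space =>
    obtain ⟨a1, a2, a3, a4, a5, a6⟩ := H₁ ν T u₀ u p hν hs t ht
    exact ⟨a1, a2, a3, a4, a5, a6.trans (hmono (le_max_left _ _))⟩
  | torus =>
    obtain ⟨a1, a2, a3, a4, a5, a6⟩ := H₂ ν T u₀ u p hν hs t ht
    exact ⟨a1, a2, a3, a4, a5, a6.trans (hmono (le_max_right _ _))⟩

end NSE

end

theorem theorem1 (ψ : NSE.E3 → ℝ) (hψ : NSE.IsCutoff ψ) :
    ∃ C : ℝ, 0 < C ∧
      ∀ (Ω : NSE.SpatialDomain) (ν T : ℝ) (u₀ : NSE.E3 → NSE.E3)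
        (u : ℝ → NSE.E3 → NSE.E3) (p : ℝ → NSE.E3 → ℝ),
        0 < ν → NSE.IsSmoothSolution Ω ν T u₀ u p →
        ∀ t ∈ Set.Ioo 0 T,
          (∀ q : ℤ, MeasureTheory.MemLp (NSE.lpPiece Ω ψ q (u t)) 2 Ω.vol) ∧
          Summable (fun q : ℤ => NSE.shell Ω ψ (u t) q) ∧
          DifferentiableAt ℝ (fun s => ∑' q : ℤ, NSE.shell Ω ψ (u s) q) t ∧
          deriv (fun s => ∑' q : ℤ, NSE.shell Ω ψ (u s) q) t
            ≤ C * ν⁻¹ * ∑' q : ℤ, (NSE.shell Ω ψ (u t) q) ^ 2 ∧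
          deriv (fun s => ∑' q : ℤ, NSE.shell Ω ψ (u s) q) t
            ≤ C * ν⁻¹ * (∑' q : ℤ, NSE.shell Ω ψ (u t) q) ^ 2 := by
  obtain ⟨C, hC, H⟩ := NSE.exists_energy_inequality hψ
  refine ⟨C, hC, fun Ω ν T u₀ u p hν hs t ht => ?_⟩
  obtain ⟨h1, h2, h3, h4, h5, h6⟩ := H Ω ν T u₀ u p hν hs t ht
  refine ⟨h1, h2, h5, h6, h6.trans ?_⟩
  exact mul_le_mul_of_nonneg_left (NSE.tsum_sq_le_sq_tsum h4 h2 h3)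
    (mul_nonneg hC.le (inv_nonneg.2 hν.le))
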